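/- Let $\mathbb X$ be a virtual equipment, i.e. a virtual double category (objects, tight-cells $\to$, loose-cells, and 2-cells $p_1,\dots,p_n\Rightarrow q$) with loose-identities $A(1,1)$ and restrictions $p(f,g)$; write $B(f,g):=B(1,1)(f,g)$. Let $j\colon A\to E$ be a dense tight-cell, i.e. $1_E$ is, via the identity of $E(j,1)$, the $E(j,1)$-weighted colimit of $j$, and let $r\colon D\to E$ be a tight-cell. A left $j$-adjoint of $r$ is a tight-cell $\ell\colon A\to D$ with an isomorphism $D(\ell,1)\cong E(j,r)$; it induces a $j$-relative monad $T$ with carrier $t=r\ell$, given by a unit $j\Rightarrow t$ and an extension operator $E(j,t)\Rightarrow E(t,t)$. An algebra object for $T$ is a universal $T$-algebra $(u_T\colon\mathbf{Alg}(T)\to E,\ E(j,u_T)\Rightarrow E(t,u_T))$, universal with respect to algebras and to graded algebra morphisms $p_1,\dots,p_n\Rightarrow E(e,e')$. Then $r$ is *strictly* (resp. *non-strictly*) *$j$-monadic* if it has a left $j$-adjoint $\ell$, the induced $j$-monad $T$ has an algebra object, and the comparison tight-cell $D\to\mathbf{Alg}(T)$ (commuting with $\ell$ and the free tight-cell $f_T$,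 and with $r$ and $u_T$) is an isomorphism (resp. an equivalence). A weighted colimit $(p*f,\lambda\colon p\Rightarrow E(f,p*f))$ in $E$ is *$j$-absolute* if the composite $E(j,f)\odot p$ exists and the canonical 2-cell $E(j,f)\odot p\Rightarrow E(j,p*f)$ is invertible. A colimit $(p*(rf),\lambda)$ in $E$ is *strictly created* by $r$ if there is a unique $p$-cocone $(w,\lambda')$ for $f$ with $rw=p*(rf)$ and $r\lambda'=\lambda$, and moreover $(w,\lambda')$ is the colimit $p*f$; it is *non-strictly created* by $r$ if $p*f$ exists and a $p$-cocone for $f$ is a colimit if and only if its image under $r$ is. Then: 1. $r$ is strictly $j$-monadic if and only if $r$ has a left $j$-adjoint whose induced $j$-monad has an algebra object, and $r$ strictly creates all $j$-absolute colimits. 2. $r$ is non-strictly $j$-monadic if and only if $r$ has a left $j$-adjoint whose induced $j$-monad has an algebra object, and $r$ non-strictly creates all $j$-absolute colimits. 3. Call $q$ a left-composite of $E(j,f),p$, exhibited by a 2-cell $E(j,f),p\Rightarrow q$, if every 2-cell with domain $E(j,f),p,q_1,\dots,q_n$ factors uniquely through it (whereas for a composite this is required for all domains $r_1,\dots,r_m,E(j,f),p,q_1,\dots,q_n$).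 If every left-composite of the form $E(j,f),p\Rightarrow q$ is a composite, then 1 and 2 also hold with "$j$-absolute" defined by left-composites in place of composites. -/

import Mathlib

open CategoryTheory

universe z w v u

set_option linter.checkUnivs false

namespace FormalCat

/-! ### Virtual double categories -/

/-- Finite composable chains of loose-cells.  `L A B` is to be thought of as the type of
loose-cells whose left end is `A` and whose right end is `B`, so that a chain `p₁, …, pₙ` starts
at its leftmost object `A₀` and ends at its rightmost object `Aₙ`. -/
inductive Chain {X : Type u} (L : X → X → Type w) : X → X → Type (max u w)
  | nil (A : X) : Chain L A A
  | cons {A B C : X} (p : L A B) (P : Chain L B C) : Chain L A C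

/-- Concatenation of chains. -/
@[reducible] def Chain.append {X : Type u} {L : X → X → Type w} :
    {A B C : X} → Chain L A B → Chain L B C → Chain L A C
  | _, _, _, .nil _, Q => Q
  | _, _, _, .cons p P, Q => .cons p (P.append Q)

/-- The chain consisting of one loose-cell. -/
abbrev Chain.single {X : Type u} {L : X → X → Type w} {A B : X} (p : L A B) : Chain L A B :=
  .cons p (.nil B)

theorem Chain.append_nil {X : Type u} {L : X → X → Type w} {A B : X} (P : Chain L A B) :
    P.append (.nil B) = P := by
  induction P with
  | nil A => rfl
  | cons p P ih => simp only [Chain.append, ih]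

theorem Chain.append_assoc {X : Type u} {L : X → X → Type w} {A B C D : X}
    (P : Chain L A B) (Q : Chain L B C) (R : Chain L C D) :
    (P.append Q).append R = P.append (Q.append R) := by
  induction P with
  | nil A => rfl
  | cons p P ih => simp only [Chain.append, ih]

/-- The cells of a virtual double category, without operations: objects and tight-cells form a
category; `Loose A B` is the type of loose-cells with left end `A` and right end `B` (that is,
loose-cells from `B` to `A`); and `Cell f g P q` is the type of 2-cells with left boundary `f`,
right boundary `g`, domain the chain `P` and codomain the loose-cell `q`. -/
class VDCGraph (X : Type u) extends Category.{v} X where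
  Loose : X → X → Type w
  Cell : {A₀ A₁ B₀ B₁ : X} → (A₀ ⟶ B₀) → (A₁ ⟶ B₁) → Chain Loose A₀ A₁ → Loose B₀ B₁ → Type z

open VDCGraph (Loose Cell)

/-- Chains of loose-cells of `X`. -/
abbrev LChain {X : Type u} [VDCGraph.{z, w, v, u} X] (A B : X) : Type (max u w) :=
  Chain (Loose (X := X)) A B

/-- `Cells f g P Q` is the type of horizontally composable sequences of 2-cells
`φ₁ : P₁ ⇒ q₁, …, φₘ : Pₘ ⇒ qₘ`, whose concatenated domain `P₁, …, Pₘ` is `P`, whose codomains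
form the chain `Q = q₁, …, qₘ`, and whose outer boundaries are `f` and `g`. -/
inductive Cells {X : Type u} [VDCGraph.{z, w, v, u} X] :
    {A₀ A₁ B₀ B₁ : X} → (A₀ ⟶ B₀) → (A₁ ⟶ B₁) →
      LChain A₀ A₁ → LChain B₀ B₁ → Type (max u v w z)
  | nil {A B : X} (f : A ⟶ B) : Cells f f (.nil A) (.nil B)
  | cons {A₀ A₁ A₂ B₀ B₁ B₂ : X} {f : A₀ ⟶ B₀} {g : A₁ ⟶ B₁} {h : A₂ ⟶ B₂}
      {P : LChain A₀ A₁} {P' : LChain A₁ A₂} {R : LChain A₀ A₂}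
      {q : Loose B₀ B₁} {Q : LChain B₁ B₂}
      (φ : Cell f g P q) (Φ : Cells g h P' Q) (e : R = P.append P') : Cells f h R (.cons q Q)

section

variable {X : Type u} [VDCGraph.{z, w, v, u} X]

/-- The sequence consisting of one 2-cell. -/
abbrev Cells.single {A₀ A₁ B₀ B₁ : X} {f : A₀ ⟶ B₀} {g : A₁ ⟶ B₁} {P : LChain A₀ A₁}
    {q : Loose B₀ B₁} (φ : Cell f g P q) : Cells f g P (.single q) :=
  .cons φ (.nil g) P.append_nil.symm

/-- Concatenation of sequences of 2-cells. -/
def Cells.append :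
    {A₀ A₁ A₂ B₀ B₁ B₂ : X} → {f : A₀ ⟶ B₀} → {g : A₁ ⟶ B₁} → {h : A₂ ⟶ B₂} →
    {P : LChain A₀ A₁} → {P' : LChain A₁ A₂} → {Q : LChain B₀ B₁} → {Q' : LChain B₁ B₂} →
    Cells f g P Q → Cells g h P' Q' → Cells f h (P.append P') (Q.append Q')
  | _, _, _, _, _, _, _, _, _, _, _, _, _, .nil _, Φ' => Φ'
  | _, _, _, _, _, _, _, _, _, _, _, _, _, .cons φ Φ e, Φ' =>
      .cons φ (Φ.append Φ') (by rw [e, Chain.append_assoc])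

end

/-- The operations of a virtual double category: identity 2-cells, and composition of a 2-cell
`ψ : q₁, …, qₘ ⇒ r` with a sequence of 2-cells `φᵢ : Pᵢ ⇒ qᵢ`.  The boundaries of the composite
are the composites of the boundaries; they are passed as `k`, `l` with proofs that `f ≫ f' = k`
and `g ≫ g' = l`, to avoid transporting along the category laws for tight-cells. -/
class VDCOps (X : Type u) extends VDCGraph.{z, w, v, u} X where
  idCell : {A B : X} → (p : Loose A B) → Cell (𝟙 A) (𝟙 B) (.single p) p
  paste : {A₀ A₁ B₀ B₁ C₀ C₁ : X} → {f : A₀ ⟶ B₀} → {g : A₁ ⟶ B₁} → {f' : B₀ ⟶ C₀} →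
    {g' : B₁ ⟶ C₁} → {k : A₀ ⟶ C₀} → {l : A₁ ⟶ C₁} →
    {P : LChain A₀ A₁} → {Q : LChain B₀ B₁} → {r : Loose C₀ C₁} →
    Cells f g P Q → Cell f' g' Q r → f ≫ f' = k → g ≫ g' = l → Cell k l P r

open VDCOps (idCell paste)

/-- The sequence of identity 2-cells on a chain. -/
def Cells.id {X : Type u} [VDCOps.{z, w, v, u} X] :
    {A B : X} → (P : LChain A B) → Cells (𝟙 A) (𝟙 B) P P
  | _, _, .nil A => .nil (𝟙 A)
  | _, _, .cons p P => .cons (idCell p) (Cells.id P) rfl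

/-- Composable data for the associativity law: a sequence of 2-cells `ψᵢ : Qᵢ ⇒ rᵢ`, together
with, for every `i`, a sequence of 2-cells with codomain `Qᵢ`.  Here `P`, `Q`, `R` are the total
domain, the total middle chain and the chain of codomains, `f, g` and `f', g'` are the outer
boundaries of the two levels, and `k, l` their composites. -/
inductive TwoLevel {X : Type u} [VDCOps.{z, w, v, u} X] :
    {A₀ A₁ B₀ B₁ C₀ C₁ : X} → (A₀ ⟶ B₀) → (A₁ ⟶ B₁) → (B₀ ⟶ C₀) → (B₁ ⟶ C₁) →
      (A₀ ⟶ C₀) → (A₁ ⟶ C₁) → LChain A₀ A₁ → LChain B₀ B₁ → LChain C₀ C₁ →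
      Type (max u v w z)
  | nil {A B C : X} (f : A ⟶ B) (f' : B ⟶ C) {k : A ⟶ C} (hk : f ≫ f' = k) :
      TwoLevel f f f' f' k k (.nil A) (.nil B) (.nil C)
  | cons {A₀ A₁ A₂ B₀ B₁ B₂ C₀ C₁ C₂ : X} {f : A₀ ⟶ B₀} {g : A₁ ⟶ B₁} {h : A₂ ⟶ B₂}
      {f' : B₀ ⟶ C₀} {g' : B₁ ⟶ C₁} {h' : B₂ ⟶ C₂}
      {k : A₀ ⟶ C₀} {l : A₁ ⟶ C₁} {m : A₂ ⟶ C₂}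
      {P : LChain A₀ A₁} {P' : LChain A₁ A₂} {Q : LChain B₀ B₁} {Q' : LChain B₁ B₂}
      {r : Loose C₀ C₁} {R : LChain C₁ C₂}
      (Φ : Cells f g P Q) (ψ : Cell f' g' Q r) (hk : f ≫ f' = k) (hl : g ≫ g' = l)
      (T : TwoLevel g h g' h' l m P' Q' R) :
      TwoLevel f h f' h' k m (P.append P') (Q.append Q') (.cons r R)

section

variable {X : Type u} [VDCOps.{z, w, v, u} X]

/-- The upper level, as one sequence of 2-cells. -/
def TwoLevel.top : {A₀ A₁ B₀ B₁ C₀ C₁ : X} → {f : A₀ ⟶ B₀} → {g : A₁ ⟶ B₁} → {f' : B₀ ⟶ C₀} →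
    {g' : B₁ ⟶ C₁} → {k : A₀ ⟶ C₀} → {l : A₁ ⟶ C₁} →
    {P : LChain A₀ A₁} → {Q : LChain B₀ B₁} → {R : LChain C₀ C₁} →
    TwoLevel f g f' g' k l P Q R → Cells f g P Q
  | _, _, _, _, _, _, _, _, _, _, _, _, _, _, _, .nil f _ _ => .nil f
  | _, _, _, _, _, _, _, _, _, _, _, _, _, _, _, .cons Φ _ _ _ T => Φ.append T.top

/-- The lower level, as one sequence of 2-cells. -/
def TwoLevel.bot : {A₀ A₁ B₀ B₁ C₀ C₁ : X} → {f : A₀ ⟶ B₀} → {g : A₁ ⟶ B₁} → {f' : B₀ ⟶ C₀} →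
    {g' : B₁ ⟶ C₁} → {k : A₀ ⟶ C₀} → {l : A₁ ⟶ C₁} →
    {P : LChain A₀ A₁} → {Q : LChain B₀ B₁} → {R : LChain C₀ C₁} →
    TwoLevel f g f' g' k l P Q R → Cells f' g' Q R
  | _, _, _, _, _, _, _, _, _, _, _, _, _, _, _, .nil _ f' _ => .nil f'
  | _, _, _, _, _, _, _, _, _, _, _, _, _, _, _, .cons _ ψ _ _ T => .cons ψ T.bot rfl

/-- The sequence of the composites of the two levels. -/
def TwoLevel.vert : {A₀ A₁ B₀ B₁ C₀ C₁ : X} → {f : A₀ ⟶ B₀} → {g : A₁ ⟶ B₁} → {f' : B₀ ⟶ C₀} →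
    {g' : B₁ ⟶ C₁} → {k : A₀ ⟶ C₀} → {l : A₁ ⟶ C₁} →
    {P : LChain A₀ A₁} → {Q : LChain B₀ B₁} → {R : LChain C₀ C₁} →
    TwoLevel f g f' g' k l P Q R → Cells k l P R
  | _, _, _, _, _, _, _, _, _, _, _, _, _, _, _, .nil (k := k) _ _ _ => .nil k
  | _, _, _, _, _, _, _, _, _, _, _, _, _, _, _, .cons Φ ψ hk hl T =>
      .cons (paste Φ ψ hk hl) T.vert rfl

end

/-- A virtual double category: the unit laws and the associativity law hold. -/
class VirtualDoubleCategory (X : Type u) extends VDCOps.{z, w, v, u} X where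
  id_paste : ∀ {A₀ A₁ B₀ B₁ : X} {f : A₀ ⟶ B₀} {g : A₁ ⟶ B₁} {P : LChain A₀ A₁}
    {q : Loose B₀ B₁} (φ : Cell f g P q),
    paste (Cells.id P) φ (Category.id_comp f) (Category.id_comp g) = φ
  paste_id : ∀ {A₀ A₁ B₀ B₁ : X} {f : A₀ ⟶ B₀} {g : A₁ ⟶ B₁} {P : LChain A₀ A₁}
    {q : Loose B₀ B₁} (φ : Cell f g P q),
    paste (Cells.single φ) (idCell q) (Category.comp_id f) (Category.comp_id g) = φ
  paste_assoc : ∀ {A₀ A₁ B₀ B₁ C₀ C₁ D₀ D₁ : X} {f : A₀ ⟶ B₀} {g : A₁ ⟶ B₁} {f' : B₀ ⟶ C₀}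
    {g' : B₁ ⟶ C₁} {k : A₀ ⟶ C₀} {l : A₁ ⟶ C₁} {P : LChain A₀ A₁} {Q : LChain B₀ B₁}
    {R : LChain C₀ C₁} (T : TwoLevel f g f' g' k l P Q R)
    {f'' : C₀ ⟶ D₀} {g'' : C₁ ⟶ D₁} {s : Loose D₀ D₁} (χ : Cell f'' g'' R s)
    {m : B₀ ⟶ D₀} {n : B₁ ⟶ D₁} {a : A₀ ⟶ D₀} {b : A₁ ⟶ D₁}
    (hm : f' ≫ f'' = m) (hn : g' ≫ g'' = n) (ha : f ≫ m = a) (hb : g ≫ n = b)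
    (ha' : k ≫ f'' = a) (hb' : l ≫ g'' = b),
    paste T.top (paste T.bot χ hm hn) ha hb = paste T.vert χ ha' hb'

/-! ### Opcartesian and cartesian 2-cells; virtual equipments -/

section

variable {X : Type u} [VirtualDoubleCategory.{z, w, v, u} X]

/-- The sequence `1, …, 1, φ, 1, …, 1` of a 2-cell `φ : P ⇒ q` with identity boundaries, flanked
by the identity 2-cells of chains `L` and `R`. -/
def Cells.flank {A₀ A B A₁ : X} (L : LChain A₀ A) {P : LChain A B} {q : Loose A B}
    (φ : Cell (𝟙 A) (𝟙 B) P q) (R : LChain B A₁) :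
    Cells (𝟙 A₀) (𝟙 A₁) (L.append (P.append R)) (L.append (.cons q R)) :=
  (Cells.id L).append (.cons φ (Cells.id R) rfl)

/-- A 2-cell `φ : p₁, …, pₙ ⇒ q` with identity boundaries is opcartesian when every 2-cell whose
domain is of the form `L, p₁, …, pₙ, R` factors uniquely through it.  In this case `q` is the
composite of `p₁, …, pₙ`, and, if `n = 0`, the loose-identity. -/
def IsOpcartesian {A B : X} {P : LChain A B} {q : Loose A B} (φ : Cell (𝟙 A) (𝟙 B) P q) : Prop :=
  ∀ {A₀ A₁ B₀ B₁ : X} (L : LChain A₀ A) (R : LChain B A₁) {f : A₀ ⟶ B₀} {g : A₁ ⟶ B₁}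
    {r : Loose B₀ B₁} (χ : Cell f g (L.append (P.append R)) r),
    ∃! χ' : Cell f g (L.append (.cons q R)) r,
      paste (Cells.flank L φ R) χ' (Category.id_comp f) (Category.id_comp g) = χ

/-- A 2-cell `φ : p₁, …, pₙ ⇒ q` with identity boundaries is left-opcartesian when every 2-cell
whose domain is of the form `p₁, …, pₙ, R` factors uniquely through it.  In this case `q` is the
left-composite of `p₁, …, pₙ`. -/
def IsLeftOpcartesian {A B : X} {P : LChain A B} {q : Loose A B} (φ : Cell (𝟙 A) (𝟙 B) P q) :
    Prop :=
  ∀ {A₁ B₀ B₁ : X} (R : LChain B A₁) {f : A ⟶ B₀} {g : A₁ ⟶ B₁}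
    {r : Loose B₀ B₁} (χ : Cell f g (P.append R) r),
    ∃! χ' : Cell f g (.cons q R) r,
      paste (Cells.cons φ (Cells.id R) rfl) χ' (Category.id_comp f) (Category.id_comp g) = χ

/-- A unary 2-cell `κ : q ⇒ p` with boundaries `f`, `g` is cartesian when every 2-cell with
codomain `p` whose boundaries factor through `f` and `g` factors uniquely through `κ`.  In this
case `q` is the restriction `p(f, g)`. -/
def IsCartesian {A₀ A₁ B₀ B₁ : X} {f : A₀ ⟶ B₀} {g : A₁ ⟶ B₁} {q : Loose A₀ A₁}
    {p : Loose B₀ B₁} (κ : Cell f g (.single q) p) : Prop :=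
  ∀ {C₀ C₁ : X} (a : C₀ ⟶ A₀) (b : C₁ ⟶ A₁) {k : C₀ ⟶ B₀} {l : C₁ ⟶ B₁} (hk : a ≫ f = k)
    (hl : b ≫ g = l) {P : LChain C₀ C₁} (χ : Cell k l P p),
    ∃! χ' : Cell a b P q, paste (Cells.single χ') κ hk hl = χ

/-- Invertibility of a unary 2-cell with identity boundaries. -/
def IsIsoCell {A B : X} {p q : Loose A B} (φ : Cell (𝟙 A) (𝟙 B) (.single p) q) : Prop :=
  ∃ ψ : Cell (𝟙 A) (𝟙 B) (.single q) p,
    paste (Cells.single φ) ψ (Category.id_comp _) (Category.id_comp _) = idCell p ∧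
    paste (Cells.single ψ) φ (Category.id_comp _) (Category.id_comp _) = idCell q

end

section

variable {X : Type u} [VirtualDoubleCategory.{z, w, v, u} X]

theorem Cells.append_nil {A₀ A₁ B₀ B₁ : X} {f : A₀ ⟶ B₀} {g : A₁ ⟶ B₁} {P : LChain A₀ A₁}
    {Q : LChain B₀ B₁} (Φ : Cells f g P Q) : HEq (Φ.append (Cells.nil g)) Φ := by
  induction Φ with
  | nil f => rfl
  | @cons A₀ A₁ A₂ B₀ B₁ B₂ f g h P P' R q Q φ Φ e ih =>
    subst e
    have key : ∀ {P₁ : LChain A₁ A₂} {Q₁ : LChain B₁ B₂} (Ψ : Cells g h P₁ Q₁)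
        (e₁ : (P.append P').append (.nil A₂) = P.append P₁), P₁ = P' → Q₁ = Q → HEq Ψ Φ →
        HEq (Cells.cons φ Ψ e₁) (Cells.cons φ Φ rfl) := by
      intro P₁ Q₁ Ψ e₁ h₁ h₂ h₃
      subst h₁ h₂
      obtain rfl := eq_of_heq h₃
      congr 1
      exact proof_irrel_heq _ _
    exact key _ _ P'.append_nil Q.append_nil ih

theorem Cells.single_append {A₀ A₁ A₂ B₀ B₁ B₂ : X} {f : A₀ ⟶ B₀} {g : A₁ ⟶ B₁} {h : A₂ ⟶ B₂}
    {P : LChain A₀ A₁} {P' : LChain A₁ A₂} {R : LChain A₀ A₂} {q : Loose B₀ B₁}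
    {Q : LChain B₁ B₂} (φ : Cell f g P q) (Φ : Cells g h P' Q) (e : R = P.append P') :
    HEq (Cells.cons φ Φ e) ((Cells.single φ).append Φ) := by
  subst e; rfl

theorem paste_single {A₀ A₁ B₀ B₁ C₀ C₁ D₀ D₁ : X} {f : A₀ ⟶ B₀} {g : A₁ ⟶ B₁} {f' : B₀ ⟶ C₀}
    {g' : B₁ ⟶ C₁} {k : A₀ ⟶ C₀} {l : A₁ ⟶ C₁} {P : LChain A₀ A₁} {Q : LChain B₀ B₁}
    {r : Loose C₀ C₁} (Φ : Cells f g P Q) (ψ : Cell f' g' Q r) (hk : f ≫ f' = k)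
    (hl : g ≫ g' = l) {f'' : C₀ ⟶ D₀} {g'' : C₁ ⟶ D₁} {s : Loose D₀ D₁}
    (χ : Cell f'' g'' (.single r) s)
    {m : B₀ ⟶ D₀} {n : B₁ ⟶ D₁} {a : A₀ ⟶ D₀} {b : A₁ ⟶ D₁}
    (hm : f' ≫ f'' = m) (hn : g' ≫ g'' = n) (ha : f ≫ m = a) (hb : g ≫ n = b)
    (ha' : k ≫ f'' = a) (hb' : l ≫ g'' = b) :
    paste Φ (paste (Cells.single ψ) χ hm hn) ha hb =
      paste (Cells.single (paste Φ ψ hk hl)) χ ha' hb' := by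
  have key : ∀ {RP : LChain A₀ A₁} {RQ : LChain B₀ B₁} (eP : RP = P.append (.nil A₁))
      (eQ : RQ = Q.append (.nil B₁)) (Φ' : Cells f g RP RQ),
      HEq Φ' (Φ.append (Cells.nil g)) →
      paste Φ' (paste (Cells.cons ψ (Cells.nil g') eQ) χ hm hn) ha hb =
        paste (Cells.cons (paste Φ ψ hk hl) (Cells.nil l) eP) χ ha' hb' := by
    intro RP RQ eP eQ Φ' h
    subst eP eQ
    obtain rfl := eq_of_heq h
    exact VirtualDoubleCategory.paste_assoc
      (TwoLevel.cons Φ ψ hk hl (TwoLevel.nil g g' hl)) χ hm hn ha hb ha' hb'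
  exact key P.append_nil.symm Q.append_nil.symm Φ Φ.append_nil.symm

theorem paste_pair {A₀ A₁ A₂ B₀ B₁ B₂ C₀ C₁ C₂ D₀ D₂ : X} {f : A₀ ⟶ B₀} {g : A₁ ⟶ B₁}
    {h : A₂ ⟶ B₂} {f' : B₀ ⟶ C₀} {g' : B₁ ⟶ C₁} {h' : B₂ ⟶ C₂}
    {k : A₀ ⟶ C₀} {l : A₁ ⟶ C₁} {m : A₂ ⟶ C₂}
    {P : LChain A₀ A₁} {P' : LChain A₁ A₂} {Q : LChain B₀ B₁} {Q' : LChain B₁ B₂}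
    {RP : LChain A₀ A₂} {RQ : LChain B₀ B₂}
    {r : Loose C₀ C₁} {r' : Loose C₁ C₂} (Φ : Cells f g P Q) (ψ : Cell f' g' Q r)
    (Φ' : Cells g h P' Q') (ψ' : Cell g' h' Q' r')
    (hk : f ≫ f' = k) (hl : g ≫ g' = l) (hm : h ≫ h' = m)
    (eP : RP = P.append P') (eQ : RQ = Q.append Q') (Θ : Cells f h RP RQ)
    (hΘ : HEq Θ (Φ.append Φ'))
    {f'' : C₀ ⟶ D₀} {g'' : C₂ ⟶ D₂} {s : Loose D₀ D₂} (χ : Cell f'' g'' (.cons r (.single r')) s)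
    {u : B₀ ⟶ D₀} {n : B₂ ⟶ D₂} {a : A₀ ⟶ D₀} {b : A₂ ⟶ D₂}
    (hu : f' ≫ f'' = u) (hn : h' ≫ g'' = n) (ha : f ≫ u = a) (hb : h ≫ n = b)
    (ha' : k ≫ f'' = a) (hb' : m ≫ g'' = b) :
    paste Θ (paste (Cells.cons ψ (Cells.single ψ') eQ) χ hu hn) ha hb =
      paste (Cells.cons (paste Φ ψ hk hl) (Cells.single (paste Φ' ψ' hl hm)) eP) χ ha' hb' := by
  subst eP eQ
  obtain rfl := eq_of_heq hΘ
  have key : ∀ {R : LChain A₁ A₂} {S : LChain B₁ B₂} (eR : R = P'.append (.nil A₂))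
      (eS : S = Q'.append (.nil B₂)) (Ψ : Cells g h R S),
      HEq Ψ (Φ'.append (Cells.nil h)) →
      paste (Φ.append Ψ) (paste (Cells.cons ψ (Cells.cons ψ' (Cells.nil h') eS) rfl) χ hu hn) ha hb
        = paste (Cells.cons (paste Φ ψ hk hl)
            (Cells.cons (paste Φ' ψ' hl hm) (Cells.nil m) eR) rfl) χ ha' hb' := by
    intro R S eR eS Ψ hΨ
    subst eR eS
    obtain rfl := eq_of_heq hΨ
    exact VirtualDoubleCategory.paste_assoc
      (TwoLevel.cons Φ ψ hk hl (TwoLevel.cons Φ' ψ' hl hm (TwoLevel.nil h h' hm))) χ hu hn ha hb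
      ha' hb'
  exact key P'.append_nil.symm Q'.append_nil.symm Φ' Φ'.append_nil.symm

theorem paste_idCell_single {A₀ A₁ B₀ B₁ : X} {f : A₀ ⟶ B₀} {g : A₁ ⟶ B₁} {p : Loose A₀ A₁}
    {q : Loose B₀ B₁} (φ : Cell f g (.single p) q) :
    paste (Cells.single (idCell p)) φ (Category.id_comp f) (Category.id_comp g) = φ :=
  VirtualDoubleCategory.id_paste φ

end

/-- A virtual equipment: a virtual double category with loose-identities `A(1, 1)` and
restrictions `p(f, g)`. -/
class VirtualEquipment (X : Type u) [VirtualDoubleCategory.{z, w, v, u} X] where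
  one : (A : X) → Loose A A
  oneCell : (A : X) → Cell (𝟙 A) (𝟙 A) (.nil A) (one A)
  oneCell_opcartesian : ∀ A : X, IsOpcartesian (oneCell A)
  restr : {A₀ A₁ B₀ B₁ : X} → Loose B₀ B₁ → (A₀ ⟶ B₀) → (A₁ ⟶ B₁) → Loose A₀ A₁
  restrCell : {A₀ A₁ B₀ B₁ : X} → (p : Loose B₀ B₁) → (f : A₀ ⟶ B₀) → (g : A₁ ⟶ B₁) →
    Cell f g (.single (restr p f g)) p
  restrCell_cartesian : ∀ {A₀ A₁ B₀ B₁ : X} (p : Loose B₀ B₁) (f : A₀ ⟶ B₀) (g : A₁ ⟶ B₁),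
    IsCartesian (restrCell p f g)

open VirtualEquipment (one oneCell restr restrCell)

noncomputable section

variable {X : Type u} [VirtualDoubleCategory.{z, w, v, u} X] [VirtualEquipment X]

/-- A 2-cell `P ⇒ B(f, g)`.  By the universal property of the restriction `B(f, g)` of the
loose-identity `B(1, 1)`, this is a 2-cell `P ⇒ B(1, 1)` with boundaries `f` and `g`, and
2-cells into `B(f, g)` are represented in this form throughout.  For `P` empty these are the
2-cells `f ⇒ g` between tight-cells. -/
abbrev HCell {A₀ A₁ B : X} (f : A₀ ⟶ B) (g : A₁ ⟶ B) (P : LChain A₀ A₁) : Type z :=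
  Cell f g P (one B)

/-- The restriction `B(f, g)`. -/
abbrev hom {A₀ A₁ B : X} (f : A₀ ⟶ B) (g : A₁ ⟶ B) : Loose A₀ A₁ := restr (one B) f g

/-- The universal 2-cell of `B(f, g)` (corresponding to the identity 2-cell on `B(f, g)`). -/
abbrev homCell {A₀ A₁ B : X} (f : A₀ ⟶ B) (g : A₁ ⟶ B) : HCell f g (.single (hom f g)) :=
  restrCell (one B) f g

/-- The factorisation of a 2-cell through `B(f, g)`: a 2-cell `P ⇒ B(k, l)`, where
`k = a ≫ f` and `l = b ≫ g`, is regarded as a 2-cell `P ⇒ B(f, g)` with boundaries `a`, `b`. -/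
def homLift {C₀ C₁ A₀ A₁ B : X} (f : A₀ ⟶ B) (g : A₁ ⟶ B) (a : C₀ ⟶ A₀) (b : C₁ ⟶ A₁)
    {k : C₀ ⟶ B} {l : C₁ ⟶ B} (hk : a ≫ f = k) (hl : b ≫ g = l) {P : LChain C₀ C₁}
    (χ : HCell k l P) : Cell a b P (hom f g) :=
  (VirtualEquipment.restrCell_cartesian (one B) f g a b hk hl χ).choose

/-- The identity 2-cell `1_f : f ⇒ f` on a tight-cell. -/
def idH {A B : X} (f : A ⟶ B) : HCell f f (.nil A) :=
  paste (Cells.nil f) (oneCell B) (Category.comp_id f) (Category.comp_id f)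

/-- The composition 2-cell `B(1, 1), B(1, 1) ⇒ B(1, 1)`. -/
def mul (B : X) : HCell (𝟙 B) (𝟙 B) (.cons (one B) (.single (one B))) :=
  (VirtualEquipment.oneCell_opcartesian B (.nil B) (.single (one B)) (idCell (one B))).choose

/-- Composition `P, Q ⇒ B(f, h)` of 2-cells `P ⇒ B(f, g)` and `Q ⇒ B(g, h)`. -/
def hcomp {A₀ A₁ A₂ B : X} {f : A₀ ⟶ B} {g : A₁ ⟶ B} {h : A₂ ⟶ B} {P : LChain A₀ A₁}
    {Q : LChain A₁ A₂} (φ : HCell f g P) (ψ : HCell g h Q) : HCell f h (P.append Q) :=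
  paste (Cells.cons φ (Cells.single ψ) rfl) (mul B) (Category.comp_id f) (Category.comp_id h)

/-- The action `A(1, 1) ⇒ B(g, g)` of a tight-cell `g : A ⟶ B` on homs. -/
def mapCell {A B : X} (g : A ⟶ B) : HCell g g (.single (one A)) :=
  (VirtualEquipment.oneCell_opcartesian A (.nil A) (.nil A) (idH g)).choose

/-- Postcomposition of a 2-cell `P ⇒ A(f, f')` with a tight-cell `g : A ⟶ B`, giving a 2-cell
`P ⇒ B(k, k')`, where `k = f ≫ g` and `k' = f' ≫ g`. -/
def postcomp {A₀ A₁ A B : X} {f : A₀ ⟶ A} {f' : A₁ ⟶ A} {P : LChain A₀ A₁} (φ : HCell f f' P)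
    (g : A ⟶ B) {k : A₀ ⟶ B} {k' : A₁ ⟶ B} (hk : f ≫ g = k) (hk' : f' ≫ g = k') : HCell k k' P :=
  paste (Cells.single φ) (mapCell g) hk hk'

theorem homLift_spec {C₀ C₁ A₀ A₁ B : X} (f : A₀ ⟶ B) (g : A₁ ⟶ B) (a : C₀ ⟶ A₀) (b : C₁ ⟶ A₁)
    {k : C₀ ⟶ B} {l : C₁ ⟶ B} (hk : a ≫ f = k) (hl : b ≫ g = l) {P : LChain C₀ C₁}
    (χ : HCell k l P) :
    paste (Cells.single (homLift f g a b hk hl χ)) (homCell f g) hk hl = χ :=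
  (VirtualEquipment.restrCell_cartesian (one B) f g a b hk hl χ).choose_spec.1

theorem homLift_unique {C₀ C₁ A₀ A₁ B : X} {f : A₀ ⟶ B} {g : A₁ ⟶ B} {a : C₀ ⟶ A₀} {b : C₁ ⟶ A₁}
    {k : C₀ ⟶ B} {l : C₁ ⟶ B} (hk : a ≫ f = k) (hl : b ≫ g = l) {P : LChain C₀ C₁}
    {χ χ' : Cell a b P (hom f g)}
    (h : paste (Cells.single χ) (homCell f g) hk hl = paste (Cells.single χ') (homCell f g) hk hl) :
    χ = χ' :=
  (VirtualEquipment.restrCell_cartesian (one B) f g a b hk hl _).unique h rfl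

theorem mul_left (B : X) :
    paste (Cells.cons (oneCell B) (Cells.single (idCell (one B))) rfl) (mul B)
      (Category.id_comp _) (Category.id_comp _) = idCell (one B) :=
  (VirtualEquipment.oneCell_opcartesian B (.nil B) (.single (one B)) (idCell (one B))).choose_spec.1

theorem mapCell_spec {A B : X} (g : A ⟶ B) :
    paste (Cells.single (oneCell A)) (mapCell g) (Category.id_comp _) (Category.id_comp _) = idH g :=
  (VirtualEquipment.oneCell_opcartesian A (.nil A) (.nil A) (idH g)).choose_spec.1

theorem mul_right (B : X) :
    paste (Cells.cons (idCell (one B)) (Cells.single (oneCell B)) rfl) (mul B)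
      (Category.id_comp _) (Category.id_comp _) = idCell (one B) := by
  refine (VirtualEquipment.oneCell_opcartesian B (.nil B) (.nil B) (oneCell B)).unique ?_
    (VirtualDoubleCategory.paste_id (oneCell B))
  refine (paste_pair (Cells.single (oneCell B)) (idCell (one B)) (Cells.nil (𝟙 B)) (oneCell B)
    (Category.id_comp _) (Category.id_comp _) (Category.id_comp _) rfl rfl _ HEq.rfl (mul B)
    _ _ _ _ (Category.id_comp _) (Category.id_comp _)).trans ?_
  have e₁ := VirtualDoubleCategory.paste_id (oneCell B)
  have e₂ : paste (Cells.nil (𝟙 B)) (oneCell B) (Category.id_comp _) (Category.id_comp _)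
    = oneCell B := VirtualDoubleCategory.id_paste (oneCell B)
  rw [e₁, e₂]
  have e₃ := paste_pair (Cells.nil (𝟙 B)) (oneCell B) (Cells.single (oneCell B)) (idCell (one B))
    (Category.id_comp _) (Category.id_comp _) (Category.id_comp _) rfl rfl _ HEq.rfl (mul B)
    (Category.id_comp _) (Category.id_comp _) (Category.id_comp _) (Category.id_comp _)
    (Category.id_comp _) (Category.id_comp _)
  rw [e₁, e₂, mul_left] at e₃
  exact e₃.symm.trans e₁
theorem paste_nil_one {A B : X} (f : A ⟶ B) :
    paste (Cells.nil f) (oneCell B) (Category.comp_id f) (Category.comp_id f) = idH f := rfl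

theorem idH_id (A : X) : idH (𝟙 A) = oneCell A :=
  VirtualDoubleCategory.id_paste (oneCell A)

/-- Pasting on top of a composite. -/
theorem paste_hcomp {A₀ A₁ A₂ B₀ B₁ B₂ B : X} {f : A₀ ⟶ B₀} {g : A₁ ⟶ B₁} {h : A₂ ⟶ B₂}
    {f' : B₀ ⟶ B} {g' : B₁ ⟶ B} {h' : B₂ ⟶ B} {k : A₀ ⟶ B} {l : A₁ ⟶ B} {m : A₂ ⟶ B}
    {P : LChain A₀ A₁} {P' : LChain A₁ A₂} {Q : LChain B₀ B₁} {Q' : LChain B₁ B₂}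
    (Φ : Cells f g P Q) (ψ : HCell f' g' Q) (Φ' : Cells g h P' Q') (ψ' : HCell g' h' Q')
    (hk : f ≫ f' = k) (hl : g ≫ g' = l) (hm : h ≫ h' = m) :
    paste (Φ.append Φ') (hcomp ψ ψ') hk hm = hcomp (paste Φ ψ hk hl) (paste Φ' ψ' hl hm) :=
  paste_pair Φ ψ Φ' ψ' hk hl hm rfl rfl _ HEq.rfl (mul B) _ _ _ _ _ _

theorem id_hcomp {A₀ A₁ B : X} {f : A₀ ⟶ B} {g : A₁ ⟶ B} {P : LChain A₀ A₁} (φ : HCell f g P) :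
    hcomp (idH f) φ = φ := by
  have h := paste_pair (Cells.nil f) (oneCell B) (Cells.single φ) (idCell (one B))
    (Category.comp_id _) (Category.comp_id _) (Category.comp_id _) (RP := P) rfl rfl
    (Cells.single φ) HEq.rfl (mul B) (Category.id_comp _) (Category.id_comp _)
    (Category.comp_id _) (Category.comp_id _) (Category.comp_id _) (Category.comp_id _)
  have e₁ := VirtualDoubleCategory.paste_id φ
  rw [mul_left, e₁] at h
  exact h.symm

theorem hcomp_id_aux {A₀ A₁ B : X} {f : A₀ ⟶ B} {g : A₁ ⟶ B} {P : LChain A₀ A₁} (φ : HCell f g P)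
    (e : P = P.append (.nil A₁)) :
    paste (Cells.cons φ (Cells.single (idH g)) e) (mul B) (Category.comp_id f)
      (Category.comp_id g) = φ := by
  have h := paste_pair (Cells.single φ) (idCell (one B)) (Cells.nil g) (oneCell B)
    (Category.comp_id _) (Category.comp_id _) (Category.comp_id _) (RP := P) e rfl
    (Cells.single φ) (Cells.single φ).append_nil.symm (mul B) (Category.id_comp _)
    (Category.id_comp _)
    (Category.comp_id _) (Category.comp_id _) (Category.comp_id _) (Category.comp_id _)
  have e₁ := VirtualDoubleCategory.paste_id φ
  rw [mul_right, e₁] at h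
  exact h.symm

theorem mul_assoc (B : X) :
    hcomp (mul B) (idCell (one B)) = hcomp (idCell (one B)) (mul B) := by
  have hi := paste_idCell_single (idCell (one B))
  refine (VirtualEquipment.oneCell_opcartesian B (.nil B)
    (.cons (one B) (.single (one B))) (mul B)).unique ?_ ?_
  · refine (paste_hcomp (Cells.cons (oneCell B) (Cells.single (idCell (one B))) rfl) (mul B)
      (Cells.single (idCell (one B))) (idCell (one B)) (Category.id_comp _) (Category.id_comp _)
      (Category.id_comp _)).trans ?_
    rw [mul_left, hi]
    exact VirtualDoubleCategory.id_paste (mul B)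
  · refine (paste_hcomp (Cells.single (oneCell B)) (idCell (one B))
      (Cells.cons (idCell (one B)) (Cells.single (idCell (one B))) rfl) (mul B)
      (Category.id_comp _) (Category.id_comp _) (Category.id_comp _)).trans ?_
    have e₁ := VirtualDoubleCategory.paste_id (oneCell B)
    have e₂ : paste (Cells.cons (idCell (one B)) (Cells.single (idCell (one B))) rfl) (mul B)
      (Category.id_comp _) (Category.id_comp _) = mul B := VirtualDoubleCategory.id_paste (mul B)
    rw [e₁, e₂, ← idH_id]
    exact id_hcomp (mul B)

theorem hcomp_assoc_aux {A₀ A₁ A₂ A₃ B : X} {f : A₀ ⟶ B} {g : A₁ ⟶ B} {h : A₂ ⟶ B} {k : A₃ ⟶ B}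
    {P : LChain A₀ A₁} {Q : LChain A₁ A₂} {R : LChain A₂ A₃}
    (φ : HCell f g P) (ψ : HCell g h Q) (χ : HCell h k R)
    (e : (P.append Q).append R = P.append (Q.append R)) :
    hcomp (hcomp φ ψ) χ = paste (Cells.cons φ (Cells.single (hcomp ψ χ)) e) (mul B)
      (Category.comp_id f) (Category.comp_id k) := by
  have h₁ := paste_pair (Cells.cons φ (Cells.single ψ) rfl) (mul B) (Cells.single χ)
    (idCell (one B)) (Category.comp_id _) (Category.comp_id _) (Category.comp_id _) rfl rfl _
    HEq.rfl (mul B) (Category.id_comp _) (Category.id_comp _)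
    (Category.comp_id _) (Category.comp_id _) (Category.comp_id _) (Category.comp_id _)
  have h₂ := paste_pair (Cells.single φ) (idCell (one B))
    (Cells.cons ψ (Cells.single χ) rfl) (mul B)
    (Category.comp_id _) (Category.comp_id _) (Category.comp_id _) e rfl
    (Cells.cons φ (Cells.cons ψ (Cells.single χ) rfl) e) (Cells.single_append _ _ _)
    (mul B) (Category.id_comp _) (Category.id_comp _)
    (Category.comp_id _) (Category.comp_id _) (Category.comp_id _) (Category.comp_id _)
  rw [VirtualDoubleCategory.paste_id] at h₁ h₂
  refine h₁.symm.trans (Eq.trans ?_ h₂)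
  exact congrArg (fun x => paste (Cells.cons φ (Cells.cons ψ (Cells.single χ) rfl) e) x
    (Category.comp_id f) (Category.comp_id k)) (mul_assoc B)

theorem postcomp_hcomp {A₀ A₁ A₂ A B : X} {f : A₀ ⟶ A} {g : A₁ ⟶ A} {h : A₂ ⟶ A}
    {P : LChain A₀ A₁} {Q : LChain A₁ A₂} (φ : HCell f g P) (ψ : HCell g h Q) (r : A ⟶ B)
    {k : A₀ ⟶ B} {l : A₁ ⟶ B} {m : A₂ ⟶ B} (hk : f ≫ r = k) (hl : g ≫ r = l) (hm : h ≫ r = m) :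
    postcomp (hcomp φ ψ) r hk hm = hcomp (postcomp φ r hk hl) (postcomp ψ r hl hm) := by
  have hmul : paste (Cells.single (mul A)) (mapCell r) (Category.id_comp _) (Category.id_comp _)
      = hcomp (mapCell r) (mapCell r) := by
    refine (VirtualEquipment.oneCell_opcartesian A (.nil A) (.single (one A)) (mapCell r)).unique
      ?_ ?_
    · refine (paste_single (Cells.cons (oneCell A) (Cells.single (idCell (one A))) rfl) (mul A)
        (Category.id_comp _) (Category.id_comp _) (mapCell r) _ _ _ _ (Category.id_comp _)
        (Category.id_comp _)).trans ?_
      rw [mul_left]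
      exact paste_idCell_single _
    · refine (paste_hcomp (Cells.single (oneCell A)) (mapCell r) (Cells.single (idCell (one A)))
        (mapCell r) (Category.id_comp _) (Category.id_comp _) (Category.id_comp _)).trans ?_
      rw [mapCell_spec, paste_idCell_single]
      exact id_hcomp _
  have h₁ := paste_single (Cells.cons φ (Cells.single ψ) rfl) (mul A) (Category.comp_id _)
    (Category.comp_id _) (mapCell r) (Category.id_comp _) (Category.id_comp _) hk hm hk hm
  rw [hmul] at h₁
  exact h₁.symm.trans
    (paste_hcomp (Cells.single φ) (mapCell r) (Cells.single ψ) (mapCell r) hk hl hm)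

theorem postcomp_idH {A B C : X} (f : A ⟶ B) (r : B ⟶ C) {k : A ⟶ C} (hk : f ≫ r = k) :
    postcomp (idH f) r hk hk = idH k := by
  subst hk
  have h := paste_single (Cells.nil f) (oneCell B) (Category.comp_id _) (Category.comp_id _)
    (mapCell r) (Category.id_comp _) (Category.id_comp _) rfl rfl rfl rfl
  rw [mapCell_spec] at h
  refine h.symm.trans ?_
  have h₂ := VirtualDoubleCategory.paste_assoc (TwoLevel.nil f r rfl) (oneCell C)
    (Category.comp_id _) (Category.comp_id _) rfl rfl (Category.comp_id _) (Category.comp_id _)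
  exact h₂

/-- Every 2-cell out of `B(l, 1)` is determined by its value at the identity of `l`. -/
theorem yoneda {A C E : X} (l : A ⟶ C) {a : A ⟶ E} {b : C ⟶ E}
    (σ : HCell a b (.single (hom l (𝟙 C)))) {m : A ⟶ E} (hm : l ≫ b = m) :
    σ = hcomp
      (paste (Cells.single (homLift l (𝟙 C) (𝟙 A) l (Category.id_comp l) (Category.comp_id l)
        (idH l))) σ (Category.id_comp a) hm)
      (postcomp (homCell l (𝟙 C)) b hm (Category.id_comp b)) := by
  revert σ
  set p := hom l (𝟙 C) with hp
  intro σ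
  set κ : HCell l (𝟙 C) (.single p) := homCell l (𝟙 C) with hκ
  set i := homLift l (𝟙 C) (𝟙 A) l (Category.id_comp l) (Category.comp_id l) (idH l) with hi
  obtain ⟨ρ, hρ, -⟩ := VirtualEquipment.oneCell_opcartesian C (.single p) (.nil C) (idCell p)
  -- `ρ` is the right action of `C(1, 1)` on `p`, for which every 2-cell out of `p` is equivariant
  have equi : ∀ {E : X} {a : A ⟶ E} {b : C ⟶ E} (σ : HCell a b (.single p))
      (τ : HCell b b (.single (one C))),
      paste (Cells.single (oneCell C)) τ (Category.id_comp _) (Category.id_comp _) = idH b →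
      paste (Cells.single ρ) σ (Category.id_comp _) (Category.id_comp _) = hcomp σ τ := by
    intro E a b σ τ hτ
    refine (VirtualEquipment.oneCell_opcartesian C (.single p) (.nil C) σ).unique ?_ ?_
    · refine (paste_single (Cells.flank (.single p) (oneCell C) (.nil C)) ρ (Category.id_comp _)
        (Category.id_comp _) σ _ _ _ _ (Category.id_comp _) (Category.id_comp _)).trans ?_
      have := congrArg (fun x => paste (Cells.single x) σ (Category.id_comp _)
        (Category.id_comp _)) hρ
      exact this.trans (paste_idCell_single σ)
    · refine (paste_hcomp (Cells.single (idCell p)) σ (Cells.single (oneCell C)) τ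
        (Category.id_comp _) (Category.id_comp _) (Category.id_comp _)).trans ?_
      rw [hτ, paste_idCell_single]
      exact hcomp_id_aux σ rfl
  have hκρ := equi κ (idCell (one C))
    ((VirtualDoubleCategory.paste_id (oneCell C)).trans (idH_id C).symm)
  have hid : paste (Cells.cons i (Cells.single κ) rfl) ρ (Category.id_comp _) (Category.id_comp _)
      = idCell p := by
    refine homLift_unique (Category.id_comp _) (Category.id_comp _) ?_
    refine (paste_single (Cells.cons i (Cells.single κ) rfl) ρ (Category.id_comp _)
      (Category.id_comp _) κ (Category.id_comp _) (Category.id_comp _) (Category.id_comp _)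
      (Category.id_comp _) (Category.id_comp _) (Category.id_comp _)).symm.trans ?_
    rw [hκρ, paste_idCell_single]
    refine (paste_hcomp (Cells.single i) κ (Cells.single κ) (idCell (one C))
      (Category.id_comp _) (Category.comp_id _) (Category.comp_id _)).trans ?_
    rw [VirtualDoubleCategory.paste_id, homLift_spec]
    exact id_hcomp κ
  have h₁ := paste_single (Cells.cons i (Cells.single κ) rfl) ρ (Category.id_comp _)
    (Category.id_comp _) σ (Category.id_comp _) (Category.id_comp _) (Category.id_comp _)
    (Category.id_comp _) (Category.id_comp _) (Category.id_comp _)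
  rw [hid, paste_idCell_single, equi σ (mapCell b) (mapCell_spec b)] at h₁
  exact h₁.symm.trans (paste_hcomp (Cells.single i) σ (Cells.single κ) (mapCell b)
    (Category.id_comp _) hm (Category.id_comp _))

/-! ### Relative adjunctions, relative monads and algebras -/

/-- Let `α : E(j, e) ⇒ E(t, e)`.  Then `act α x φ` is the composite of `α(1, x)` with a 2-cell
`φ : P ⇒ E(j, l)`, where `l = x ≫ e`; it is a 2-cell `P ⇒ E(t, l)`. -/
def act {A D D' E : X} {j t : A ⟶ E} {e : D ⟶ E} (α : HCell t e (.single (hom j e)))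
    (x : D' ⟶ D) {l : D' ⟶ E} (hl : x ≫ e = l) {P : LChain A D'} (φ : HCell j l P) :
    HCell t l P :=
  paste (Cells.single (homLift j e (𝟙 A) x (Category.id_comp j) hl φ)) α (Category.id_comp t) hl

/-- A `j`-relative monad: a carrier `t`, an extension operator `E(j, t) ⇒ E(t, t)` and a unit
`j ⇒ t`, satisfying the left- and right-unit laws and the associativity law. -/
structure RelativeMonad {A E : X} (j : A ⟶ E) where
  t : A ⟶ E
  ext : HCell t t (.single (hom j t))
  unit : HCell j t (.nil A)
  unit_ext : hcomp unit ext = homCell j t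
  ext_unit : act ext (𝟙 A) (Category.id_comp t) unit = idH t
  ext_ext : act ext (𝟙 A) (Category.id_comp t) (hcomp (homCell j t) ext) = hcomp ext ext

/-- A left `j`-relative adjoint of `r`: a tight-cell `l` with an isomorphism
`C(l, 1) ≅ E(j, r)`. -/
structure LeftRelativeAdjoint {A C E : X} (j : A ⟶ E) (r : C ⟶ E) where
  l : A ⟶ C
  sharp : Cell (𝟙 A) (𝟙 C) (.single (hom l (𝟙 C))) (hom j r)
  flat : Cell (𝟙 A) (𝟙 C) (.single (hom j r)) (hom l (𝟙 C))
  sharp_flat : paste (Cells.single sharp) flat (Category.id_comp _) (Category.id_comp _) =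
    idCell (hom l (𝟙 C))
  flat_sharp : paste (Cells.single flat) sharp (Category.id_comp _) (Category.id_comp _) =
    idCell (hom j r)

namespace LeftRelativeAdjoint

variable {A C E : X} {j : A ⟶ E} {r : C ⟶ E} (L : LeftRelativeAdjoint j r)

/-- Transposition, from 2-cells `P ⇒ C(l, b)` to 2-cells `P ⇒ E(j, b ≫ r)`. -/
def toE {D : X} {b : D ⟶ C} {P : LChain A D} (φ : HCell L.l b P) {m : D ⟶ E} (hm : b ≫ r = m) :
    HCell j m P :=
  paste (Cells.single (homLift L.l (𝟙 C) (𝟙 A) b (Category.id_comp _) (Category.comp_id _) φ))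
    (paste (Cells.single L.sharp) (homCell j r) (Category.id_comp _) (Category.id_comp _))
    (Category.id_comp _) hm

/-- Transposition, from 2-cells `P ⇒ E(j, b ≫ r)` to 2-cells `P ⇒ C(l, b)`. -/
def toC {D : X} {b : D ⟶ C} {P : LChain A D} {m : D ⟶ E} (hm : b ≫ r = m) (φ : HCell j m P) :
    HCell L.l b P :=
  paste (Cells.single (homLift j r (𝟙 A) b (Category.id_comp _) hm φ))
    (paste (Cells.single L.flat) (homCell L.l (𝟙 C)) (Category.id_comp _) (Category.id_comp _))
    (Category.id_comp _) (Category.comp_id _)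

theorem toE_toC {D : X} {b : D ⟶ C} {P : LChain A D} {m : D ⟶ E} (hm : b ≫ r = m)
    (φ : HCell j m P) : L.toE (L.toC hm φ) hm = φ := by
  have h₁ : homLift L.l (𝟙 C) (𝟙 A) b (Category.id_comp _) (Category.comp_id _) (L.toC hm φ) =
      paste (Cells.single (homLift j r (𝟙 A) b (Category.id_comp _) hm φ)) L.flat
        (Category.id_comp _) (Category.comp_id _) := by
    refine homLift_unique (Category.id_comp _) (Category.comp_id _) ?_
    rw [homLift_spec]
    exact paste_single _ _ _ _ _ _ _ _ _ _ _
  unfold toE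
  rw [h₁, ← paste_single _ _ _ _ _ (Category.id_comp _) (Category.id_comp _) (Category.id_comp _)
    hm, paste_single (Cells.single L.flat) L.sharp (Category.id_comp _) (Category.id_comp _) _ _ _ _
    _ (Category.id_comp _) (Category.id_comp _), L.flat_sharp, paste_idCell_single, homLift_spec]

theorem toC_toE {D : X} {b : D ⟶ C} {P : LChain A D} {m : D ⟶ E} (hm : b ≫ r = m)
    (φ : HCell L.l b P) : L.toC hm (L.toE φ hm) = φ := by
  have h₁ : homLift j r (𝟙 A) b (Category.id_comp _) hm (L.toE φ hm) =
      paste (Cells.single (homLift L.l (𝟙 C) (𝟙 A) b (Category.id_comp _) (Category.comp_id _) φ))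
        L.sharp (Category.id_comp _) (Category.comp_id _) := by
    refine homLift_unique (Category.id_comp _) hm ?_
    rw [homLift_spec]
    exact paste_single _ _ _ _ _ _ _ _ _ _ _
  unfold toC
  rw [h₁, ← paste_single _ _ _ _ _ (Category.id_comp _) (Category.id_comp _) (Category.id_comp _)
    (Category.comp_id _), paste_single (Cells.single L.sharp) L.flat (Category.id_comp _)
    (Category.id_comp _) _ _ _ _
    _ (Category.id_comp _) (Category.id_comp _), L.sharp_flat, paste_idCell_single, homLift_spec]

/-- The unit `j ⇒ l ≫ r`: the transpose of the identity of `l`. -/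
def unit : HCell j (L.l ≫ r) (.nil A) := L.toE (idH L.l) rfl

/-- The extension operator `E(j, l ≫ r) ⇒ E(l ≫ r, l ≫ r)` : transpose, and apply `r`. -/
def ext : HCell (L.l ≫ r) (L.l ≫ r) (.single (hom j (L.l ≫ r))) :=
  postcomp (L.toC rfl (homCell j (L.l ≫ r))) r rfl rfl

theorem toE_eq {D : X} {b : D ⟶ C} {P : LChain A D} (φ : HCell L.l b P) {m : D ⟶ E}
    (hm : b ≫ r = m) : L.toE φ hm = hcomp L.unit (postcomp φ r rfl hm) := by
  set S := paste (Cells.single L.sharp) (homCell j r) (Category.id_comp _) (Category.id_comp _)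
    with hS
  have hy := yoneda L.l S (rfl : L.l ≫ r = L.l ≫ r)
  have h := paste_hcomp (Cells.nil (𝟙 A)) L.unit
    (Cells.single (homLift L.l (𝟙 C) (𝟙 A) b (Category.id_comp _) (Category.comp_id _) φ))
    (postcomp (homCell L.l (𝟙 C)) r rfl (Category.id_comp r))
    (Category.id_comp _) (Category.id_comp _) hm
  have e₁ : paste (Cells.nil (𝟙 A)) L.unit (Category.id_comp _) (Category.id_comp _) = L.unit :=
    VirtualDoubleCategory.id_paste _
  have e₂ := paste_single
    (Cells.single (homLift L.l (𝟙 C) (𝟙 A) b (Category.id_comp _) (Category.comp_id _) φ))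
    (homCell L.l (𝟙 C)) (Category.id_comp _) (Category.comp_id _) (mapCell r)
    (rfl : L.l ≫ r = _) (Category.id_comp r) (Category.id_comp _) hm rfl hm
  rw [homLift_spec] at e₂
  have e₃ : paste (Cells.single (homLift L.l (𝟙 C) (𝟙 A) b (Category.id_comp _)
      (Category.comp_id _) φ)) (postcomp (homCell L.l (𝟙 C)) r rfl (Category.id_comp r))
      (Category.id_comp _) hm = postcomp φ r rfl hm := e₂
  rw [e₁, e₃] at h
  refine Eq.trans ?_ h
  exact congrArg (fun x => paste (Cells.single (homLift L.l (𝟙 C) (𝟙 A) b (Category.id_comp _)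
      (Category.comp_id _) φ)) x (Category.id_comp _) hm) hy

/-- Transposition is natural. -/
theorem toC_hcomp {D D' : X} {b : D ⟶ C} {b' : D' ⟶ C} {P : LChain A D} {Q : LChain D D'}
    {m : D ⟶ E} {m' : D' ⟶ E} (hm : b ≫ r = m) (hm' : b' ≫ r = m') (φ : HCell j m P)
    (ψ : HCell b b' Q) :
    L.toC hm' (hcomp φ (postcomp ψ r hm hm')) = hcomp (L.toC hm φ) ψ := by
  have h : hcomp φ (postcomp ψ r hm hm') = L.toE (hcomp (L.toC hm φ) ψ) hm' := by
    rw [toE_eq, postcomp_hcomp _ _ _ rfl hm hm']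
    conv_lhs => rw [← L.toE_toC hm φ, toE_eq]
    exact hcomp_assoc_aux L.unit (postcomp (L.toC hm φ) r rfl hm) (postcomp ψ r hm hm') rfl
  rw [h, toC_toE]

theorem act_ext {D : X} {b : D ⟶ A} {P : LChain A D} {m : D ⟶ E} (hm : b ≫ L.l ≫ r = m)
    {c : D ⟶ C} (hc : b ≫ L.l = c) (hcm : c ≫ r = m) (φ : HCell j m P) :
    act L.ext b hm φ = postcomp (L.toC hcm φ) r rfl hcm := by
  subst hc
  have h : paste (Cells.single (homLift j (L.l ≫ r) (𝟙 A) b (Category.id_comp _) hm φ))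
      (L.toC rfl (homCell j (L.l ≫ r))) (Category.id_comp _) rfl =
      L.toC ((Category.assoc _ _ _).trans hm) φ := by
    have h₁ : paste (Cells.single (homLift j (L.l ≫ r) (𝟙 A) b (Category.id_comp _) hm φ))
        (homLift j r (𝟙 A) L.l (Category.id_comp _) rfl (homCell j (L.l ≫ r)))
        (Category.id_comp _) rfl =
        homLift j r (𝟙 A) (b ≫ L.l) (Category.id_comp _) ((Category.assoc _ _ _).trans hm) φ := by
      refine homLift_unique (Category.id_comp _) ((Category.assoc _ _ _).trans hm) ?_
      rw [homLift_spec, ← paste_single _ _ _ _ _ (Category.id_comp _) rfl (Category.id_comp _) hm,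
        homLift_spec, homLift_spec]
    unfold toC
    rw [paste_single _ _ (Category.id_comp _) rfl _ _ _ _ _ (Category.id_comp _)
      (Category.comp_id _), h₁]
  unfold act ext postcomp
  rw [paste_single _ _ (Category.id_comp _) rfl _ _ _ _ _ rfl
      ((Category.assoc _ _ _).trans hm), h]

/-- The `j`-relative monad induced by a `j`-relative adjunction. -/
def monad : RelativeMonad j where
  t := L.l ≫ r
  ext := L.ext
  unit := L.unit
  unit_ext := by
    have h := L.toE_eq (L.toC rfl (homCell j (L.l ≫ r))) rfl
    rw [toE_toC] at h
    exact h.symm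
  ext_unit := by
    rw [act_ext L _ (Category.id_comp L.l) rfl, unit, toC_toE, postcomp_idH]
  ext_ext := by
    rw [act_ext L _ (Category.id_comp L.l) rfl]
    have h := L.toC_hcomp rfl rfl (homCell j (L.l ≫ r)) (L.toC rfl (homCell j (L.l ≫ r)))
    exact (congrArg (fun x => postcomp x r rfl rfl) h).trans
      (postcomp_hcomp _ _ r rfl rfl rfl)

end LeftRelativeAdjoint

namespace RelativeMonad

variable {A E : X} {j : A ⟶ E}

/-- A `T`-algebra with domain `D`: a carrier `e : D ⟶ E` and an extension operator
`E(j, e) ⇒ E(t, e)`, compatible with the unit and the extension operator of `T`. -/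
structure Algebra (T : RelativeMonad j) (D : X) where
  e : D ⟶ E
  op : HCell T.t e (.single (hom j e))
  unit_op : hcomp T.unit op = homCell j e
  op_op : act op (𝟙 D) (Category.id_comp e) (hcomp (homCell j T.t) op) = hcomp T.ext op

/-- The free `T`-algebra: the carrier `t` of `T` with the extension operator of `T`. -/
def free (T : RelativeMonad j) : T.Algebra A where
  e := T.t
  op := T.ext
  unit_op := T.unit_ext
  op_op := T.ext_ext

/-- A graded morphism of `T`-algebras, with grading a chain `P = p₁, …, pₙ`: a 2-cell
`p₁, …, pₙ ⇒ E(e, e')` compatible with the extension operators. -/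
def IsGradedMorphism {T : RelativeMonad j} {D D' : X} (M : T.Algebra D) (M' : T.Algebra D')
    {P : LChain D D'} (ε : HCell M.e M'.e P) : Prop :=
  act M'.op (𝟙 D') (Category.id_comp M'.e) (hcomp (homCell j M.e) ε) = hcomp M.op ε

/-- `x : D ⟶ C` satisfies `x ≫ u = e` and `α_U(1, x) = α`, where `U = (u, α_U)` is an algebra
with domain `C` and `M = (e, α)` is an algebra with domain `D`. -/
def Mediates {T : RelativeMonad j} {C D : X} (U : T.Algebra C) (M : T.Algebra D) (x : D ⟶ C) :
    Prop :=
  ∃ h : x ≫ U.e = M.e, act U.op x h (homCell j M.e) = M.op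

/-- `U` is an algebra object for `T`: every algebra has a unique mediating tight-cell, and every
graded morphism of algebras factors uniquely through postcomposition with `u`. -/
structure IsAlgebraObject {T : RelativeMonad j} {C : X} (U : T.Algebra C) : Prop where
  tight : ∀ {D : X} (M : T.Algebra D), ∃! x : D ⟶ C, Mediates U M x
  cell : ∀ {D D' : X} (M : T.Algebra D) (M' : T.Algebra D') (x : D ⟶ C) (x' : D' ⟶ C),
    Mediates U M x → Mediates U M' x' → ∀ (h : x ≫ U.e = M.e) (h' : x' ≫ U.e = M'.e)
      {P : LChain D D'} (ε : HCell M.e M'.e P), IsGradedMorphism M M' ε →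
      ∃! ε' : HCell x x' P, postcomp ε' U.e h h' = ε

/-- `T` admits an algebra object. -/
def HasAlgebraObject (T : RelativeMonad j) : Prop :=
  ∃ (C : X) (U : T.Algebra C), IsAlgebraObject U

end RelativeMonad

/-- `c : D ⟶ Alg(T)` is the comparison tight-cell of the relative adjunction `L`, where `U` is an
algebra object for the induced relative monad `T`: it commutes with the left adjoints `l` and
`f_T` (the mediating tight-cell of the free `T`-algebra) and with the right adjoints `r` and
`u_T`. -/
def IsComparison {A D E : X} {j : A ⟶ E} {r : D ⟶ E} (L : LeftRelativeAdjoint j r) {C : X}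
    (U : L.monad.Algebra C) (c : D ⟶ C) : Prop :=
  c ≫ U.e = r ∧ ∃ fT : A ⟶ C, RelativeMonad.Mediates U L.monad.free fT ∧ L.l ≫ c = fT

/-- Isomorphism of tight-cells: invertible 2-cells `f ⇒ g`. -/
def TightIso {A B : X} (f g : A ⟶ B) : Prop :=
  ∃ (φ : HCell f g (.nil A)) (ψ : HCell g f (.nil A)), hcomp φ ψ = idH f ∧ hcomp ψ φ = idH g

/-- A tight-cell is an equivalence when it has a pseudo-inverse. -/
def IsTightEquivalence {A B : X} (c : A ⟶ B) : Prop :=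
  ∃ d : B ⟶ A, TightIso (c ≫ d) (𝟙 A) ∧ TightIso (d ≫ c) (𝟙 B)

/-- Strict `j`-monadicity: `r` has a left `j`-adjoint, the induced `j`-monad has an algebra object,
and the comparison tight-cell is an isomorphism. -/
def StrictlyMonadic {A D E : X} (j : A ⟶ E) (r : D ⟶ E) : Prop :=
  ∃ (L : LeftRelativeAdjoint j r) (C : X) (U : L.monad.Algebra C),
    RelativeMonad.IsAlgebraObject U ∧ ∃ c : D ⟶ C, IsComparison L U c ∧ IsIso c

/-- Non-strict `j`-monadicity: as before, but the comparison tight-cell is an equivalence. -/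
def NonstrictlyMonadic {A D E : X} (j : A ⟶ E) (r : D ⟶ E) : Prop :=
  ∃ (L : LeftRelativeAdjoint j r) (C : X) (U : L.monad.Algebra C),
    RelativeMonad.IsAlgebraObject U ∧ ∃ c : D ⟶ C, IsComparison L U c ∧ IsTightEquivalence c

/-! ### Weighted colimits, density, absoluteness and creation -/

/-- A `p`-cocone for `f : Z ⟶ W`, where `p` is a loose-cell from `Y` (right end) to `Z` (left
end): a tight-cell `pt : Y ⟶ W` with a 2-cell `p ⇒ W(f, pt)`. -/
structure Cocone {Z Y W : X} (p : Loose Z Y) (f : Z ⟶ W) where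
  pt : Y ⟶ W
  cell : HCell f pt (.single p)

/-- The image of a cocone under a tight-cell `g`. -/
def Cocone.map {Z Y W V : X} {p : Loose Z Y} {f : Z ⟶ W} (K : Cocone p f) (g : W ⟶ V) :
    Cocone p (f ≫ g) where
  pt := K.pt ≫ g
  cell := postcomp K.cell g rfl rfl

/-- A `p`-cocone `(c, γ)` for `f` is the `p`-weighted colimit of `f` when pasting with `γ` is a
bijection from 2-cells `q₁, …, qₙ ⇒ W(c, g)` to 2-cells `p, q₁, …, qₙ ⇒ W(f, g)`. -/
def Cocone.IsColimit {Z Y W : X} {p : Loose Z Y} {f : Z ⟶ W} (K : Cocone p f) : Prop :=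
  ∀ {V : X} (g : V ⟶ W) (Q : LChain Y V) (χ : HCell f g (.cons p Q)),
    ∃! χ' : HCell K.pt g Q, hcomp K.cell χ' = χ

/-- `j` is dense when the identity tight-cell, with the identity 2-cell on `E(j, 1)`, is the left
extension of `j` along itself, i.e. the `E(j, 1)`-weighted colimit of `j`. -/
def Dense {A E : X} (j : A ⟶ E) : Prop :=
  Cocone.IsColimit (p := hom j (𝟙 E)) (f := j) ⟨𝟙 E, homCell j (𝟙 E)⟩

/-- The 2-cell `E(j, f), p ⇒ E(j, c)` induced by a `p`-cocone `(c, γ)` for `f : Z ⟶ E`. -/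
def Cocone.nerveCell {A Z Y E : X} (j : A ⟶ E) {p : Loose Z Y} {f : Z ⟶ E} (K : Cocone p f) :
    Cell (𝟙 A) (𝟙 Y) (.cons (hom j f) (.single p)) (hom j K.pt) :=
  homLift j K.pt (𝟙 A) (𝟙 Y) (Category.id_comp _) (Category.id_comp _)
    (hcomp (homCell j f) K.cell)

/-- `j`-absoluteness of a colimit `(c, γ)`: the composite of `E(j, f)` and `p` exists, and the
canonical 2-cell from it to `E(j, c)` is invertible. -/
def Cocone.IsAbsolute {A Z Y E : X} (j : A ⟶ E) {p : Loose Z Y} {f : Z ⟶ E} (K : Cocone p f) :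
    Prop :=
  ∃ (q : Loose A Y) (κ : Cell (𝟙 A) (𝟙 Y) (.cons (hom j f) (.single p)) q),
    IsOpcartesian κ ∧
    ∃ can : Cell (𝟙 A) (𝟙 Y) (.single q) (hom j K.pt),
      paste (Cells.single κ) can (Category.id_comp _) (Category.id_comp _) = K.nerveCell j ∧
      IsIsoCell can

/-- As `Cocone.IsAbsolute`, with the left-composite of `E(j, f)` and `p` in place of their
composite. -/
def Cocone.IsLeftAbsolute {A Z Y E : X} (j : A ⟶ E) {p : Loose Z Y} {f : Z ⟶ E}
    (K : Cocone p f) : Prop :=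
  ∃ (q : Loose A Y) (κ : Cell (𝟙 A) (𝟙 Y) (.cons (hom j f) (.single p)) q),
    IsLeftOpcartesian κ ∧
    ∃ can : Cell (𝟙 A) (𝟙 Y) (.single q) (hom j K.pt),
      paste (Cells.single κ) can (Category.id_comp _) (Category.id_comp _) = K.nerveCell j ∧
      IsIsoCell can

/-- Every left-composite of `E(j, f)` and `p` is a composite. -/
def LeftCompositesAreComposites {A E : X} (j : A ⟶ E) : Prop :=
  ∀ {Z Y : X} (f : Z ⟶ E) (p : Loose Z Y) (q : Loose A Y)
    (κ : Cell (𝟙 A) (𝟙 Y) (.cons (hom j f) (.single p)) q),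
    IsLeftOpcartesian κ → IsOpcartesian κ

/-- The colimit `L` of `f ≫ g` is strictly created by `g`: there is a unique cocone for `f` whose
image under `g` is `L`, and it is a colimit of `f`. -/
def StrictlyCreatesColimit {Z Y W V : X} {p : Loose Z Y} {f : Z ⟶ W} (g : W ⟶ V)
    (L : Cocone p (f ≫ g)) : Prop :=
  ∃ K : Cocone p f, (K.map g = L ∧ ∀ K' : Cocone p f, K'.map g = L → K' = K) ∧ K.IsColimit

/-- The colimit of `f ≫ g` weighted by `p` is non-strictly created by `g`: a cocone for `f` is a
colimit if and only if its image under `g` is, and `f` has a `p`-weighted colimit. -/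
def NonstrictlyCreatesColimit {Z Y W V : X} (p : Loose Z Y) (f : Z ⟶ W) (g : W ⟶ V) : Prop :=
  (∀ K : Cocone p f, (K.map g).IsColimit ↔ K.IsColimit) ∧ ∃ K : Cocone p f, K.IsColimit

/-- `r` strictly creates `j`-absolute colimits. -/
def StrictlyCreatesAbsolute {A D E : X} (j : A ⟶ E) (r : D ⟶ E) : Prop :=
  ∀ {Z Y : X} (p : Loose Z Y) (f : Z ⟶ D) (L : Cocone p (f ≫ r)),
    L.IsColimit → L.IsAbsolute j → StrictlyCreatesColimit r L

/-- `r` non-strictly creates `j`-absolute colimits. -/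
def NonstrictlyCreatesAbsolute {A D E : X} (j : A ⟶ E) (r : D ⟶ E) : Prop :=
  ∀ {Z Y : X} (p : Loose Z Y) (f : Z ⟶ D) (L : Cocone p (f ≫ r)),
    L.IsColimit → L.IsAbsolute j → NonstrictlyCreatesColimit p f r

/-- `r` strictly creates the colimits that are `j`-absolute in the sense of left-composites. -/
def StrictlyCreatesLeftAbsolute {A D E : X} (j : A ⟶ E) (r : D ⟶ E) : Prop :=
  ∀ {Z Y : X} (p : Loose Z Y) (f : Z ⟶ D) (L : Cocone p (f ≫ r)),
    L.IsColimit → L.IsLeftAbsolute j → StrictlyCreatesColimit r L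

/-- `r` non-strictly creates the colimits that are `j`-absolute in the sense of left-composites. -/
def NonstrictlyCreatesLeftAbsolute {A D E : X} (j : A ⟶ E) (r : D ⟶ E) : Prop :=
  ∀ {Z Y : X} (p : Loose Z Y) (f : Z ⟶ D) (L : Cocone p (f ≫ r)),
    L.IsColimit → L.IsLeftAbsolute j → NonstrictlyCreatesColimit p f r

end

end FormalCat

namespace FormalCat

open VDCGraph (Loose Cell)
open VDCOps (idCell paste)

section

variable {X : Type u} [VirtualDoubleCategory.{z, w, v, u} X]

/-! ### Sequences of 2-cells flanked by identities -/

/-! A cocone `(c, γ)` for `f` is `j`-absolute exactly when the 2-cell `E(j, f), p ⇒ E(j, c)` that it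
induces is opcartesian (`Cocone.isAbsolute_iff`). This makes absoluteness a universal property that
can be used directly. If `j` is dense, it already forces the cocone to be a colimit
(`Dense.isColimit`).

Monadic implies creating (density plays no role here). Let `u` be the carrier of an algebra object
and let `(w, l)` be an absolute colimit of `f ≫ u`. Opcartesianness gives exactly one extension
operator on `w` for which `l` is graded. The unit law is tested after pasting with the induced
2-cell, and the associativity law after pasting with it to the right of `E(j, t)`. The second test
needs a composite; a left-composite does not supply it. The universal property of the algebra object
then lifts `w`, `l` and all comparison 2-cells uniquely (`IsAlgebraObject.creates`). Creation passes
to `r` along the comparison `c`, which is an isomorphism or an equivalence.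

Creating implies monadic. The tight-cell `r` is itself an algebra, so the algebra object, with
domain `C`, supplies `c : D ⟶ C`. Two cocones under `r` are absolute: `u`, weighted by `C(c, 1)`,
and `r`, weighted by `D(1, 1)`. In both cases the reason is that `E(j, r) ≅ D(l, 1)` is the
companion of `l`, that composing a companion with `q` gives the restriction `q(l, 1)`
(`isOpcartesian_of_companion`), and that `E(j, u)` is the restriction of `C(c, 1)` along `l`.
Creating the first colimit gives a tight-cell `d : C ⟶ D` lying over `u`, on the nose or up to
isomorphism. Restricting along `c` gives a cocone comparable with the second colimit, so `c ≫ d` is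
the identity, or isomorphic to it. The universal property of the algebra object handles `d ≫ c`.

For left-composites, the extra hypothesis makes the two notions of absoluteness coincide, so nothing
further has to be proved. -/

theorem Cells.cons_heq {A₀ A₁ A₂ B₀ B₁ B₂ : X} {f : A₀ ⟶ B₀} {g : A₁ ⟶ B₁} {h : A₂ ⟶ B₂}
    {P : LChain A₀ A₁} {P' P'' : LChain A₁ A₂} {R R' : LChain A₀ A₂} {q : Loose B₀ B₁}
    {Q Q' : LChain B₁ B₂} (φ : Cell f g P q) {Φ : Cells g h P' Q} {Φ' : Cells g h P'' Q'}
    {e : R = P.append P'} {e' : R' = P.append P''} (hP : P' = P'') (hQ : Q = Q')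
    (hΦ : HEq Φ Φ') : HEq (Cells.cons φ Φ e) (Cells.cons φ Φ' e') := by
  subst hP hQ e
  obtain rfl := eq_of_heq hΦ
  subst e'
  rfl

theorem Cells.id_append {A B C : X} (L : LChain A B) (R : LChain B C) :
    (Cells.id L).append (Cells.id R) = Cells.id (L.append R) := by
  induction L with
  | nil A => rfl
  | cons p L ih =>
    exact congrArg (fun x => Cells.cons (idCell p) x rfl) (ih R)

/-- The two sides have different types, since reassociating chains is only a propositional equality;
hence `HEq`. -/
theorem Cells.id_append_single_append {A B C D : X} (L : LChain A B) (p : Loose B C)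
    {P Q : LChain C D} (Φ : Cells (𝟙 C) (𝟙 D) P Q) :
    HEq ((Cells.id (L.append (.single p))).append Φ)
      ((Cells.id L).append (Cells.cons (idCell p) Φ rfl)) := by
  induction L with
  | nil A => rfl
  | cons p' L ih =>
    exact Cells.cons_heq _ (Chain.append_assoc _ _ _) (Chain.append_assoc _ _ _) (ih p)

/-- Two levels of identity 2-cells. -/
def TwoLevel.ids : {A B : X} → (P : LChain A B) →
    TwoLevel (𝟙 A) (𝟙 B) (𝟙 A) (𝟙 B) (𝟙 A) (𝟙 B) P P P
  | _, _, .nil A => .nil (𝟙 A) (𝟙 A) (Category.comp_id _)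
  | _, _, .cons p P => .cons (Cells.single (idCell p)) (idCell p) (Category.comp_id _)
      (Category.comp_id _) (TwoLevel.ids P)

@[simp] theorem TwoLevel.ids_top {A B : X} (P : LChain A B) :
    (TwoLevel.ids P).top = Cells.id P := by
  induction P with
  | nil A => rfl
  | cons p P ih => exact congrArg (fun x => Cells.cons (idCell p) x rfl) ih

@[simp] theorem TwoLevel.ids_bot {A B : X} (P : LChain A B) :
    (TwoLevel.ids P).bot = Cells.id P := by
  induction P with
  | nil A => rfl
  | cons p P ih => exact congrArg (fun x => Cells.cons (idCell p) x rfl) ih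

@[simp] theorem TwoLevel.ids_vert {A B : X} (P : LChain A B) :
    (TwoLevel.ids P).vert = Cells.id P := by
  induction P with
  | nil A => rfl
  | cons p P ih =>
    refine (congrArg (fun x => Cells.cons (paste (Cells.single (idCell p)) (idCell p)
      (Category.comp_id _) (Category.comp_id _)) x rfl) ih).trans ?_
    rw [VirtualDoubleCategory.paste_id]
    rfl

/-- Identities on a chain to the left of two levels of 2-cells. -/
def TwoLevel.whiskerLeft : {A₀ A A₁ B₁ C₁ : X} → (L : LChain A₀ A) → {g : A₁ ⟶ B₁} →
    {g' : B₁ ⟶ C₁} → {l : A₁ ⟶ C₁} → {P : LChain A A₁} → {Q : LChain A B₁} → {R : LChain A C₁} →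
    TwoLevel (𝟙 A) g (𝟙 A) g' (𝟙 A) l P Q R →
    TwoLevel (𝟙 A₀) g (𝟙 A₀) g' (𝟙 A₀) l (L.append P) (L.append Q) (L.append R)
  | _, _, _, _, _, .nil _, _, _, _, _, _, _, T => T
  | _, _, _, _, _, .cons p L, _, _, _, _, _, _, T =>
      .cons (g := 𝟙 _) (g' := 𝟙 _) (l := 𝟙 _) (Cells.single (idCell p)) (idCell p)
        (Category.comp_id _) (Category.comp_id _) (TwoLevel.whiskerLeft L T)

section

variable {A₀ A A₁ B₁ C₁ : X} (L : LChain A₀ A) {g : A₁ ⟶ B₁}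
    {g' : B₁ ⟶ C₁} {l : A₁ ⟶ C₁} {P : LChain A A₁} {Q : LChain A B₁} {R : LChain A C₁}
    (T : TwoLevel (𝟙 A) g (𝟙 A) g' (𝟙 A) l P Q R)

theorem TwoLevel.whiskerLeft_top : (T.whiskerLeft L).top = (Cells.id L).append T.top := by
  induction L with
  | nil A => rfl
  | cons p L ih => exact congrArg (fun x => Cells.cons (idCell p) x rfl) (ih T)

theorem TwoLevel.whiskerLeft_bot : (T.whiskerLeft L).bot = (Cells.id L).append T.bot := by
  induction L with
  | nil A => rfl
  | cons p L ih => exact congrArg (fun x => Cells.cons (idCell p) x rfl) (ih T)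

theorem TwoLevel.whiskerLeft_vert : (T.whiskerLeft L).vert = (Cells.id L).append T.vert := by
  induction L with
  | nil A => rfl
  | cons p L ih =>
    refine (congrArg (fun x => Cells.cons (paste (Cells.single (idCell p)) (idCell p)
      (Category.comp_id _) (Category.comp_id _)) x rfl) (ih T)).trans ?_
    rw [VirtualDoubleCategory.paste_id]
    rfl

end

/-- Associativity of pasting, with identities on a chain to the left. -/
theorem paste_whiskerLeft {A₀ A A₁ B₁ C₁ D₀ D₁ : X} (L : LChain A₀ A) {g : A₁ ⟶ B₁}
    {g' : B₁ ⟶ C₁} {l : A₁ ⟶ C₁} {P : LChain A A₁} {Q : LChain A B₁} {R : LChain A C₁}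
    (T : TwoLevel (𝟙 A) g (𝟙 A) g' (𝟙 A) l P Q R) {f'' : A₀ ⟶ D₀} {g'' : C₁ ⟶ D₁}
    {s : Loose D₀ D₁} (χ : Cell f'' g'' (L.append R) s) {n : B₁ ⟶ D₁} {b : A₁ ⟶ D₁}
    (hn : g' ≫ g'' = n) (hb : g ≫ n = b) (hb' : l ≫ g'' = b)
    {Φ : Cells (𝟙 A) g P Q} {Ψ : Cells (𝟙 A) g' Q R} {Ω : Cells (𝟙 A) l P R}
    (hΦ : T.top = Φ) (hΨ : T.bot = Ψ) (hΩ : T.vert = Ω) :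
    paste ((Cells.id L).append Φ) (paste ((Cells.id L).append Ψ) χ (Category.id_comp _) hn)
      (Category.id_comp _) hb = paste ((Cells.id L).append Ω) χ (Category.id_comp _) hb' := by
  subst hΦ hΨ hΩ
  have h := VirtualDoubleCategory.paste_assoc (T.whiskerLeft L) χ (Category.id_comp _) hn
    (Category.id_comp _) hb (Category.id_comp _) hb'
  rwa [TwoLevel.whiskerLeft_top, TwoLevel.whiskerLeft_bot, TwoLevel.whiskerLeft_vert] at h

theorem paste_id_append {A₀ A A₁ B₀ B₁ : X} (L : LChain A₀ A) {P : LChain A A₁}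
    {f : A₀ ⟶ B₀} {g : A₁ ⟶ B₁} {s : Loose B₀ B₁} (χ : Cell f g (L.append P) s) :
    paste ((Cells.id L).append (Cells.id P)) χ (Category.id_comp _) (Category.id_comp _) = χ := by
  rw [Cells.id_append]
  exact VirtualDoubleCategory.id_paste χ

/-! ### Opcartesian 2-cells -/

theorem IsOpcartesian.isLeftOpcartesian {A B : X} {P : LChain A B} {q : Loose A B}
    {φ : Cell (𝟙 A) (𝟙 B) P q} (h : IsOpcartesian φ) : IsLeftOpcartesian φ :=
  fun R _ _ _ χ => h (.nil A) R χ

theorem IsLeftOpcartesian.ext {A B A₁ B₀ B₁ : X} {P : LChain A B} {q : Loose A B}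
    {φ : Cell (𝟙 A) (𝟙 B) P q} (h : IsLeftOpcartesian φ) {R : LChain B A₁} {f : A ⟶ B₀}
    {g : A₁ ⟶ B₁} {r : Loose B₀ B₁} {χ χ' : Cell f g (.cons q R) r}
    (e : paste (Cells.cons φ (Cells.id R) rfl) χ (Category.id_comp f) (Category.id_comp g) =
      paste (Cells.cons φ (Cells.id R) rfl) χ' (Category.id_comp f) (Category.id_comp g)) :
    χ = χ' :=
  (h R _).unique e rfl

/-- Two 2-cells agree if they agree after pasting with an opcartesian 2-cell between a chain
followed by a loose-cell `p` and a further chain. -/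
theorem IsOpcartesian.ext_cons {A B C A₀ A₁ B₀ B₁ : X} {P : LChain A B} {q : Loose A B}
    {φ : Cell (𝟙 A) (𝟙 B) P q} (h : IsOpcartesian φ) (L : LChain A₀ C) (p : Loose C A)
    (R : LChain B A₁) {f : A₀ ⟶ B₀} {g : A₁ ⟶ B₁} {r : Loose B₀ B₁}
    {χ χ' : Cell f g (L.append (.cons p (.cons q R))) r}
    (e : paste ((Cells.id L).append (.cons (idCell p) (.cons φ (Cells.id R) rfl) rfl)) χ
        (Category.id_comp f) (Category.id_comp g) =
      paste ((Cells.id L).append (.cons (idCell p) (.cons φ (Cells.id R) rfl) rfl)) χ'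
        (Category.id_comp f) (Category.id_comp g)) : χ = χ' := by
  have key : ∀ {S S' : LChain A₀ A₁} (_ : (L.append (.single p)).append (P.append R) = S)
      (_ : (L.append (.single p)).append (.cons q R) = S') (Θ : Cells (𝟙 A₀) (𝟙 A₁) S S')
      (_ : HEq (Cells.flank (L.append (.single p)) φ R) Θ) (χ χ' : Cell f g S' r),
      paste Θ χ (Category.id_comp f) (Category.id_comp g) =
        paste Θ χ' (Category.id_comp f) (Category.id_comp g) → χ = χ' := by
    intro S S' hS hS' Θ hΘ χ χ' e
    subst hS hS'
    obtain rfl := eq_of_heq hΘ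
    exact (h (L.append (.single p)) R _).unique e rfl
  exact key (Chain.append_assoc _ _ _) (Chain.append_assoc _ _ _) _
    (Cells.id_append_single_append L p _) χ χ' e

/-- Pasting with `θ`, flanked by identities, is a bijection whose inverse is pasting with `θ'`, so
factorisations through `φ` and through the composite correspond. This serves both to characterise
absoluteness and to move it along isomorphisms of cocones. -/
theorem IsOpcartesian.paste_isIsoCell {A B : X} {P : LChain A B} {q q' : Loose A B}
    {φ : Cell (𝟙 A) (𝟙 B) P q} (h : IsOpcartesian φ) {θ : Cell (𝟙 A) (𝟙 B) (.single q) q'}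
    (hθ : IsIsoCell θ) :
    IsOpcartesian (paste (Cells.single φ) θ (Category.id_comp _) (Category.id_comp _)) := by
  obtain ⟨θ', h₁, h₂⟩ := hθ
  intro A₀ A₁ B₀ B₁ L R f g r χ
  have e₀ : ∀ x : Cell f g (L.append (.cons q' R)) r,
      paste (Cells.flank L φ R) (paste (Cells.flank L θ R) x (Category.id_comp _)
        (Category.id_comp _)) (Category.id_comp _) (Category.id_comp _) =
      paste (Cells.flank L (paste (Cells.single φ) θ (Category.id_comp _) (Category.id_comp _)) R)
        x (Category.id_comp _) (Category.id_comp _) := fun x =>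
    paste_whiskerLeft L (TwoLevel.cons (Cells.single φ) θ (Category.id_comp _)
      (Category.id_comp _) (TwoLevel.ids R)) x _ _ _
      (by rw [TwoLevel.top, TwoLevel.ids_top]; rfl) (by rw [TwoLevel.bot, TwoLevel.ids_bot])
      (by rw [TwoLevel.vert, TwoLevel.ids_vert])
  have e₁ : ∀ x : Cell f g (L.append (.cons q' R)) r,
      paste (Cells.flank L θ' R) (paste (Cells.flank L θ R) x (Category.id_comp _)
        (Category.id_comp _)) (Category.id_comp _) (Category.id_comp _) = x := fun x => by
    refine (paste_whiskerLeft L (TwoLevel.cons (Cells.single θ') θ (Category.id_comp _)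
      (Category.id_comp _) (TwoLevel.ids R)) x (Category.id_comp _) _ (Category.id_comp _)
      (by rw [TwoLevel.top, TwoLevel.ids_top]; rfl) (by rw [TwoLevel.bot, TwoLevel.ids_bot])
      (by rw [TwoLevel.vert, TwoLevel.ids_vert, h₂])).trans ?_
    exact paste_id_append L x
  have e₂ : ∀ x : Cell f g (L.append (.cons q R)) r,
      paste (Cells.flank L θ R) (paste (Cells.flank L θ' R) x (Category.id_comp _)
        (Category.id_comp _)) (Category.id_comp _) (Category.id_comp _) = x := fun x => by
    refine (paste_whiskerLeft L (TwoLevel.cons (Cells.single θ) θ' (Category.id_comp _)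
      (Category.id_comp _) (TwoLevel.ids R)) x (Category.id_comp _) _ (Category.id_comp _)
      (by rw [TwoLevel.top, TwoLevel.ids_top]; rfl) (by rw [TwoLevel.bot, TwoLevel.ids_bot])
      (by rw [TwoLevel.vert, TwoLevel.ids_vert, h₁])).trans ?_
    exact paste_id_append L x
  obtain ⟨y, hy, hu⟩ := h L R χ
  refine ⟨paste (Cells.flank L θ' R) y (Category.id_comp _) (Category.id_comp _), ?_, ?_⟩
  · beta_reduce
    rw [← e₀, e₂, hy]
  · intro x hx
    rw [← hu _ ((e₀ x).trans hx), e₁]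

end

open VirtualEquipment (one oneCell restr restrCell)

section

variable {X : Type u} [VirtualDoubleCategory.{z, w, v, u} X] [VirtualEquipment X]

/-! ### Actions of loose-identities, and composites with companions -/

theorem exists_rightAction {A C : X} (p : Loose A C) :
    ∃ ρ : Cell (𝟙 A) (𝟙 C) (.cons p (.single (one C))) p,
      paste (Cells.cons (idCell p) (Cells.single (oneCell C)) rfl) ρ (Category.id_comp _)
        (Category.id_comp _) = idCell p :=
  (VirtualEquipment.oneCell_opcartesian C (.single p) (.nil C) (idCell p)).exists

theorem exists_leftAction {A C : X} (p : Loose A C) :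
    ∃ ρ : Cell (𝟙 A) (𝟙 C) (.cons (one A) (.single p)) p,
      paste (Cells.cons (oneCell A) (Cells.single (idCell p)) rfl) ρ (Category.id_comp _)
        (Category.id_comp _) = idCell p :=
  (VirtualEquipment.oneCell_opcartesian A (.nil A) (.single p) (idCell p)).exists

/-- Every 2-cell out of `p` is equivariant for the right action of the loose-identity. -/
theorem rightAction_paste {A C E : X} {p : Loose A C}
    {ρ : Cell (𝟙 A) (𝟙 C) (.cons p (.single (one C))) p}
    (hρ : paste (Cells.cons (idCell p) (Cells.single (oneCell C)) rfl) ρ (Category.id_comp _)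
        (Category.id_comp _) = idCell p) {a : A ⟶ E} {b : C ⟶ E} (σ : HCell a b (.single p))
    (τ : HCell b b (.single (one C)))
    (hτ : paste (Cells.single (oneCell C)) τ (Category.id_comp _) (Category.id_comp _) = idH b) :
    paste (Cells.single ρ) σ (Category.id_comp _) (Category.id_comp _) = hcomp σ τ := by
  refine (VirtualEquipment.oneCell_opcartesian C (.single p) (.nil C) σ).unique ?_ ?_
  · refine (paste_single (Cells.flank (.single p) (oneCell C) (.nil C)) ρ (Category.id_comp _)
      (Category.id_comp _) σ _ _ _ _ (Category.id_comp _) (Category.id_comp _)).trans ?_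
    have := congrArg (fun x => paste (Cells.single x) σ (Category.id_comp _)
      (Category.id_comp _)) hρ
    exact this.trans (paste_idCell_single σ)
  · refine (paste_hcomp (Cells.single (idCell p)) σ (Cells.single (oneCell C)) τ
      (Category.id_comp _) (Category.id_comp _) (Category.id_comp _)).trans ?_
    rw [hτ, paste_idCell_single]
    exact hcomp_id_aux σ rfl

/-- Every 2-cell out of `p` is equivariant for the left action of the loose-identity. -/
theorem leftAction_paste {A C E : X} {p : Loose A C}
    {ρ : Cell (𝟙 A) (𝟙 C) (.cons (one A) (.single p)) p}
    (hρ : paste (Cells.cons (oneCell A) (Cells.single (idCell p)) rfl) ρ (Category.id_comp _)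
        (Category.id_comp _) = idCell p) {a : A ⟶ E} {b : C ⟶ E} (σ : HCell a b (.single p))
    (τ : HCell a a (.single (one A)))
    (hτ : paste (Cells.single (oneCell A)) τ (Category.id_comp _) (Category.id_comp _) = idH a) :
    paste (Cells.single ρ) σ (Category.id_comp _) (Category.id_comp _) = hcomp τ σ := by
  refine (VirtualEquipment.oneCell_opcartesian A (.nil A) (.single p) σ).unique ?_ ?_
  · refine (paste_single (Cells.flank (.nil A) (oneCell A) (.single p)) ρ (Category.id_comp _)
      (Category.id_comp _) σ _ _ _ _ (Category.id_comp _) (Category.id_comp _)).trans ?_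
    have := congrArg (fun x => paste (Cells.single x) σ (Category.id_comp _)
      (Category.id_comp _)) hρ
    exact this.trans (paste_idCell_single σ)
  · refine (paste_hcomp (Cells.single (oneCell A)) τ (Cells.single (idCell p)) σ
      (Category.id_comp _) (Category.id_comp _) (Category.id_comp _)).trans ?_
    rw [hτ, paste_idCell_single]
    exact id_hcomp σ

/-- If `p` is the companion of `l`, as exhibited by `η` and `ε`, then a 2-cell `p, q ⇒ q'` that
exhibits `q'` as the restriction `q(l, 1)` is opcartesian. -/
theorem isOpcartesian_of_companion {A D C : X} {l : A ⟶ D} {p : Loose A D} {q : Loose D C}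
    {q' : Loose A C} (η : Cell (𝟙 A) l (.nil A) p) (ε : Cell l (𝟙 D) (.single p) (one D))
    (κ : Cell (𝟙 A) (𝟙 C) (.cons p (.single q)) q') (τ : Cell l (𝟙 C) (.single q') q)
    {ρ : Cell (𝟙 A) (𝟙 D) (.cons p (.single (one D))) p}
    (hρ : paste (Cells.cons (idCell p) (Cells.single (oneCell D)) rfl) ρ (Category.id_comp _)
        (Category.id_comp _) = idCell p)
    {ν : Cell (𝟙 D) (𝟙 C) (.cons (one D) (.single q)) q}
    (hν : paste (Cells.cons (oneCell D) (Cells.single (idCell q)) rfl) ν (Category.id_comp _)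
        (Category.id_comp _) = idCell q)
    (hηε : paste (Cells.cons η (Cells.single ε) rfl) ρ (Category.id_comp _)
      (Category.id_comp _) = idCell p)
    (hητ : paste (Cells.cons η (Cells.single τ) rfl) κ (Category.id_comp _)
      (Category.id_comp _) = idCell q')
    (hκτ : paste (Cells.single κ) τ (Category.id_comp _) (Category.id_comp _) =
      paste (Cells.cons ε (Cells.single (idCell q)) rfl) ν (Category.comp_id _)
        (Category.id_comp _)) :
    IsOpcartesian κ := by
  intro A₀ A₁ B₀ B₁ L R f g s χ
  -- Balancing: with a loose-identity inserted between `p` and `q`, it does not matter whether it is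
  -- absorbed by `p` or by `q`. Both sides reduce to `χ` once the loose-identity is filled by its
  -- unit.
  have bal : paste ((Cells.id L).append (.cons ρ (.cons (idCell q) (Cells.id R) rfl) rfl)) χ
        (Category.id_comp _) (Category.id_comp _) =
      paste ((Cells.id L).append (.cons (idCell p) (.cons ν (Cells.id R) rfl) rfl)) χ
        (Category.id_comp _) (Category.id_comp _) := by
    refine IsOpcartesian.ext_cons (VirtualEquipment.oneCell_opcartesian D) L p (.cons q R) ?_
    refine (paste_whiskerLeft L (TwoLevel.cons
      (Cells.cons (idCell p) (Cells.single (oneCell D)) rfl) ρ (Category.id_comp _)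
      (Category.id_comp _) (TwoLevel.ids (.cons q R))) χ (Category.id_comp _) (Category.id_comp _)
      (Category.id_comp _)
      (by rw [TwoLevel.top, TwoLevel.ids_top]; rfl) (by rw [TwoLevel.bot, TwoLevel.ids_bot]; rfl)
      (by rw [TwoLevel.vert, TwoLevel.ids_vert, hρ])).trans ?_
    refine (paste_whiskerLeft L (TwoLevel.cons (Cells.single (idCell p)) (idCell p)
      (Category.id_comp _) (Category.id_comp _) (TwoLevel.cons
      (Cells.cons (oneCell D) (Cells.single (idCell q)) rfl) ν (Category.id_comp _)
      (Category.id_comp _) (TwoLevel.ids R))) χ (Category.id_comp _) (Category.id_comp _)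
      (Category.id_comp _) ?_ ?_ ?_).symm
    · rw [TwoLevel.top, TwoLevel.top, TwoLevel.ids_top]; rfl
    · rw [TwoLevel.bot, TwoLevel.bot, TwoLevel.ids_bot]
    · rw [TwoLevel.vert, TwoLevel.vert, TwoLevel.ids_vert, hν, paste_idCell_single]; rfl
  -- Pasting `η, ε, 1` onto the balancing equation: on one side `ε` acting on `q` is `κ` followed by
  -- `τ`; on the other the triangle identity removes `η` and `ε`.
  have absorb : paste ((Cells.id L).append (.cons η (.cons (paste (Cells.single κ) τ
      (Category.id_comp _) (Category.id_comp _)) (Cells.id R) rfl) rfl)) χ (Category.id_comp _)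
      (Category.id_comp _) = χ := by
    have h₁ := congrArg (fun x => paste ((Cells.id L).append (.cons η (.cons ε (.cons (idCell q)
      (Cells.id R) rfl) rfl) rfl)) x (Category.id_comp _) (Category.id_comp _)) bal
    refine Eq.trans ?_ (h₁.symm.trans ?_)
    · refine (paste_whiskerLeft L (TwoLevel.cons (Cells.single η) (idCell p)
        (Category.id_comp _) (Category.comp_id _) (TwoLevel.cons
        (Cells.cons ε (Cells.single (idCell q)) rfl) ν (Category.comp_id _)
        (Category.id_comp _) (TwoLevel.ids R))) χ (Category.id_comp _) (Category.id_comp _)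
        (Category.id_comp _) ?_ ?_ ?_).symm
      · rw [TwoLevel.top, TwoLevel.top, TwoLevel.ids_top]; rfl
      · rw [TwoLevel.bot, TwoLevel.bot, TwoLevel.ids_bot]
      · rw [TwoLevel.vert, TwoLevel.vert, TwoLevel.ids_vert, hκτ,
          VirtualDoubleCategory.paste_id]
    · refine (paste_whiskerLeft L (TwoLevel.cons (Cells.cons η (Cells.single ε) rfl) ρ
        (Category.id_comp _) (Category.id_comp _) (TwoLevel.ids (.cons q R))) χ
        (Category.id_comp _) (Category.id_comp _) (Category.id_comp _)
        (by rw [TwoLevel.top, TwoLevel.ids_top]; rfl)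
        (by rw [TwoLevel.bot, TwoLevel.ids_bot]; rfl)
        (by rw [TwoLevel.vert, TwoLevel.ids_vert, hηε])).trans ?_
      exact paste_id_append L χ
  -- The factorisation expands `q'` to `p, q` by means of `η` and `τ`. It exists by `absorb`, and is
  -- unique because `η, τ` followed by `κ` is the identity.
  refine ⟨paste ((Cells.id L).append (.cons η (.cons τ (Cells.id R) rfl) rfl)) χ
    (Category.id_comp _) (Category.id_comp _), ?_, ?_⟩
  · refine Eq.trans ?_ absorb
    refine paste_whiskerLeft L (TwoLevel.cons (Cells.nil (𝟙 A)) η (Category.id_comp _)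
      (Category.id_comp _) (TwoLevel.cons (Cells.single κ) τ (Category.id_comp _)
        (Category.id_comp _) (TwoLevel.ids R))) χ _ _ _ ?_ ?_ ?_
    · rw [TwoLevel.top, TwoLevel.top, TwoLevel.ids_top]; rfl
    · rw [TwoLevel.bot, TwoLevel.bot, TwoLevel.ids_bot]
    · rw [TwoLevel.vert, TwoLevel.vert, TwoLevel.ids_vert]
      have := VirtualDoubleCategory.id_paste η
      exact congrArg (fun x => Cells.cons x _ rfl) this
  · intro y hy
    subst hy
    refine Eq.trans ?_ (paste_whiskerLeft L (TwoLevel.cons (Cells.cons η (Cells.single τ) rfl) κ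
      (Category.id_comp _) (Category.id_comp _) (TwoLevel.ids R)) y (Category.id_comp _)
      (Category.id_comp _) (Category.id_comp _) (by rw [TwoLevel.top, TwoLevel.ids_top]; rfl)
      (by rw [TwoLevel.bot, TwoLevel.ids_bot]) (by rw [TwoLevel.vert, TwoLevel.ids_vert,
        hητ])).symm
    exact (paste_id_append L (P := .cons q' R) y).symm

/-! ### Composition of 2-cells into homs -/

/-- Composition of 2-cells `P ⇒ B(f, g)` and `Q ⇒ B(g, h)`, where the domain `R` is equal to the
concatenation of `P` and `Q`. -/
noncomputable abbrev hcompOf {A₀ A₁ A₂ B : X} {f : A₀ ⟶ B} {g : A₁ ⟶ B} {h : A₂ ⟶ B}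
    {P : LChain A₀ A₁} {Q : LChain A₁ A₂} {R : LChain A₀ A₂} (e : R = P.append Q) (φ : HCell f g P)
    (ψ : HCell g h Q) : HCell f h R :=
  paste (Cells.cons φ (Cells.single ψ) e) (mul B) (Category.comp_id f) (Category.comp_id h)

/-- Composition of a 2-cell `P ⇒ B(f, g)` with a 2-cell `g ⇒ h`. -/
noncomputable abbrev hcompNil {A₀ A₁ B : X} {f : A₀ ⟶ B} {g h : A₁ ⟶ B} {P : LChain A₀ A₁}
    (φ : HCell f g P) (ψ : HCell g h (.nil A₁)) : HCell f h P :=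
  hcompOf P.append_nil.symm φ ψ

theorem hcompOf_assoc {A₀ A₁ A₂ A₃ B : X} {f : A₀ ⟶ B} {g : A₁ ⟶ B} {h : A₂ ⟶ B} {k : A₃ ⟶ B}
    {P : LChain A₀ A₁} {Q : LChain A₁ A₂} {R : LChain A₂ A₃} {PQ : LChain A₀ A₂}
    {QR : LChain A₁ A₃} {S : LChain A₀ A₃} (e₁ : S = PQ.append R) (e₂ : PQ = P.append Q)
    (e₃ : S = P.append QR) (e₄ : QR = Q.append R)
    (φ : HCell f g P) (ψ : HCell g h Q) (χ : HCell h k R) :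
    hcompOf e₁ (hcompOf e₂ φ ψ) χ = hcompOf e₃ φ (hcompOf e₄ ψ χ) := by
  subst e₂ e₄ e₁
  exact hcomp_assoc_aux φ ψ χ e₃

/-- When the first chain is a single loose-cell, or empty as in the next lemma, reassociation of
chains is definitional and no transport is needed. -/
theorem hcomp_assoc_single {A₀ A₁ A₂ A₃ B : X} {f : A₀ ⟶ B} {g : A₁ ⟶ B} {h : A₂ ⟶ B}
    {k : A₃ ⟶ B} {p : Loose A₀ A₁} {Q : LChain A₁ A₂} {R : LChain A₂ A₃}
    (φ : HCell f g (.single p)) (ψ : HCell g h Q) (χ : HCell h k R) :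
    (hcomp (hcomp φ ψ) χ : HCell f k (.cons p (Q.append R))) = hcomp φ (hcomp ψ χ) :=
  hcomp_assoc_aux φ ψ χ rfl

theorem hcomp_assoc_nil {A₀ A₂ A₃ B : X} {f : A₀ ⟶ B} {g : A₀ ⟶ B} {h : A₂ ⟶ B}
    {k : A₃ ⟶ B} {Q : LChain A₀ A₂} {R : LChain A₂ A₃}
    (φ : HCell f g (.nil A₀)) (ψ : HCell g h Q) (χ : HCell h k R) :
    (hcomp (hcomp φ ψ) χ : HCell f k (Q.append R)) = hcomp φ (hcomp ψ χ) :=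
  hcomp_assoc_aux φ ψ χ rfl

theorem hcompNil_idH {A₀ A₁ B : X} {f : A₀ ⟶ B} {g : A₁ ⟶ B} {P : LChain A₀ A₁}
    (φ : HCell f g P) : hcompNil φ (idH g) = φ :=
  hcomp_id_aux φ _

theorem hcompNil_hcompNil {A₀ A₁ B : X} {f : A₀ ⟶ B} {g h k : A₁ ⟶ B} {P : LChain A₀ A₁}
    (φ : HCell f g P) (ψ : HCell g h (.nil A₁)) (χ : HCell h k (.nil A₁)) :
    hcompNil (hcompNil φ ψ) χ = hcompNil φ (hcomp ψ χ) :=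
  hcompOf_assoc _ _ _ rfl φ ψ χ

theorem hcompNil_cancel {A₀ A₁ B : X} {f : A₀ ⟶ B} {g h : A₁ ⟶ B} {P : LChain A₀ A₁}
    (φ : HCell f g P) {ψ : HCell g h (.nil A₁)} {χ : HCell h g (.nil A₁)}
    (e : hcomp ψ χ = idH g) : hcompNil (hcompNil φ ψ) χ = φ := by
  rw [hcompNil_hcompNil, e, hcompNil_idH]

theorem hcomp_hcompNil {A₀ A₁ A₂ B : X} {f : A₀ ⟶ B} {g : A₁ ⟶ B} {h k : A₂ ⟶ B}
    {P : LChain A₀ A₁} {Q : LChain A₁ A₂} (φ : HCell f g P) (ψ : HCell g h Q)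
    (χ : HCell h k (.nil A₂)) : hcomp φ (hcompNil ψ χ) = hcompNil (hcomp φ ψ) χ :=
  (hcompOf_assoc _ _ _ _ φ ψ χ).symm

theorem paste_hcompNil {A₀ A₁ B₀ B₁ B : X} {f : A₀ ⟶ B₀} {g : A₁ ⟶ B₁}
    {f' : B₀ ⟶ B} {g' : B₁ ⟶ B} {h' : B₁ ⟶ B} {k : A₀ ⟶ B} {l : A₁ ⟶ B} {m : A₁ ⟶ B}
    {P : LChain A₀ A₁} {Q : LChain B₀ B₁} (Φ : Cells f g P Q) (ψ : HCell f' g' Q)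
    (ψ' : HCell g' h' (.nil B₁)) (hk : f ≫ f' = k) (hl : g ≫ g' = l) (hm : g ≫ h' = m) :
    paste Φ (hcompNil ψ ψ') hk hm =
      hcompNil (paste Φ ψ hk hl) (paste (Cells.nil g) ψ' hl hm) :=
  paste_pair Φ ψ (Cells.nil g) ψ' hk hl hm P.append_nil.symm Q.append_nil.symm _
    Φ.append_nil.symm (mul B) _ _ _ _ _ _

theorem paste_cons_hcomp {A B A₁ E : X} {P : LChain A B} {q : Loose A B}
    (φ : Cell (𝟙 A) (𝟙 B) P q) {R : LChain B A₁} {f : A ⟶ E} {g : B ⟶ E} {h : A₁ ⟶ E}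
    (ψ : HCell f g (.single q)) (χ : HCell g h R) :
    paste (Cells.cons φ (Cells.id R) rfl) (hcomp ψ χ) (Category.id_comp _) (Category.id_comp _) =
      hcomp (paste (Cells.single φ) ψ (Category.id_comp _) (Category.id_comp _)) χ := by
  refine (paste_hcomp (Cells.single φ) ψ (Cells.id R) χ (Category.id_comp _) (Category.id_comp _)
    (Category.id_comp _)).trans ?_
  rw [VirtualDoubleCategory.id_paste]

/-! ### Functoriality of postcomposition -/

theorem paste_postcomp {A₀ A₁ B₀ B₁ A B : X} {x : A₀ ⟶ B₀} {y : A₁ ⟶ B₁} {P : LChain A₀ A₁}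
    {Q : LChain B₀ B₁} (Θ : Cells x y P Q) {f : B₀ ⟶ A} {f' : B₁ ⟶ A} (φ : HCell f f' Q)
    (g : A ⟶ B) {k : B₀ ⟶ B} {k' : B₁ ⟶ B} (hk : f ≫ g = k) (hk' : f' ≫ g = k')
    {a : A₀ ⟶ A} {a' : A₁ ⟶ A} (ha : x ≫ f = a) (ha' : y ≫ f' = a')
    {b : A₀ ⟶ B} {b' : A₁ ⟶ B} (hb : x ≫ k = b) (hb' : y ≫ k' = b')
    (hc : a ≫ g = b) (hc' : a' ≫ g = b') :
    paste Θ (postcomp φ g hk hk') hb hb' = postcomp (paste Θ φ ha ha') g hc hc' :=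
  paste_single Θ φ ha ha' (mapCell g) hk hk' hb hb' hc hc'

theorem mapCell_id (A : X) : mapCell (𝟙 A) = idCell (one A) := by
  refine (VirtualEquipment.oneCell_opcartesian A (.nil A) (.nil A) (idH (𝟙 A))).unique
    (mapCell_spec (𝟙 A)) ?_
  rw [idH_id]
  exact VirtualDoubleCategory.paste_id (oneCell A)

theorem postcomp_id {A₀ A₁ A : X} {f : A₀ ⟶ A} {f' : A₁ ⟶ A} {P : LChain A₀ A₁}
    (φ : HCell f f' P) : postcomp φ (𝟙 A) (Category.comp_id _) (Category.comp_id _) = φ := by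
  unfold postcomp
  rw [mapCell_id]
  exact VirtualDoubleCategory.paste_id φ

theorem postcomp_mapCell {A B C : X} (g : A ⟶ B) (h : B ⟶ C) {k : A ⟶ C} (hk : g ≫ h = k) :
    postcomp (mapCell g) h hk hk = mapCell k := by
  refine (VirtualEquipment.oneCell_opcartesian A (.nil A) (.nil A) (idH k)).unique ?_
    (mapCell_spec k)
  refine (paste_postcomp (Cells.single (oneCell A)) (mapCell g) h hk hk (Category.id_comp _)
    (Category.id_comp _) (Category.id_comp _) (Category.id_comp _) hk hk).trans ?_
  rw [mapCell_spec, postcomp_idH]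

theorem postcomp_postcomp {A₀ A₁ A B C : X} {f : A₀ ⟶ A} {f' : A₁ ⟶ A} {P : LChain A₀ A₁}
    (φ : HCell f f' P) (g : A ⟶ B) (h : B ⟶ C) {gh : A ⟶ C} (hgh : g ≫ h = gh)
    {k : A₀ ⟶ B} {k' : A₁ ⟶ B} (hk : f ≫ g = k) (hk' : f' ≫ g = k')
    {m : A₀ ⟶ C} {m' : A₁ ⟶ C} (hm : k ≫ h = m) (hm' : k' ≫ h = m')
    (hn : f ≫ gh = m) (hn' : f' ≫ gh = m') :
    postcomp (postcomp φ g hk hk') h hm hm' = postcomp φ gh hn hn' := by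
  refine (paste_postcomp (Cells.single φ) (mapCell g) h hgh hgh hk hk' hn hn' hm hm').symm.trans ?_
  rw [postcomp_mapCell]
  rfl

/-- 2-cells between tight-cells are natural. -/
theorem postcomp_naturality {A₀ A₁ A B : X} {f : A₀ ⟶ A} {f' : A₁ ⟶ A} {P : LChain A₀ A₁}
    (φ : HCell f f' P) {a a' : A ⟶ B} (θ : HCell a a' (.nil A)) {k l : A₀ ⟶ B} {k' l' : A₁ ⟶ B}
    (hk : f ≫ a = k) (hl : f ≫ a' = l) (hk' : f' ≫ a = k') (hl' : f' ≫ a' = l') :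
    hcompNil (postcomp φ a hk hk') (paste (Cells.nil f') θ hk' hl') =
      hcomp (paste (Cells.nil f) θ hk hl) (postcomp φ a' hl hl') := by
  -- The universal case, where the 2-cell is the identity of `A(1, 1)`. It may be checked on the
  -- unit of the loose-identity.
  have h : hcomp (mapCell a) θ = hcomp θ (mapCell a') := by
    refine (VirtualEquipment.oneCell_opcartesian A (.nil A) (.nil A) θ).unique ?_ ?_
    · refine (paste_hcomp (Cells.single (oneCell A)) (mapCell a) (Cells.nil (𝟙 A)) θ
        (Category.id_comp _) (Category.id_comp _) (Category.id_comp _)).trans ?_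
      rw [mapCell_spec]
      exact (id_hcomp _).trans (VirtualDoubleCategory.id_paste θ)
    · refine (paste_hcomp (Cells.nil (𝟙 A)) θ (Cells.single (oneCell A)) (mapCell a')
        (Category.id_comp _) (Category.id_comp _) (Category.id_comp _)).trans ?_
      rw [mapCell_spec]
      exact (hcomp_id_aux _ rfl).trans (VirtualDoubleCategory.id_paste θ)
  have h₁ := paste_hcompNil (Cells.single φ) (mapCell a) θ hk hk' hl'
  have h₂ := paste_hcomp (Cells.nil f) θ (Cells.single φ) (mapCell a') hk hl hl'
  refine h₁.symm.trans (Eq.trans ?_ h₂)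
  exact congrArg (fun x => paste (Cells.single φ) x _ _) h

/-! ### Factorisations through homs -/

theorem paste_homLift {C₀ C₁ A₀ A₁ B Z₀ Z₁ : X} (f : A₀ ⟶ B) (g : A₁ ⟶ B) {a : C₀ ⟶ A₀}
    {b : C₁ ⟶ A₁} {k : C₀ ⟶ B} {l : C₁ ⟶ B} (hk : a ≫ f = k) (hl : b ≫ g = l) {P : LChain C₀ C₁}
    (χ : HCell k l P) {x : Z₀ ⟶ C₀} {y : Z₁ ⟶ C₁} {P' : LChain Z₀ Z₁} (Θ : Cells x y P' P)
    {a' : Z₀ ⟶ A₀} {b' : Z₁ ⟶ A₁} {k' : Z₀ ⟶ B} {l' : Z₁ ⟶ B} (ha : x ≫ a = a')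
    (hb : y ≫ b = b') (hk' : x ≫ k = k') (hl' : y ≫ l = l') (ha' : a' ≫ f = k')
    (hb' : b' ≫ g = l') :
    paste Θ (homLift f g a b hk hl χ) ha hb = homLift f g a' b' ha' hb' (paste Θ χ hk' hl') := by
  refine homLift_unique ha' hb' ?_
  rw [homLift_spec, ← paste_single Θ _ ha hb (homCell f g) hk hl hk' hl', homLift_spec]

theorem homLift_homCell {A₀ A₁ B : X} (f : A₀ ⟶ B) (g : A₁ ⟶ B) :
    homLift f g (𝟙 _) (𝟙 _) (Category.id_comp _) (Category.id_comp _) (homCell f g) =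
      idCell (hom f g) := by
  refine homLift_unique (Category.id_comp _) (Category.id_comp _) ?_
  rw [homLift_spec, paste_idCell_single]

/-! ### The action of a 2-cell `E(j, e) ⇒ E(t, e)` on 2-cells into `E(j, l)` -/

section act

variable {A D E : X} {j t : A ⟶ E} {e : D ⟶ E} (α : HCell t e (.single (hom j e)))

theorem act_homCell : act α (𝟙 D) (Category.id_comp e) (homCell j e) = α := by
  unfold act
  rw [homLift_homCell, paste_idCell_single]

theorem paste_act {D' D'' : X} {x : D' ⟶ D} {l : D' ⟶ E} (hl : x ≫ e = l) {P : LChain A D'}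
    (φ : HCell j l P) {y : D'' ⟶ D'} {P' : LChain A D''} (Θ : Cells (𝟙 A) y P' P)
    {m : D'' ⟶ E} (hm : y ≫ l = m) {x' : D'' ⟶ D} (hx' : y ≫ x = x') (hm' : x' ≫ e = m) :
    paste Θ (act α x hl φ) (Category.id_comp _) hm =
      act α x' hm' (paste Θ φ (Category.id_comp _) hm) := by
  unfold act
  rw [paste_single Θ _ (Category.id_comp _) hx' α (Category.id_comp _) hl (Category.id_comp _) hm
    (Category.id_comp _) hm', paste_homLift j e (Category.id_comp _) hl φ Θ (Category.id_comp _)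
    hx' (Category.id_comp _) hm (Category.id_comp _) hm']

theorem act_act {D' D'' : X} {x : D' ⟶ D} {l : D' ⟶ E} (hl : x ≫ e = l) {y : D'' ⟶ D'}
    {m : D'' ⟶ E} (hm : y ≫ l = m) {P : LChain A D''} (φ : HCell j m P) {x' : D'' ⟶ D}
    (hx' : y ≫ x = x') (hm' : x' ≫ e = m) :
    act (act α x hl (homCell j l)) y hm φ = act α x' hm' φ := by
  refine (paste_act α hl (homCell j l) (Cells.single (homLift j l (𝟙 A) y (Category.id_comp _) hm
    φ)) hm hx' hm').trans ?_
  rw [homLift_spec]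

/-- Every 2-cell `E(j, e) ⇒ E(t, e)` is natural in its second argument. -/
theorem act_hcomp_postcomp {D' D'' : X} {x : D' ⟶ D} {x' : D'' ⟶ D} {l : D' ⟶ E} {l' : D'' ⟶ E}
    (hl : x ≫ e = l) (hl' : x' ≫ e = l') {P : LChain A D'} {Q : LChain D' D''}
    (φ : HCell j l P) (ψ : HCell x x' Q) :
    act α x' hl' (hcomp φ (postcomp ψ e hl hl')) =
      hcomp (act α x hl φ) (postcomp ψ e hl hl') := by
  obtain ⟨ρ, hρ⟩ := exists_rightAction (hom j e)
  -- The factorisation of the composite through `E(j, e)` is that of `φ`, followed by the right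
  -- action of `D(1, 1)` along `ψ`. Since `α`, like every 2-cell out of `E(j, e)`, is equivariant
  -- for this action, naturality follows.
  have h : homLift j e (𝟙 A) x' (Category.id_comp _) hl' (hcomp φ (postcomp ψ e hl hl')) =
      paste (Cells.cons (homLift j e (𝟙 A) x (Category.id_comp _) hl φ) (Cells.single ψ) rfl) ρ
        (Category.id_comp _) (Category.comp_id _) := by
    refine homLift_unique (Category.id_comp _) hl' ?_
    rw [homLift_spec, ← paste_single _ ρ (Category.id_comp _) (Category.comp_id _) (homCell j e)
      (Category.id_comp _) (Category.id_comp _) (Category.id_comp _) hl' (Category.id_comp _) hl',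
      rightAction_paste hρ (homCell j e) (mapCell e) (mapCell_spec e)]
    refine Eq.trans ?_ (paste_hcomp (Cells.single (homLift j e (𝟙 A) x (Category.id_comp _) hl φ))
      (homCell j e) (Cells.single ψ) (mapCell e) (Category.id_comp _) hl hl').symm
    rw [homLift_spec]
    rfl
  unfold act
  rw [h, ← paste_single _ ρ (Category.id_comp _) (Category.comp_id _) α
      (Category.id_comp _) (Category.id_comp _) (Category.id_comp _) hl' (Category.id_comp _) hl',
      rightAction_paste hρ α (mapCell e) (mapCell_spec e)]
  exact paste_hcomp (Cells.single (homLift j e (𝟙 A) x (Category.id_comp _) hl φ))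
      α (Cells.single ψ) (mapCell e) (Category.id_comp _) hl hl'

end act

end

section

variable {X : Type u} [VirtualDoubleCategory.{z, w, v, u} X] [VirtualEquipment X]

/-! ### Absolute cocones and density -/

/-- An opcartesian 2-cell followed by an invertible one is opcartesian; conversely `E(j, c)` itself
serves as the composite, with the identity as canonical 2-cell. -/
theorem Cocone.isAbsolute_iff {A Z Y E : X} {j : A ⟶ E} {p : Loose Z Y} {f : Z ⟶ E}
    {K : Cocone p f} : K.IsAbsolute j ↔ IsOpcartesian (K.nerveCell j) := by
  constructor
  · rintro ⟨q, κ, hκ, can, hcan, hiso⟩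
    rw [← hcan]
    exact hκ.paste_isIsoCell hiso
  · intro h
    exact ⟨_, _, h, idCell _, VirtualDoubleCategory.paste_id _, idCell _,
      VirtualDoubleCategory.paste_id _, VirtualDoubleCategory.paste_id _⟩

theorem Cocone.IsAbsolute.isLeftAbsolute {A Z Y E : X} {j : A ⟶ E} {p : Loose Z Y} {f : Z ⟶ E}
    {K : Cocone p f} : K.IsAbsolute j → K.IsLeftAbsolute j := by
  rintro ⟨q, κ, hκ, h⟩
  exact ⟨q, κ, IsOpcartesian.isLeftOpcartesian hκ, h⟩

theorem Cocone.isLeftAbsolute_iff {A Z Y E : X} {j : A ⟶ E} (h : LeftCompositesAreComposites j)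
    {p : Loose Z Y} {f : Z ⟶ E} {K : Cocone p f} : K.IsLeftAbsolute j ↔ K.IsAbsolute j := by
  constructor
  · rintro ⟨q, κ, hκ, h'⟩
    exact ⟨q, κ, h f p q κ hκ, h'⟩
  · exact Cocone.IsAbsolute.isLeftAbsolute

theorem Cocone.paste_nerveCell_hcomp {A Z Y V E : X} {j t : A ⟶ E} {p : Loose Z Y} {f : Z ⟶ E}
    (K : Cocone p f) (α : HCell t K.pt (.single (hom j K.pt))) {g : V ⟶ E} {Q : LChain Y V}
    (ψ : HCell K.pt g Q) :
    paste (Cells.cons (K.nerveCell j) (Cells.id Q) rfl) (hcomp α ψ) (Category.id_comp _)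
        (Category.id_comp _) =
      hcomp (act α (𝟙 Y) (Category.id_comp _) (hcomp (homCell j f) K.cell)) ψ :=
  paste_cons_hcomp (K.nerveCell j) α ψ

/-- This is the exchange on which the density arguments run: precomposing with the nerve 2-cell
turns a 2-cell out of `c` into one out of `f`. -/
theorem Cocone.paste_nerveCell_homCell_hcomp {A Z Y V E : X} {j : A ⟶ E} {p : Loose Z Y}
    {f : Z ⟶ E} (K : Cocone p f) {g : V ⟶ E} {Q : LChain Y V} (ψ : HCell K.pt g Q) :
    paste (Cells.cons (K.nerveCell j) (Cells.id Q) rfl) (hcomp (homCell j K.pt) ψ)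
        (Category.id_comp _) (Category.id_comp _) =
      hcomp (homCell j f) (hcomp K.cell ψ) := by
  refine (paste_cons_hcomp (K.nerveCell j) (homCell j K.pt) ψ).trans ?_
  unfold Cocone.nerveCell
  rw [homLift_spec]
  exact hcomp_assoc_single (homCell j f) K.cell ψ

/-- If `j` is dense, then every `e` is the colimit of `j` weighted by `E(j, e)`. -/
theorem Dense.existsUnique {A E : X} {j : A ⟶ E} (hj : Dense j) {Y V : X} (e : Y ⟶ E) (g : V ⟶ E)
    (Q : LChain Y V) (χ : HCell j g (.cons (hom j e) Q)) :
    ∃! χ' : HCell e g Q, hcomp (homCell j e) χ' = χ := by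
  -- The identity of `E(j, e)` factors as `k, i` followed by the nerve 2-cell of this cocone, which
  -- displays `E(j, e)` as `E(j, 1)` composed with `E(1, e)`. Density can therefore be applied to
  -- the chain `E(1, e), Q`, and `i` then removes `E(1, e)`.
  let K : Cocone (hom (𝟙 E) e) (𝟙 E) := ⟨e, homCell (𝟙 E) e⟩
  let i : Cell e (𝟙 Y) (.nil Y) (hom (𝟙 E) e) :=
    homLift (𝟙 E) e e (𝟙 Y) (Category.comp_id _) (Category.id_comp _) (idH e)
  have hi : paste (Cells.single i) (homCell (𝟙 E) e) (Category.comp_id _) (Category.id_comp _) =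
    idH e := homLift_spec _ _ _ _ _ _ _
  let k : Cell (𝟙 A) e (.single (hom j e)) (hom j (𝟙 E)) :=
    homLift j (𝟙 E) (𝟙 A) e (Category.id_comp _) (Category.comp_id _) (homCell j e)
  have hk : paste (Cells.single k) (homCell j (𝟙 E)) (Category.id_comp _) (Category.comp_id _) =
    homCell j e := homLift_spec _ _ _ _ _ _ _
  have hki : paste (Cells.cons k (Cells.single i) rfl) (K.nerveCell j) (Category.id_comp _)
      (Category.id_comp _) = idCell (hom j e) := by
    refine homLift_unique (Category.id_comp _) (Category.id_comp _) ?_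
    rw [paste_idCell_single, ← paste_single _ (K.nerveCell j) (Category.id_comp _)
      (Category.id_comp _) (homCell j e) (Category.id_comp _) (Category.id_comp _)
      (Category.id_comp _) (Category.id_comp _) (Category.id_comp _) (Category.id_comp _)]
    unfold Cocone.nerveCell
    rw [homLift_spec]
    refine (paste_hcomp (Cells.single k) (homCell j (𝟙 E)) (Cells.single i) (homCell (𝟙 E) e)
      (Category.id_comp _) (Category.comp_id _) (Category.id_comp _)).trans ?_
    rw [hk, hi]
    exact hcomp_id_aux _ rfl
  obtain ⟨χ₁, h₁, -⟩ := hj g (.cons (hom (𝟙 E) e) Q) (paste (Cells.cons (K.nerveCell j)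
    (Cells.id Q) rfl) χ (Category.id_comp _) (Category.id_comp _))
  refine ⟨paste (Cells.cons i (Cells.id Q) rfl) χ₁ (Category.comp_id _) (Category.id_comp _),
    ?_, ?_⟩
  · have h₂ := paste_hcomp (Cells.single k) (homCell j (𝟙 E)) (Cells.cons i (Cells.id Q) rfl) χ₁
      (Category.id_comp _) (Category.comp_id _) (Category.id_comp _)
    rw [hk] at h₂
    refine h₂.symm.trans ?_
    have h₃ := congrArg (fun x => paste (Cells.cons k (Cells.cons i (Cells.id Q) rfl) rfl) x
      (Category.id_comp _) (Category.id_comp _)) h₁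
    refine Eq.trans h₃ ?_
    refine (paste_whiskerLeft (.nil A) (TwoLevel.cons (Cells.cons k (Cells.single i) rfl)
      (K.nerveCell j) (Category.id_comp _) (Category.id_comp _) (TwoLevel.ids Q)) χ
      (Category.id_comp _) (Category.id_comp _) (Category.id_comp _)
      (by rw [TwoLevel.top, TwoLevel.ids_top]; rfl) (by rw [TwoLevel.bot, TwoLevel.ids_bot])
      (by rw [TwoLevel.vert, TwoLevel.ids_vert, hki])).trans ?_
    exact VirtualDoubleCategory.id_paste χ
  · intro χ' hχ'
    -- Uniqueness in the density of `j` determines `χ'` after composing with `E(1, e)`; pasting with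
    -- `i` recovers `χ'` itself.
    have h₂ : hcomp (homCell (𝟙 E) e) χ' = χ₁ := by
      refine (hj g (.cons (hom (𝟙 E) e) Q) _).unique ?_ h₁
      subst hχ'
      exact (K.paste_nerveCell_homCell_hcomp χ').symm
    rw [← h₂]
    refine Eq.symm ((paste_hcomp (Cells.single i) (homCell (𝟙 E) e) (Cells.id Q) χ'
      (Category.comp_id _) (Category.id_comp _) (Category.id_comp _)).trans ?_)
    rw [hi, VirtualDoubleCategory.id_paste]
    exact id_hcomp _

/-- If `j` is dense, then a cocone that satisfies the condition for `j`-absoluteness is a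
colimit. -/
theorem Dense.isColimit {A E : X} {j : A ⟶ E} (hj : Dense j) {Z Y : X} {p : Loose Z Y}
    {f : Z ⟶ E} {K : Cocone p f} (hK : IsOpcartesian (K.nerveCell j)) : K.IsColimit := by
  intro V g Q χ
  -- Precompose `χ` with `E(j, f)`, factor through `E(j, c)`, and remove `E(j, c)` by density at
  -- `c`. Density at `f` then shows that the resulting 2-cell induces `χ`.
  obtain ⟨χ₁, h₁, -⟩ := IsOpcartesian.isLeftOpcartesian hK Q
    (hcomp (P := .single (hom j f)) (Q := .cons p Q) (homCell j f) χ)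
  obtain ⟨χ', h', hu⟩ := hj.existsUnique K.pt g Q χ₁
  refine ⟨χ', ?_, ?_⟩
  · refine (hj.existsUnique f g (.cons p Q) (hcomp (homCell j f) χ)).unique ?_ rfl
    refine (K.paste_nerveCell_homCell_hcomp χ').symm.trans ?_
    rw [h']
    exact h₁
  · intro y hy
    refine hu y (IsLeftOpcartesian.ext (IsOpcartesian.isLeftOpcartesian hK) ?_)
    refine (K.paste_nerveCell_homCell_hcomp y).trans (Eq.trans ?_ h₁.symm)
    exact congrArg (fun x => hcomp (homCell j f) x) hy

/-! ### Algebras -/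

namespace RelativeMonad

variable {A E : X} {j : A ⟶ E} {T : RelativeMonad j}

theorem Mediates.act_op {C D D' : X} {U : T.Algebra C} {M : T.Algebra D} {x : D ⟶ C}
    (h : Mediates U M x) {y : D' ⟶ D} {m : D' ⟶ E} (hm : y ≫ M.e = m) {P : LChain A D'}
    (φ : HCell j m P) {x' : D' ⟶ C} (hx' : y ≫ x = x') (hm' : x' ≫ U.e = m) :
    act M.op y hm φ = act U.op x' hm' φ := by
  obtain ⟨hx, h⟩ := h
  rw [← h]
  exact act_act U.op hx hm φ hx' hm'

/-- The restriction of a `T`-algebra along a tight-cell. -/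
noncomputable def Algebra.restrict {C D : X} (U : T.Algebra C) (x : D ⟶ C) {e : D ⟶ E}
    (h : x ≫ U.e = e) : T.Algebra D where
  e := e
  op := act U.op x h (homCell j e)
  unit_op := by
    have h₁ := paste_hcomp (Cells.nil (𝟙 A)) T.unit
      (Cells.single (homLift j U.e (𝟙 A) x (Category.id_comp _) h (homCell j e))) U.op
      (Category.id_comp _) (Category.id_comp _) h
    have h₂ : paste (Cells.nil (𝟙 A)) T.unit (Category.id_comp _) (Category.id_comp _) = T.unit :=
      VirtualDoubleCategory.id_paste _
    rw [h₂] at h₁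
    refine h₁.symm.trans ?_
    refine (congrArg (fun y => paste (Cells.single (homLift j U.e (𝟙 A) x (Category.id_comp _) h
      (homCell j e))) y (Category.id_comp _) h) U.unit_op).trans ?_
    rw [homLift_spec]
  op_op := by
    set k := homLift j U.e (𝟙 A) x (Category.id_comp _) h (homCell j e) with hk
    -- Both sides of the associativity law for the restriction are those of `U`, pasted with `k :
    -- E(j, e) ⇒ E(j, u)`.
    have e₁ : ∀ {s : A ⟶ E} (ψ : HCell s T.t (.single (hom j T.t))),
        paste (Cells.cons (idCell (hom j T.t)) (Cells.single k) rfl) (hcomp ψ U.op)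
          (Category.id_comp _) h = hcomp ψ (act U.op x h (homCell j e)) := by
      intro s ψ
      refine (paste_hcomp (Cells.single (idCell (hom j T.t))) ψ (Cells.single k) U.op
        (Category.id_comp _) (Category.id_comp _) h).trans ?_
      rw [paste_idCell_single]
      rfl
    rw [act_act U.op h (Category.id_comp e) _ (Category.id_comp x) h, ← e₁ T.ext, ← U.op_op,
      ← e₁ (homCell j T.t)]
    exact (paste_act U.op (Category.id_comp _) _ _ h (Category.comp_id _) h).symm

theorem Algebra.restrict_mediates {C D : X} (U : T.Algebra C) (x : D ⟶ C) {e : D ⟶ E}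
    (h : x ≫ U.e = e) : Mediates U (U.restrict x h) x := ⟨h, rfl⟩

theorem Mediates.refl {C : X} (U : T.Algebra C) : Mediates U U (𝟙 C) :=
  ⟨Category.id_comp _, act_homCell U.op⟩

/-- Postcomposition with the carrier of an algebra gives graded morphisms. -/
theorem isGradedMorphism_postcomp {C D D' : X} {U : T.Algebra C} {M : T.Algebra D}
    {M' : T.Algebra D'} {x : D ⟶ C} {x' : D' ⟶ C} (hx : Mediates U M x) (hx' : Mediates U M' x')
    (h : x ≫ U.e = M.e) (h' : x' ≫ U.e = M'.e) {P : LChain D D'} (ψ : HCell x x' P) :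
    IsGradedMorphism M M' (postcomp ψ U.e h h') := by
  unfold IsGradedMorphism
  rw [hx'.act_op (Category.id_comp _) _ (Category.id_comp _) h', act_hcomp_postcomp]
  obtain ⟨_, e⟩ := hx
  rw [e]

/-- The hypothesis is the universal case `φ = homCell j e`; pasting with the factorisation of `φ`
through `E(j, e)` gives the rest. No algebra laws are involved, so this can be used while an algebra
is still being built. -/
theorem act_hcomp_of_eq {t : A ⟶ E} {D D' : X} {e : D ⟶ E} {e' : D' ⟶ E}
    {α : HCell t e (.single (hom j e))} {α' : HCell t e' (.single (hom j e'))} {P : LChain D D'}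
    {ε : HCell e e' P}
    (h : act α' (𝟙 D') (Category.id_comp _) (hcomp (homCell j e) ε) = hcomp α ε)
    {Q : LChain A D} (φ : HCell j e Q) :
    act α' (𝟙 D') (Category.id_comp _) (hcomp φ ε) =
      hcomp (act α (𝟙 D) (Category.id_comp _) φ) ε := by
  set k := homLift j e (𝟙 A) (𝟙 D) (Category.id_comp _) (Category.id_comp _) φ with hk
  have e₁ : ∀ {s : A ⟶ E} (ψ : HCell s e (.single (hom j e))),
      paste (Cells.cons k (Cells.id P) rfl) (hcomp ψ ε) (Category.id_comp _)
        (Category.id_comp _) =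
      hcomp (paste (Cells.single k) ψ (Category.id_comp _) (Category.id_comp _)) ε :=
    fun ψ => paste_cons_hcomp k ψ ε
  have e₂ := e₁ (homCell j e)
  rw [hk, homLift_spec, ← hk] at e₂
  have e₃ := e₁ α
  rw [← h] at e₃
  have e₄ := paste_act α' (Category.id_comp _) (hcomp (homCell j e) ε)
    (Cells.cons k (Cells.id P) rfl) (Category.id_comp _) (Category.id_comp _) (Category.id_comp _)
  rw [e₂] at e₄
  exact e₄.symm.trans e₃

/-- Graded morphisms act on 2-cells into `E(j, e)`. -/
theorem IsGradedMorphism.act_hcomp {D D' : X} {M : T.Algebra D} {M' : T.Algebra D'}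
    {P : LChain D D'} {ε : HCell M.e M'.e P} (h : IsGradedMorphism M M' ε) {Q : LChain A D}
    (φ : HCell j M.e Q) :
    act M'.op (𝟙 D') (Category.id_comp _) (hcomp φ ε) =
      hcomp (act M.op (𝟙 D) (Category.id_comp _) φ) ε :=
  act_hcomp_of_eq h φ

/-- Apply gradedness of `θ` to `homCell j M'.e` composed with `θ'`, cancel, and compose with `θ'` on
the right. -/
theorem IsGradedMorphism.inverse {D : X} {M M' : T.Algebra D} {θ : HCell M.e M'.e (.nil D)}
    {θ' : HCell M'.e M.e (.nil D)} (h : IsGradedMorphism M M' θ) (h₁ : hcomp θ θ' = idH M.e)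
    (h₂ : hcomp θ' θ = idH M'.e) : IsGradedMorphism M' M θ' := by
  have e₁ := h.act_hcomp (hcomp (homCell j M'.e) θ')
  have e₂ : hcomp (hcomp (homCell j M'.e) θ') θ = homCell j M'.e :=
    hcompNil_cancel (homCell j M'.e) h₂
  have e₃ : act M'.op (𝟙 D) (Category.id_comp _) (hcomp (hcomp (homCell j M'.e) θ') θ) = M'.op :=
    (congrArg (fun x => act M'.op (𝟙 D) (Category.id_comp _) x) e₂).trans (act_homCell M'.op)
  have e₄ := congrArg (fun x => hcomp x θ') (e₃.symm.trans e₁)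
  exact (e₄.trans (hcompNil_cancel _ h₁)).symm

/-- A 2-cell whose composite with a suitable graded cocone is graded is itself graded. -/
theorem IsGradedMorphism.of_hcomp {Z Y V : X} {M : T.Algebra Z} {N : T.Algebra Y}
    {N' : T.Algebra V} {p : Loose Z Y} {c : HCell M.e N.e (.single p)}
    (hc : IsGradedMorphism M N c) (ho : IsOpcartesian (Cocone.nerveCell j ⟨N.e, c⟩))
    {Q : LChain Y V} {θ : HCell N.e N'.e Q} (h : IsGradedMorphism M N' (hcomp c θ)) :
    IsGradedMorphism N N' θ := by
  -- After pasting with the nerve 2-cell, and using that `c` is graded, the equation for `θ` becomes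
  -- the equation for `hcomp c θ`.
  refine IsLeftOpcartesian.ext (IsOpcartesian.isLeftOpcartesian ho) ?_
  rw [Cocone.paste_nerveCell_hcomp]
  refine (paste_act N'.op (Category.id_comp _) (hcomp (homCell j N.e) θ)
    (Cells.cons (Cocone.nerveCell j ⟨N.e, c⟩) (Cells.id Q) rfl) (Category.id_comp _)
    (Category.id_comp _) (Category.id_comp _)).trans ?_
  rw [Cocone.paste_nerveCell_homCell_hcomp ⟨N.e, c⟩ θ]
  refine Eq.trans h ?_
  unfold IsGradedMorphism at hc
  rw [hc]
  exact (hcomp_assoc_single M.op c θ).symm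

/-! ### Algebra objects and the creation of absolute colimits -/

/-- The carrier of an algebra object is faithful on 2-cells. -/
theorem IsAlgebraObject.postcomp_injective {C D D' : X} {U : T.Algebra C}
    (hU : IsAlgebraObject U) {x : D ⟶ C} {x' : D' ⟶ C} {e : D ⟶ E} {e' : D' ⟶ E}
    (h : x ≫ U.e = e) (h' : x' ≫ U.e = e') {P : LChain D D'} {ψ ψ' : HCell x x' P}
    (hψ : postcomp ψ U.e h h' = postcomp ψ' U.e h h') : ψ = ψ' :=
  -- Every tight-cell into `C` carries the restricted algebra structure, so the uniqueness clause
  -- for graded morphisms applies to arbitrary `x` and `x'`.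
  (hU.cell (U.restrict x h) (U.restrict x' h') x x' (U.restrict_mediates x h)
    (U.restrict_mediates x' h') h h' (postcomp ψ' U.e h h') (isGradedMorphism_postcomp
    (U.restrict_mediates x h) (U.restrict_mediates x' h') h h' ψ')).unique hψ rfl

/-- The carrier of an algebra object strictly creates `j`-absolute colimits. -/
theorem IsAlgebraObject.creates {C Z Y : X} {U : T.Algebra C} (hU : IsAlgebraObject U)
    {p : Loose Z Y} {f : Z ⟶ C} {k : Z ⟶ E} (hk : f ≫ U.e = k) {L : Cocone p k}
    (hL : L.IsColimit) (ho : IsOpcartesian (L.nerveCell j)) :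
    ∃ (K : Cocone p f) (hx : K.pt ≫ U.e = L.pt), postcomp K.cell U.e hk hx = L.cell ∧
      K.IsColimit ∧ ∀ (x : Y ⟶ C) (hx : x ≫ U.e = L.pt) (c : HCell f x (.single p)),
        postcomp c U.e hk hx = L.cell → (⟨x, c⟩ : Cocone p f) = K := by
  obtain ⟨w, l⟩ := L
  set M := U.restrict f hk with hM
  have hMf := U.restrict_mediates f hk
  -- The extension operator on `w` is forced: it is the unique one for which `l` is a graded
  -- morphism out of the algebra carried by `f ≫ u`.
  obtain ⟨op, hop, hopu⟩ := IsOpcartesian.isLeftOpcartesian ho (.nil Y)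
    (hcomp (P := .single (hom j k)) (Q := .single p) M.op l)
  replace hop : act op (𝟙 Y) (Category.id_comp _) (hcomp (homCell j k) l) = hcomp M.op l := hop
  replace hopu : ∀ op' : HCell T.t w (.single (hom j w)),
      act op' (𝟙 Y) (Category.id_comp _) (hcomp (homCell j k) l) = hcomp M.op l → op' = op :=
    hopu
  set κ := Cocone.nerveCell j (⟨w, l⟩ : Cocone p k) with hκ
  have hκs : paste (Cells.single κ) (homCell j w) (Category.id_comp _) (Category.id_comp _) =
      hcomp (homCell j k) l := homLift_spec _ _ _ _ _ _ _
  let N : T.Algebra Y :=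
    { e := w
      op := op
      unit_op := by
        refine IsLeftOpcartesian.ext (R := .nil Y) (IsOpcartesian.isLeftOpcartesian ho) ?_
        refine Eq.trans ?_ hκs.symm
        refine (paste_hcomp (Cells.nil (𝟙 A)) T.unit (Cells.single κ) op (Category.id_comp _)
          (Category.id_comp _) (Category.id_comp _)).trans ?_
        have e₁ : paste (Cells.nil (𝟙 A)) T.unit (Category.id_comp _) (Category.id_comp _) =
          T.unit := VirtualDoubleCategory.id_paste _
        rw [e₁]
        refine (congrArg (fun x => hcomp T.unit x) hop).trans ?_
        refine (hcomp_assoc_nil T.unit M.op l).symm.trans ?_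
        exact congrArg (fun x => hcomp x l) M.unit_op
      op_op := by
        have e₁ : ∀ {s : A ⟶ E} (ψ : HCell s T.t (.single (hom j T.t))),
            paste (Cells.cons (idCell (hom j T.t)) (Cells.single κ) rfl) (hcomp ψ op)
              (Category.id_comp _) (Category.id_comp _) = hcomp (hcomp ψ M.op) l := by
          intro s ψ
          refine (paste_hcomp (Cells.single (idCell (hom j T.t))) ψ (Cells.single κ) op
            (Category.id_comp _) (Category.id_comp _) (Category.id_comp _)).trans ?_
          rw [paste_idCell_single]
          exact (congrArg (fun x => hcomp ψ x) hop).trans (hcomp_assoc_single ψ M.op l).symm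
        -- The law is tested with `E(j, t)` to the left of `E(j, f ≫ u), p`. This is the step that
        -- uses a composite rather than a left-composite.
        refine (ho (.single (hom j T.t)) (.nil Y) (hcomp (P := .cons (hom j T.t)
          (.single (hom j k))) (Q := .single p) (hcomp T.ext M.op) l)).unique ?_ (e₁ T.ext)
        refine (paste_act op (Category.id_comp _) (hcomp (homCell j T.t) op)
          (Cells.cons (idCell (hom j T.t)) (Cells.single κ) rfl) (Category.id_comp _)
          (Category.id_comp _) (Category.id_comp _)).trans ?_
        rw [e₁]
        refine (act_hcomp_of_eq hop (hcomp (homCell j T.t) M.op)).trans ?_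
        exact congrArg (fun x => hcomp x l) M.op_op }
  have hl : IsGradedMorphism M N l := hop
  obtain ⟨x, hx, hxu⟩ := hU.tight N
  have hxe : x ≫ U.e = w := hx.choose
  obtain ⟨c, hc, -⟩ := hU.cell M N f x hMf hx hk hxe l hl
  refine ⟨⟨x, c⟩, hxe, hc, ?_, ?_⟩
  · intro V g Q χ
    obtain ⟨χ₀, h₀, h₀u⟩ := hL (g ≫ U.e) Q (postcomp χ U.e hk rfl)
    have hg := U.restrict_mediates g rfl
    -- The 2-cell induced by the colimit in `E` is graded, because its composite with `l` is the
    -- image of `χ`. It therefore lifts to the algebra object.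
    have h₁ : IsGradedMorphism N (U.restrict g rfl) χ₀ := by
      refine IsGradedMorphism.of_hcomp hl ho ?_
      have h₂ := isGradedMorphism_postcomp hMf hg hk rfl χ
      exact Eq.mp (congrArg (fun z => IsGradedMorphism M (U.restrict g rfl) z) h₀.symm) h₂
    obtain ⟨χ', h', -⟩ := hU.cell N (U.restrict g rfl) x g hx hg hxe rfl χ₀ h₁
    refine ⟨χ', hU.postcomp_injective hk rfl ?_, fun y hy => hU.postcomp_injective hxe rfl ?_⟩
    · refine (postcomp_hcomp c χ' U.e hk hxe rfl).trans ?_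
      exact (congrArg₂ (fun y z => hcomp y z) hc h').trans h₀
    · refine (h₀u _ ?_).trans h'.symm
      refine Eq.trans ?_ (congrArg (fun z => postcomp z U.e hk rfl) hy)
      exact (congrArg (fun z => hcomp z (postcomp y U.e hxe rfl)) hc.symm).trans
        (postcomp_hcomp c y U.e hk hxe rfl).symm
  · intro x' hx' c' hc'
    -- Any other lift of `(w, l)` induces an extension operator on `w` making `l` graded; this is
    -- `op`, so the lift mediates `N` and equals `x`.
    have hm : Mediates U N x' := by
      refine ⟨hx', hopu _ ?_⟩
      have h₂ := isGradedMorphism_postcomp hMf (U.restrict_mediates x' hx') hk hx' c'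
      exact Eq.mp (congrArg (fun z => IsGradedMorphism M (U.restrict x' hx') z) hc') h₂
    obtain rfl := hxu x' hm
    rw [hU.postcomp_injective hk hxe (hc'.trans hc.symm)]

end RelativeMonad

end

section

variable {X : Type u} [VirtualDoubleCategory.{z, w, v, u} X] [VirtualEquipment X]

/-! ### Comparison of cocones -/

theorem Cocone.map_eq_iff {Z Y W V : X} {p : Loose Z Y} {f : Z ⟶ W} {g : W ⟶ V}
    {K : Cocone p f} {L : Cocone p (f ≫ g)} :
    K.map g = L ↔ ∃ h : K.pt ≫ g = L.pt, postcomp K.cell g rfl h = L.cell := by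
  constructor
  · rintro rfl
    exact ⟨rfl, rfl⟩
  · rintro ⟨h, h'⟩
    have key : ∀ (w : Y ⟶ V) (l : HCell (f ≫ g) w (.single p)) (h : K.pt ≫ g = w),
        postcomp K.cell g rfl h = l → K.map g = ⟨w, l⟩ := by
      rintro w l rfl rfl
      rfl
    exact key _ _ h h'

theorem Cocone.IsColimit.exists_iso {Z Y W : X} {p : Loose Z Y} {f : Z ⟶ W} {K K' : Cocone p f}
    (h : K.IsColimit) (h' : K'.IsColimit) :
    ∃ (θ : HCell K.pt K'.pt (.nil Y)) (θ' : HCell K'.pt K.pt (.nil Y)),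
      hcomp K.cell θ = K'.cell ∧ hcomp θ θ' = idH K.pt ∧ hcomp θ' θ = idH K'.pt := by
  obtain ⟨θ, e, -⟩ := h K'.pt (.nil Y) K'.cell
  obtain ⟨θ', e', -⟩ := h' K.pt (.nil Y) K.cell
  refine ⟨θ, θ', e, ?_, ?_⟩
  · refine (h K.pt (.nil Y) K.cell).unique ?_ (hcompNil_idH K.cell)
    refine (hcomp_assoc_single K.cell θ θ').symm.trans ?_
    exact (congrArg (fun x => hcomp x θ') e).trans e'
  · refine (h' K'.pt (.nil Y) K'.cell).unique ?_ (hcompNil_idH K'.cell)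
    refine (hcomp_assoc_single K'.cell θ' θ).symm.trans ?_
    exact (congrArg (fun x => hcomp x θ) e').trans e

theorem Cocone.IsColimit.of_iso {Z Y W : X} {p : Loose Z Y} {f : Z ⟶ W} {K K' : Cocone p f}
    (h : K.IsColimit) {θ : HCell K.pt K'.pt (.nil Y)} {θ' : HCell K'.pt K.pt (.nil Y)}
    (e : hcomp K.cell θ = K'.cell) (e₁ : hcomp θ θ' = idH K.pt) (e₂ : hcomp θ' θ = idH K'.pt) :
    K'.IsColimit := by
  intro V g Q χ
  obtain ⟨y, hy, hu⟩ := h g Q χ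
  have key : ∀ x : HCell K'.pt g Q, hcomp K'.cell x = hcomp K.cell (hcomp θ x) := fun x =>
    (congrArg (fun z => hcomp z x) e.symm).trans (hcomp_assoc_single K.cell θ x)
  refine ⟨hcomp θ' y, ?_, fun x hx => ?_⟩
  · refine (key _).trans (Eq.trans ?_ hy)
    refine congrArg (fun z => hcomp K.cell z) ?_
    refine (hcomp_assoc_nil θ θ' y).symm.trans ?_
    exact (congrArg (fun z => hcomp z y) e₁).trans (id_hcomp y)
  · rw [← hu (hcomp θ x) ((key x).symm.trans hx)]
    refine Eq.symm ((hcomp_assoc_nil θ' θ x).symm.trans ?_)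
    exact (congrArg (fun z => hcomp z x) e₂).trans (id_hcomp x)

/-- `E(j, -)` is functorial on 2-cells between tight-cells, so an isomorphism of cocones makes the
two nerve 2-cells differ by an invertible 2-cell. -/
theorem Cocone.isOpcartesian_nerveCell_of_iso {A E Z Y : X} {j : A ⟶ E} {p : Loose Z Y}
    {f : Z ⟶ E} {K K' : Cocone p f}
    (h : IsOpcartesian (K.nerveCell j)) {θ : HCell K.pt K'.pt (.nil Y)}
    {θ' : HCell K'.pt K.pt (.nil Y)}
    (e : hcomp K.cell θ = K'.cell) (e₁ : hcomp θ θ' = idH K.pt) (e₂ : hcomp θ' θ = idH K'.pt) :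
    IsOpcartesian (K'.nerveCell j) := by
  have key : ∀ {a b c : Y ⟶ E} (σ : HCell a b (.nil Y)) (σ' : HCell b c (.nil Y)),
      paste (Cells.single (homLift j b (𝟙 A) (𝟙 Y) (Category.id_comp _) (Category.id_comp _)
        (hcomp (homCell j a) σ))) (homLift j c (𝟙 A) (𝟙 Y) (Category.id_comp _)
        (Category.id_comp _) (hcomp (homCell j b) σ')) (Category.id_comp _) (Category.id_comp _) =
      homLift j c (𝟙 A) (𝟙 Y) (Category.id_comp _) (Category.id_comp _)
        (hcomp (homCell j a) (hcomp σ σ')) := by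
    intro a b c σ σ'
    refine (paste_homLift j c (Category.id_comp _) (Category.id_comp _) _ _ (Category.id_comp _)
      (Category.id_comp _) (Category.id_comp _) (Category.id_comp _) (Category.id_comp _)
      (Category.id_comp _)).trans ?_
    congr 1
    refine (paste_cons_hcomp _ (homCell j b) σ').trans ?_
    rw [homLift_spec]
    exact hcomp_assoc_single (homCell j a) σ σ'
  have hid : ∀ a : Y ⟶ E, homLift j a (𝟙 A) (𝟙 Y) (Category.id_comp _) (Category.id_comp _)
      (hcomp (homCell j a) (idH a)) = idCell (hom j a) := fun a =>
    (congrArg (homLift j a (𝟙 A) (𝟙 Y) (Category.id_comp _) (Category.id_comp _))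
      (hcompNil_idH (homCell j a))).trans (homLift_homCell j a)
  have h₁ : K'.nerveCell j = paste (Cells.single (K.nerveCell j)) (homLift j K'.pt (𝟙 A) (𝟙 Y)
      (Category.id_comp _) (Category.id_comp _) (hcomp (homCell j K.pt) θ)) (Category.id_comp _)
      (Category.id_comp _) := by
    refine Eq.symm ((paste_homLift j K'.pt (Category.id_comp _) (Category.id_comp _) _ _
      (Category.id_comp _) (Category.id_comp _) (Category.id_comp _) (Category.id_comp _)
      (Category.id_comp _) (Category.id_comp _)).trans ?_)
    refine congrArg (homLift j K'.pt (𝟙 A) (𝟙 Y) (Category.id_comp _) (Category.id_comp _)) ?_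
    refine (K.paste_nerveCell_homCell_hcomp θ).trans ?_
    exact congrArg (fun x => hcomp (homCell j f) x) e
  rw [h₁]
  refine @IsOpcartesian.paste_isIsoCell _ _ _ _ _ _ _ _ h _ ⟨homLift j K.pt (𝟙 A) (𝟙 Y)
    (Category.id_comp _) (Category.id_comp _) (hcomp (homCell j K'.pt) θ'), ?_, ?_⟩
  · rw [key, e₁, hid]
  · rw [key, e₂, hid]

/-! ### The comparison tight-cell -/

theorem postcomp_idCell {D E : X} (r : D ⟶ E) {k : D ⟶ E} (hk : 𝟙 D ≫ r = k) :
    postcomp (idCell (one D)) r hk hk = mapCell k := by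
  rw [← postcomp_mapCell (𝟙 D) r hk, mapCell_id]

namespace LeftRelativeAdjoint

variable {A D E : X} {j : A ⟶ E} {r : D ⟶ E} (L : LeftRelativeAdjoint j r)

theorem paste_toC {Y Y' : X} {b : Y ⟶ D} {P : LChain A Y} {m : Y ⟶ E} (hm : b ≫ r = m)
    (φ : HCell j m P) {y : Y' ⟶ Y} {P' : LChain A Y'} (Θ : Cells (𝟙 A) y P' P) {b' : Y' ⟶ D}
    (hb : y ≫ b = b') {m' : Y' ⟶ E} (hm' : y ≫ m = m') (hm'' : b' ≫ r = m') :
    paste Θ (L.toC hm φ) (Category.id_comp _) hb =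
      L.toC hm'' (paste Θ φ (Category.id_comp _) hm') := by
  unfold toC
  rw [paste_single Θ _ (Category.id_comp _) hb _ _ _ _ _ (Category.id_comp _)
    (Category.comp_id _), paste_homLift j r (Category.id_comp _) hm φ Θ (Category.id_comp _) hb
    (Category.id_comp _) hm' (Category.id_comp _) hm'']

theorem act_postcomp_toC {Y : X} {b : Y ⟶ D} {P : LChain A Y} {m : Y ⟶ E} (hm : b ≫ r = m)
    (φ : HCell j m P) :
    act (postcomp (L.toC (Category.id_comp r) (homCell j r)) r rfl (Category.id_comp r)) b hm φ =
      postcomp (L.toC hm φ) r rfl hm := by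
  unfold act
  rw [paste_postcomp _ _ r rfl (Category.id_comp r) (Category.id_comp _) (Category.comp_id b)
    (Category.id_comp _) hm rfl hm, L.paste_toC (Category.id_comp r) (homCell j r) _
    (Category.comp_id b) hm hm, homLift_spec]

/-- The right adjoint of a relative adjunction is an algebra for the induced relative monad. -/
noncomputable def algebra : L.monad.Algebra D where
  e := r
  op := postcomp (L.toC (Category.id_comp r) (homCell j r)) r rfl (Category.id_comp r)
  unit_op := by
    have h := L.toE_eq (L.toC (Category.id_comp r) (homCell j r)) (Category.id_comp r)
    rw [toE_toC] at h
    exact h.symm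
  op_op := by
    refine (L.act_postcomp_toC (Category.id_comp r) _).trans ?_
    have h := L.toC_hcomp (rfl : L.l ≫ r = L.l ≫ r) (Category.id_comp r)
      (homCell j (L.l ≫ r)) (L.toC (Category.id_comp r) (homCell j r))
    exact (congrArg (fun x => postcomp x r rfl (Category.id_comp r)) h).trans
      (postcomp_hcomp _ _ r rfl rfl (Category.id_comp r))

/-- Restricting the algebra `r` along `l` gives the free algebra, so `l ≫ c` mediates the free
algebra automatically. -/
theorem isComparison_of_mediates {C : X} {U : L.monad.Algebra C} {c : D ⟶ C}
    (hc : RelativeMonad.Mediates U L.algebra c) : IsComparison L U c := by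
  obtain ⟨h, -⟩ := id hc
  have h' : (L.l ≫ c) ≫ U.e = L.l ≫ r := by rw [Category.assoc, h]; rfl
  refine ⟨h, L.l ≫ c, ⟨h', ?_⟩, rfl⟩
  refine (hc.act_op (rfl : L.l ≫ r = L.l ≫ r) (homCell j (L.l ≫ r)) rfl h').symm.trans ?_
  exact L.act_postcomp_toC rfl _

/-- A triangle identity exhibiting `E(j, r)` as the companion of `l`. By equivariance it reduces to
the unit law of the algebra `r`. -/
theorem companion {ρ : Cell (𝟙 A) (𝟙 D) (.cons (hom j r) (.single (one D))) (hom j r)}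
    (hρ : paste (Cells.cons (idCell (hom j r)) (Cells.single (oneCell D)) rfl) ρ
      (Category.id_comp _) (Category.id_comp _) = idCell (hom j r)) :
    paste (Cells.cons (homLift j r (𝟙 A) L.l (Category.id_comp _) rfl L.unit)
      (Cells.single (L.toC (Category.id_comp r) (homCell j r))) rfl) ρ (Category.id_comp _)
      (Category.id_comp _) = idCell (hom j r) := by
  refine homLift_unique (Category.id_comp _) (Category.id_comp _) ?_
  rw [paste_idCell_single, ← paste_single _ ρ (Category.id_comp _) (Category.id_comp _)
    (homCell j r) (Category.id_comp _) (Category.id_comp _) (Category.id_comp _)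
    (Category.id_comp _) (Category.id_comp _) (Category.id_comp _),
    rightAction_paste hρ (homCell j r) (mapCell r) (mapCell_spec r)]
  refine (paste_hcomp (Cells.single (homLift j r (𝟙 A) L.l (Category.id_comp _) rfl L.unit))
    (homCell j r) (Cells.single (L.toC (Category.id_comp r) (homCell j r))) (mapCell r)
    (Category.id_comp _) rfl (Category.id_comp _)).trans ?_
  rw [homLift_spec]
  exact L.algebra.unit_op

/-- The case `q = D(1, 1)` of `isOpcartesian_of_companion`, where the nerve 2-cell is the right
action on `E(j, r)` and both triangles coincide. The auxiliary `r'` lets the result be used for `𝟙 D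
≫ r`, which is equal but not syntactically identical to `r`. -/
theorem isOpcartesian_nerveCell_one (L : LeftRelativeAdjoint j r) {r' : D ⟶ E} (hr : r' = r) :
    IsOpcartesian (Cocone.nerveCell j (⟨r', mapCell r'⟩ : Cocone (one D) r')) := by
  subst r
  have hρ : paste (Cells.cons (idCell (hom j r')) (Cells.single (oneCell D)) rfl)
      (Cocone.nerveCell j (⟨r', mapCell r'⟩ : Cocone (one D) r'))
      (Category.id_comp _) (Category.id_comp _) = idCell (hom j r') := by
    refine (paste_homLift j r' (Category.id_comp _) (Category.id_comp _) _ _ (Category.id_comp _)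
      (Category.id_comp _) (Category.id_comp _) (Category.id_comp _) (Category.id_comp _)
      (Category.id_comp _)).trans (Eq.trans ?_ (homLift_homCell j r'))
    refine congrArg (homLift j r' (𝟙 A) (𝟙 D) (Category.id_comp _) (Category.id_comp _)) ?_
    refine (paste_hcomp (Cells.single (idCell (hom j r'))) (homCell j r')
      (Cells.single (oneCell D)) (mapCell r') (Category.id_comp _) (Category.id_comp _)
      (Category.id_comp _)).trans ?_
    rw [paste_idCell_single, mapCell_spec]
    exact hcompNil_idH (homCell j r')
  refine @isOpcartesian_of_companion _ _ _ _ _ _ _ _ _ _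
    (homLift j r' (𝟙 A) L.l (Category.id_comp _) rfl L.unit)
    (L.toC (Category.id_comp r') (homCell j r')) _
    (L.toC (Category.id_comp r') (homCell j r')) _ hρ _ (mul_left D) (L.companion hρ)
    (L.companion hρ) ?_
  exact rightAction_paste hρ _ (idCell (one D))
    ((VirtualDoubleCategory.paste_id (oneCell D)).trans (idH_id D).symm)

/-- The case `q = C(c, 1)`, `q' = E(j, u)`: the algebra object makes `E(j, u)` the restriction of
`C(c, 1)` along `l`. -/
theorem isOpcartesian_nerveCell_comparison {C : X} {U : L.monad.Algebra C}
    (hU : RelativeMonad.IsAlgebraObject U) {c : D ⟶ C}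
    (hc : RelativeMonad.Mediates U L.algebra c) {r' : D ⟶ E} (hr : r' = r) (h : c ≫ U.e = r') :
    IsOpcartesian (Cocone.nerveCell j (⟨U.e, postcomp (homCell c (𝟙 C)) U.e h
      (Category.id_comp _)⟩ : Cocone (hom c (𝟙 C)) r')) := by
  subst r
  obtain ⟨ρ, hρ⟩ := exists_rightAction (hom j r')
  obtain ⟨ν, hν⟩ := exists_leftAction (hom c (𝟙 C))
  have hlc : RelativeMonad.Mediates U L.monad.free (L.l ≫ c) := by
    obtain ⟨_, fT, hf, e⟩ := L.isComparison_of_mediates hc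
    rwa [e]
  have hlc' : (L.l ≫ c) ≫ U.e = L.l ≫ r' := hlc.choose
  -- The associativity law of `U` says that its extension operator is a graded morphism from the
  -- free algebra to `U`. It thus lifts to `ξ : E(j, u) ⇒ C(l ≫ c, 1)`, from which the 2-cell to
  -- `C(c, 1)` is obtained.
  obtain ⟨ξ, hξ, -⟩ := hU.cell L.monad.free U (L.l ≫ c) (𝟙 C) hlc
    (RelativeMonad.Mediates.refl U) hlc' (Category.id_comp _) U.op U.op_op
  replace hξ : postcomp (k := L.l ≫ r') (k' := U.e) ξ U.e hlc' (Category.id_comp _) = U.op := hξ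
  refine @isOpcartesian_of_companion _ _ _ _ _ _ _ _ _ _
    (homLift j r' (𝟙 A) L.l (Category.id_comp _) rfl L.unit)
    (L.toC (Category.id_comp r') (homCell j r')) _
    (homLift c (𝟙 C) L.l (𝟙 C) rfl (Category.comp_id _) ξ) _ hρ _ hν (L.companion hρ) ?_ ?_
  · refine (paste_homLift j U.e (Category.id_comp _) (Category.id_comp _) _ _ (Category.id_comp _)
      (Category.id_comp _) (Category.id_comp _) (Category.id_comp _) (Category.id_comp _)
      (Category.id_comp _)).trans (Eq.trans ?_ (homLift_homCell j U.e))
    refine congrArg (homLift j U.e (𝟙 A) (𝟙 C) (Category.id_comp _) (Category.id_comp _)) ?_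
    refine (paste_hcomp (Cells.single (homLift j r' (𝟙 A) L.l (Category.id_comp _) rfl L.unit))
      (homCell j r') (Cells.single (homLift c (𝟙 C) L.l (𝟙 C) rfl (Category.comp_id _) ξ))
      (postcomp (homCell c (𝟙 C)) U.e h (Category.id_comp _)) (Category.id_comp _) rfl
      (Category.id_comp _)).trans ?_
    rw [homLift_spec, paste_postcomp (Cells.single (homLift c (𝟙 C) L.l (𝟙 C) rfl
      (Category.comp_id _) ξ)) (homCell c (𝟙 C)) U.e h (Category.id_comp _) rfl
      (Category.comp_id _) rfl (Category.id_comp _) hlc' (Category.id_comp _), homLift_spec, hξ]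
    exact U.unit_op
  -- Compared after applying the faithful `u`, the equation is naturality of the extension operator
  -- of `U`, together with the fact that `c` mediates the algebra `r`.
  · refine homLift_unique (f := c) (g := 𝟙 C) rfl (Category.id_comp _)
      (hU.postcomp_injective hlc' (Category.id_comp _) ?_)
    set κ := Cocone.nerveCell j (⟨U.e, postcomp (homCell c (𝟙 C)) U.e h
      (Category.id_comp _)⟩ : Cocone (hom c (𝟙 C)) r') with hκ
    rw [← paste_single (Cells.single κ) _ _ _ (homCell c (𝟙 C)) rfl (Category.comp_id _)
      (Category.id_comp _) (Category.id_comp _) rfl (Category.id_comp _), homLift_spec,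
      ← paste_postcomp (Cells.single κ) ξ U.e hlc' (Category.id_comp _) (Category.id_comp _)
      (Category.id_comp _) (Category.id_comp _) (Category.id_comp _) hlc' (Category.id_comp _), hξ,
      ← paste_single _ ν _ _ (homCell c (𝟙 C)) (Category.id_comp _) (Category.id_comp _) rfl
      (Category.id_comp _) rfl (Category.id_comp _),
      leftAction_paste hν (homCell c (𝟙 C)) (mapCell c) (mapCell_spec c)]
    have e₁ := paste_hcomp (Cells.single (L.toC (Category.id_comp r') (homCell j r'))) (mapCell c)
      (Cells.single (idCell (hom c (𝟙 C)))) (homCell c (𝟙 C)) rfl (Category.id_comp _)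
      (Category.id_comp _)
    rw [paste_idCell_single] at e₁
    refine Eq.trans ?_ (congrArg (fun x => postcomp x U.e hlc' (Category.id_comp _)) e₁.symm)
    refine Eq.trans ?_ (postcomp_hcomp (postcomp (L.toC (Category.id_comp r')
      (homCell j r')) c rfl (Category.id_comp _)) (homCell c (𝟙 C)) U.e hlc' h
      (Category.id_comp _)).symm
    refine Eq.trans (act_hcomp_postcomp U.op h (Category.id_comp _) (homCell j r')
      (homCell c (𝟙 C))) ?_
    refine congrArg (fun x => hcomp x (postcomp (homCell c (𝟙 C)) U.e h (Category.id_comp _))) ?_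
    obtain ⟨_, e₂⟩ := hc
    refine e₂.trans ?_
    exact (postcomp_postcomp _ c U.e h rfl (Category.id_comp _) hlc' h rfl
      (Category.id_comp _)).symm

end LeftRelativeAdjoint

end

section

variable {X : Type u} [VirtualDoubleCategory.{z, w, v, u} X] [VirtualEquipment X]

/-! ### Equivalences -/

theorem paste_nil_idH {A B C : X} (f : A ⟶ B) (a : B ⟶ C) {k : A ⟶ C} (hk : f ≫ a = k) :
    paste (Cells.nil f) (idH a) hk hk = idH k := by
  subst hk
  exact VirtualDoubleCategory.paste_assoc (TwoLevel.nil f a rfl) (oneCell C)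
    (Category.comp_id _) (Category.comp_id _) rfl rfl (Category.comp_id _) (Category.comp_id _)

theorem paste_nil_hcomp_eq_idH {A B C : X} (f : A ⟶ B) {a b : B ⟶ C} {θ : HCell a b (.nil B)}
    {θ' : HCell b a (.nil B)} (e : hcomp θ θ' = idH a) {k l : A ⟶ C} (hk : f ≫ a = k)
    (hl : f ≫ b = l) :
    hcomp (paste (Cells.nil f) θ hk hl) (paste (Cells.nil f) θ' hl hk) = idH k := by
  refine (paste_hcomp (Cells.nil f) θ (Cells.nil f) θ' hk hl hk).symm.trans ?_
  refine Eq.trans ?_ (paste_nil_idH f a hk)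
  exact congrArg (fun x => paste (Cells.nil f) x hk hk) e

theorem TightIso.of_eq {A B : X} {f g : A ⟶ B} (h : f = g) : TightIso f g := by
  subst h
  exact ⟨idH f, idH f, id_hcomp _, id_hcomp _⟩

/-- By naturality of `c ≫ d ≅ 1`, a 2-cell is recovered from its image under `c ≫ d`, hence from its
image under `c`. -/
theorem TightIso.postcomp_injective {A B A₀ A₁ : X} {c : A ⟶ B} {d : B ⟶ A}
    (h : TightIso (c ≫ d) (𝟙 A)) {f : A₀ ⟶ A} {f' : A₁ ⟶ A} {P : LChain A₀ A₁} {k : A₀ ⟶ B}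
    {k' : A₁ ⟶ B} (hk : f ≫ c = k) (hk' : f' ≫ c = k') {χ χ' : HCell f f' P}
    (e : postcomp χ c hk hk' = postcomp χ' c hk hk') : χ = χ' := by
  obtain ⟨φ, ψ, -, h₂⟩ := h
  have n := fun x : HCell f f' P => postcomp_naturality x φ (rfl : f ≫ c ≫ d = _)
    (Category.comp_id f) (rfl : f' ≫ c ≫ d = _) (Category.comp_id f')
  have e₁ : postcomp χ (c ≫ d) (rfl : f ≫ c ≫ d = _) (rfl : f' ≫ c ≫ d = _) =
      postcomp χ' (c ≫ d) rfl rfl := by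
    rw [← postcomp_postcomp χ c d rfl hk hk' (by rw [← hk, Category.assoc])
      (by rw [← hk', Category.assoc]), e, postcomp_postcomp χ' c d rfl]
  have e₂ := (n χ).symm.trans ((congrArg (fun x => hcompNil x (paste (Cells.nil f') φ
    (rfl : f' ≫ c ≫ d = _) (Category.comp_id f'))) e₁).trans (n χ'))
  rw [postcomp_id, postcomp_id] at e₂
  have e₃ := paste_nil_hcomp_eq_idH f h₂ (Category.comp_id f) (rfl : f ≫ c ≫ d = _)
  have e₄ : ∀ x : HCell f f' P, hcomp (paste (Cells.nil f) ψ (Category.comp_id f) rfl)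
      (hcomp (paste (Cells.nil f) φ (rfl : f ≫ c ≫ d = _) (Category.comp_id f)) x) = x := fun x =>
    (hcomp_assoc_nil _ _ x).symm.trans ((congrArg (fun y => hcomp y x) e₃).trans (id_hcomp x))
  rw [← e₄ χ, e₂, e₄ χ']

theorem IsTightEquivalence.postcomp_bijective {A B A₀ A₁ : X} {c : A ⟶ B}
    (h : IsTightEquivalence c) {f : A₀ ⟶ A} {f' : A₁ ⟶ A} (P : LChain A₀ A₁) {k : A₀ ⟶ B}
    {k' : A₁ ⟶ B} (hk : f ≫ c = k) (hk' : f' ≫ c = k') :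
    Function.Bijective (fun χ : HCell f f' P => postcomp χ c hk hk') := by
  obtain ⟨d, hcd, hdc⟩ := h
  refine ⟨fun χ χ' e => hcd.postcomp_injective hk hk' e, fun ω => ?_⟩
  obtain ⟨φ, ψ, h₁, h₂⟩ := id hcd
  have hm : k ≫ d = f ≫ c ≫ d := by rw [← hk, Category.assoc]
  have hm' : k' ≫ d = f' ≫ c ≫ d := by rw [← hk', Category.assoc]
  -- The preimage of `ω` is its image under `d`, conjugated by `c ≫ d ≅ 1`. That it maps to `ω` is
  -- checked after applying `d`, which is faithful because `d ≫ c ≅ 1`.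
  let χ₁ : HCell (f ≫ c ≫ d) f' P := hcompNil (postcomp ω d hm hm')
    (paste (Cells.nil f') φ rfl (Category.comp_id f'))
  let χ : HCell f f' P := hcomp (paste (Cells.nil f) ψ (Category.comp_id f) rfl) χ₁
  refine ⟨χ, hdc.postcomp_injective hm hm' ?_⟩
  beta_reduce
  rw [postcomp_postcomp χ c d rfl hk hk' hm hm' rfl rfl]
  have n := postcomp_naturality χ φ (rfl : f ≫ c ≫ d = _) (Category.comp_id f)
    (rfl : f' ≫ c ≫ d = _) (Category.comp_id f')
  rw [postcomp_id] at n
  have e₁ : hcomp (paste (Cells.nil f) φ (rfl : f ≫ c ≫ d = _) (Category.comp_id f)) χ = χ₁ := by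
    refine (hcomp_assoc_nil _ _ χ₁).symm.trans ?_
    refine (congrArg (fun y => hcomp y χ₁) (paste_nil_hcomp_eq_idH f h₁ rfl
      (Category.comp_id f))).trans (id_hcomp χ₁)
  have e₂ := paste_nil_hcomp_eq_idH f' h₁ rfl (Category.comp_id f')
  have e₃ := congrArg (fun y => hcompNil y (paste (Cells.nil f') ψ (Category.comp_id f') rfl))
    (n.trans e₁)
  exact (hcompNil_cancel _ e₂).symm.trans (e₃.trans (hcompNil_cancel _ e₂))

theorem IsTightEquivalence.exists_tightIso {A B V : X} {c : A ⟶ B} (h : IsTightEquivalence c)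
    (g : V ⟶ B) : ∃ g' : V ⟶ A, TightIso g (g' ≫ c) := by
  obtain ⟨d, -, φ, ψ, h₁, h₂⟩ := h
  exact ⟨g ≫ d, paste (Cells.nil g) ψ (Category.comp_id g) (Category.assoc _ _ _).symm,
    paste (Cells.nil g) φ (Category.assoc _ _ _).symm (Category.comp_id g),
    paste_nil_hcomp_eq_idH g h₂ _ _, paste_nil_hcomp_eq_idH g h₁ _ _⟩

theorem IsTightEquivalence.of_isIso {A B : X} (c : A ⟶ B) [IsIso c] : IsTightEquivalence c :=
  ⟨inv c, TightIso.of_eq (IsIso.hom_inv_id c), TightIso.of_eq (IsIso.inv_hom_id c)⟩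

theorem IsTightEquivalence.isColimit_of_map {A B Z Y : X} {c : A ⟶ B} (h : IsTightEquivalence c)
    {p : Loose Z Y} {f : Z ⟶ A} {K : Cocone p f} (hK : (K.map c).IsColimit) : K.IsColimit := by
  intro V g Q χ
  obtain ⟨y, hy, hu⟩ := hK (g ≫ c) Q (postcomp χ c rfl rfl)
  obtain ⟨x, rfl⟩ := (h.postcomp_bijective Q (rfl : K.pt ≫ c = _) (rfl : g ≫ c = _)).2 y
  have e : ∀ x : HCell K.pt g Q, postcomp (hcomp K.cell x) c rfl rfl =
      hcomp (K.map c).cell (postcomp x c rfl rfl) := fun x =>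
    postcomp_hcomp K.cell x c rfl rfl rfl
  refine ⟨x, (h.postcomp_bijective _ rfl rfl).1 ((e x).trans hy), fun x' hx' => ?_⟩
  refine (h.postcomp_bijective Q rfl rfl).1 (hu _ ?_)
  exact (e x').symm.trans (congrArg (fun y => postcomp y c rfl rfl) hx')

theorem IsTightEquivalence.isColimit_map {A B Z Y : X} {c : A ⟶ B} (h : IsTightEquivalence c)
    {p : Loose Z Y} {f : Z ⟶ A} {K : Cocone p f} (hK : K.IsColimit) : (K.map c).IsColimit := by
  intro V g Q χ
  -- Preservation, unlike reflection, has to test against every `g : V ⟶ B`; up to isomorphism it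
  -- suffices to take `g` of the form `g' ≫ c`.
  obtain ⟨g', θ, θ', h₁, h₂⟩ := h.exists_tightIso g
  obtain ⟨χ', hχ'⟩ := (h.postcomp_bijective (.cons p Q) (rfl : f ≫ c = _)
    (rfl : g' ≫ c = _)).2 (hcompNil χ θ)
  replace hχ' : postcomp χ' c rfl rfl = hcompNil χ θ := hχ'
  obtain ⟨y, hy, hu⟩ := hK g' Q χ'
  have e : ∀ x : HCell K.pt g' Q, postcomp (hcomp K.cell x) c rfl rfl =
      hcomp (K.map c).cell (postcomp x c rfl rfl) := fun x =>
    postcomp_hcomp K.cell x c rfl rfl rfl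
  refine ⟨hcompNil (postcomp y c rfl rfl) θ', ?_, fun x hx => ?_⟩
  · refine (hcomp_hcompNil (K.map c).cell (postcomp y c rfl rfl) θ').trans ?_
    refine Eq.trans ?_ (hcompNil_cancel χ h₁)
    refine congrArg (fun x => hcompNil x θ') ((e y).symm.trans (Eq.trans ?_ hχ'))
    exact congrArg (fun x => postcomp x c rfl rfl) hy
  · obtain ⟨x', hx'⟩ := (h.postcomp_bijective Q (rfl : K.pt ≫ c = _)
      (rfl : g' ≫ c = _)).2 (hcompNil x θ)
    replace hx' : postcomp x' c rfl rfl = hcompNil x θ := hx'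
    have e₁ : x' = y := by
      refine hu x' ((h.postcomp_bijective (.cons p Q) rfl rfl).1 ?_)
      refine (e x').trans (Eq.trans ?_ hχ'.symm)
      refine (congrArg (fun z => hcomp (K.map c).cell z) hx').trans ?_
      refine (hcomp_hcompNil (K.map c).cell x θ).trans ?_
      exact congrArg (fun z => hcompNil z θ) hx
    subst e₁
    exact (hcompNil_cancel x h₁).symm.trans (congrArg (fun z => hcompNil z θ') hx'.symm)

theorem IsTightEquivalence.exists_isColimit {A B Z Y : X} {c : A ⟶ B} (h : IsTightEquivalence c)
    {p : Loose Z Y} {f : Z ⟶ A} {K : Cocone p (f ≫ c)} (hK : K.IsColimit) :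
    ∃ K' : Cocone p f, K'.IsColimit := by
  obtain ⟨g, θ, θ', h₁, h₂⟩ := h.exists_tightIso K.pt
  obtain ⟨x, hx⟩ := (h.postcomp_bijective (.single p) (rfl : f ≫ c = _)
    (rfl : g ≫ c = _)).2 (hcomp K.cell θ)
  refine ⟨⟨g, x⟩, h.isColimit_of_map ?_⟩
  exact hK.of_iso (K' := Cocone.map ⟨g, x⟩ c) (θ := θ) (θ' := θ') hx.symm h₁ h₂

/-! ### Monadic tight-cells create absolute colimits -/

variable {A D E : X} {j : A ⟶ E} {r : D ⟶ E}

theorem StrictlyMonadic.creates (h : StrictlyMonadic j r) : StrictlyCreatesAbsolute j r := by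
  obtain ⟨L, C, U, hU, c, ⟨hc, -⟩, hi⟩ := h
  intro Z Y p f K hK ha
  have hf : (f ≫ c) ≫ U.e = f ≫ r := by rw [Category.assoc, hc]
  have hr : inv c ≫ r = U.e := by rw [IsIso.inv_comp_eq, hc]
  have hf' : (f ≫ c) ≫ inv c = f := by rw [Category.assoc, IsIso.hom_inv_id, Category.comp_id]
  obtain ⟨⟨x, k⟩, hx, hk, hcol, hu⟩ := hU.creates hf hK (Cocone.isAbsolute_iff.1 ha)
  have hx' : (x ≫ inv c) ≫ c = x := by rw [Category.assoc, IsIso.inv_hom_id, Category.comp_id]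
  have hxr : (x ≫ inv c) ≫ r = K.pt := by rw [Category.assoc, hr, hx]
  have he := IsTightEquivalence.of_isIso c
  -- `x ≫ inv c ≫ c` and `x` agree only propositionally, so the claim is stated for any `y` over
  -- `x`, which lets `x` be eliminated.
  have key : ∀ (y : Y ⟶ D) (hy : y ≫ c = x) (l : HCell f y (.single p)),
      postcomp l c rfl hy = k → (Cocone.mk y l).IsColimit := by
    rintro y rfl l rfl
    exact he.isColimit_of_map hcol
  have e₁ : postcomp (postcomp k (inv c) hf' rfl) c rfl hx' = k :=
    (postcomp_postcomp k (inv c) c (IsIso.inv_hom_id c) hf' rfl rfl hx' (Category.comp_id _)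
      (Category.comp_id _)).trans (postcomp_id k)
  refine ⟨⟨x ≫ inv c, postcomp k (inv c) hf' rfl⟩, ⟨?_, ?_⟩, key _ hx' _ e₁⟩
  · refine Cocone.map_eq_iff.2 ⟨hxr, ?_⟩
    exact (postcomp_postcomp k (inv c) r hr hf' rfl rfl hxr hf hx).trans hk
  · rintro ⟨y, l⟩ hl
    obtain ⟨hy, hl'⟩ := Cocone.map_eq_iff.1 hl
    have hyc : (y ≫ c) ≫ U.e = K.pt := by rw [Category.assoc, hc]; exact hy
    have e₂ := hu (y ≫ c) hyc (postcomp l c rfl rfl)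
      ((postcomp_postcomp l c U.e hc rfl rfl hf hyc rfl hy).trans hl')
    rw [Cocone.mk.injEq] at e₂
    obtain ⟨e₃, e₄⟩ := e₂
    subst e₃
    obtain rfl := eq_of_heq e₄
    have hyy : (y ≫ c) ≫ inv c = y := by
      rw [Category.assoc, IsIso.hom_inv_id, Category.comp_id]
    have e₅ := (postcomp_postcomp l c (inv c) (IsIso.hom_inv_id c) rfl rfl hf' hyy
      (Category.comp_id _) (Category.comp_id _)).trans (postcomp_id l)
    have key₂ : ∀ (y' : Y ⟶ D) (h : (y ≫ c) ≫ inv c = y') (h' : y' = y),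
        (⟨y, l⟩ : Cocone p f) = ⟨y', postcomp (postcomp l c rfl rfl) (inv c) hf' h⟩ := by
      rintro y' h rfl
      rw [e₅]
    exact key₂ _ rfl hyy

theorem NonstrictlyMonadic.creates (h : NonstrictlyMonadic j r) :
    NonstrictlyCreatesAbsolute j r := by
  obtain ⟨L, C, U, hU, c, ⟨hc, -⟩, he⟩ := h
  intro Z Y p f L₀ hL₀ ha
  have ho : IsOpcartesian (L₀.nerveCell j) := Cocone.isAbsolute_iff.1 ha
  have hf : (f ≫ c) ≫ U.e = f ≫ r := by rw [Category.assoc, hc]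
  have e₁ : ∀ (K : Cocone p f) (hK : (K.pt ≫ c) ≫ U.e = K.pt ≫ r),
      postcomp (K.map c).cell U.e hf hK = (K.map r).cell := fun K hK =>
    postcomp_postcomp K.cell c U.e hc rfl rfl hf hK rfl rfl
  have hpt : ∀ K : Cocone p f, (K.pt ≫ c) ≫ U.e = K.pt ≫ r := fun K => by
    rw [Category.assoc, hc]
  obtain ⟨K₀, hx, hk, hcol, -⟩ := hU.creates hf hL₀ ho
  refine ⟨fun K => ⟨fun hK => ?_, fun hK => ?_⟩, he.exists_isColimit hcol⟩
  -- If the image of `K` under `r` is a colimit, it is isomorphic to the given absolute one, hence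
  -- absolute. The cocone that `u` creates over it must be the image of `K` under `c`, and `c`
  -- reflects colimits.
  · obtain ⟨θ, θ', e, h₁, h₂⟩ := hL₀.exists_iso hK
    obtain ⟨K₁, -, -, hcol₁, hu₁⟩ := hU.creates hf hK
      (Cocone.isOpcartesian_nerveCell_of_iso ho e h₁ h₂)
    rw [← hu₁ (K.pt ≫ c) (hpt K) (K.map c).cell (e₁ K _)] at hcol₁
    exact he.isColimit_of_map hcol₁
  -- Conversely, the image of `K` under `c` is a colimit, hence isomorphic to the cocone created by
  -- `u`; applying `u` gives an isomorphism between the given colimit and the image of `K` under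
  -- `r`.
  · obtain ⟨θ, θ', e, h₁, h₂⟩ := hcol.exists_iso (he.isColimit_map hK)
    refine hL₀.of_iso (K' := K.map r) (θ := postcomp θ U.e hx (hpt K))
      (θ' := postcomp θ' U.e (hpt K) hx)
      ?_ ?_ ?_
    · refine Eq.trans ?_ (e₁ K (hpt K))
      refine Eq.trans ?_ (congrArg (fun y => postcomp y U.e hf (hpt K)) e)
      refine Eq.trans ?_ (postcomp_hcomp K₀.cell θ U.e hf hx (hpt K)).symm
      exact congrArg (fun y => hcomp y (postcomp θ U.e hx (hpt K))) hk.symm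
    · refine (postcomp_hcomp θ θ' U.e hx (hpt K) hx).symm.trans ?_
      exact (congrArg (fun y => postcomp y U.e hx hx) h₁).trans (postcomp_idH _ _ hx)
    · refine (postcomp_hcomp θ' θ U.e (hpt K) hx (hpt K)).symm.trans ?_
      exact (congrArg (fun y => postcomp y U.e (hpt K) (hpt K)) h₂).trans (postcomp_idH _ _ (hpt K))

end

noncomputable section

variable {X : Type u} [VirtualDoubleCategory.{z, w, v, u} X] [VirtualEquipment X]

/-! ### Tight-cells that create absolute colimits are monadic -/

namespace LeftRelativeAdjoint

variable {A D E : X} {j : A ⟶ E} {r : D ⟶ E} (L : LeftRelativeAdjoint j r) {C : X}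
  {U : L.monad.Algebra C} {c : D ⟶ C}

/-- The carrier of an algebra object, as a cocone for `r` weighted by `C(c, 1)`, where `c` is the
comparison tight-cell. -/
def carrierCocone (hc : RelativeMonad.Mediates U L.algebra c) : Cocone (hom c (𝟙 C)) (𝟙 D ≫ r) :=
  ⟨U.e, postcomp (homCell c (𝟙 C)) U.e (hc.choose.trans (Category.id_comp r).symm)
    (Category.id_comp _)⟩

/-- The 2-cell `D(1, 1) ⇒ C(c, c)`, regarded as a 2-cell into `C(c, 1)`. -/
def mapLift (c : D ⟶ C) : Cell (𝟙 D) c (.single (one D)) (hom c (𝟙 C)) :=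
  homLift c (𝟙 C) (𝟙 D) c (Category.id_comp _) (Category.comp_id _) (mapCell c)

/-- The restriction along `c` of a cocone weighted by `C(c, 1)`. -/
def restrictCocone {c : D ⟶ C} (K : Cocone (hom c (𝟙 C)) (𝟙 D)) : Cocone (one D) (𝟙 D) :=
  ⟨c ≫ K.pt, paste (Cells.single (mapLift c)) K.cell (Category.id_comp _) rfl⟩

variable (hc : RelativeMonad.Mediates U L.algebra c)

theorem isOpcartesian_carrierCocone (hU : RelativeMonad.IsAlgebraObject U) :
    IsOpcartesian ((L.carrierCocone hc).nerveCell j) :=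
  L.isOpcartesian_nerveCell_comparison hU hc (Category.id_comp r) _

/-- This ties the two absolute colimits together: restricting the `C(c, 1)`-weighted cocone `u`
along `c` yields the `D(1, 1)`-weighted cocone `r`. -/
theorem paste_mapLift_carrierCocone (h : c ≫ U.e = 𝟙 D ≫ r) :
    paste (Cells.single (mapLift c)) (L.carrierCocone hc).cell (Category.id_comp _) h =
      mapCell (𝟙 D ≫ r) := by
  refine (paste_postcomp (Cells.single (mapLift c)) (homCell c (𝟙 C)) U.e h (Category.id_comp _)
    (Category.id_comp _) (Category.comp_id _) (Category.id_comp _) h h h).trans ?_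
  rw [mapLift, homLift_spec, postcomp_mapCell]

theorem idCocone_map : (Cocone.mk (𝟙 D) (idCell (one D))).map r =
    (⟨𝟙 D ≫ r, mapCell (𝟙 D ≫ r)⟩ : Cocone (one D) (𝟙 D ≫ r)) :=
  Cocone.map_eq_iff.2 ⟨rfl, postcomp_idCell r rfl⟩

theorem restrictCocone_map_cell (K : Cocone (hom c (𝟙 C)) (𝟙 D)) {m : C ⟶ E}
    (hm : K.pt ≫ r = m) {n : D ⟶ E} (hn : (c ≫ K.pt) ≫ r = n) :
    postcomp (restrictCocone K).cell r rfl hn =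
      paste (Cells.single (mapLift c)) (postcomp K.cell r rfl hm) (Category.id_comp _)
        (by rw [← hm, ← hn, Category.assoc]) :=
  (paste_postcomp (Cells.single (mapLift c)) K.cell r rfl hm (Category.id_comp _) rfl
    (Category.id_comp _) _ rfl hn).symm

theorem comp_carrier (hc : RelativeMonad.Mediates U L.algebra c)
    (K : Cocone (hom c (𝟙 C)) (𝟙 D)) : (K.pt ≫ c) ≫ U.e = K.pt ≫ r := by
  rw [Category.assoc, hc.choose]
  rfl

theorem isGradedMorphism_carrierCocone :
    RelativeMonad.IsGradedMorphism
      (U.restrict c (hc.choose.trans (Category.id_comp r).symm)) U (L.carrierCocone hc).cell :=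
  RelativeMonad.isGradedMorphism_postcomp (U.restrict_mediates c _)
    (RelativeMonad.Mediates.refl U) _ (Category.id_comp _) (homCell c (𝟙 C))

theorem isGradedMorphism_map_cell (K : Cocone (hom c (𝟙 C)) (𝟙 D)) {m : C ⟶ E}
    (hm : K.pt ≫ r = m) (h : (K.pt ≫ c) ≫ U.e = m) :
    RelativeMonad.IsGradedMorphism (U.restrict c (hc.choose.trans (Category.id_comp r).symm))
      (U.restrict (K.pt ≫ c) h) (postcomp K.cell r rfl hm) := by
  have e := postcomp_postcomp K.cell c U.e hc.choose (Category.id_comp c) rfl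
    (hc.choose.trans (Category.id_comp r).symm) h rfl hm
  have g := RelativeMonad.isGradedMorphism_postcomp
    (U.restrict_mediates c (hc.choose.trans (Category.id_comp r).symm))
    (U.restrict_mediates (K.pt ≫ c) h) (hc.choose.trans (Category.id_comp r).symm) h
    (postcomp K.cell c (Category.id_comp c) rfl)
  exact Eq.mp (congrArg (fun x => RelativeMonad.IsGradedMorphism (U.restrict c
    (hc.choose.trans (Category.id_comp r).symm)) (U.restrict (K.pt ≫ c) h) x) e) g

theorem strictlyMonadic (hc : RelativeMonad.Mediates U L.algebra c) (hj : Dense j)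
    (hU : RelativeMonad.IsAlgebraObject U) (h : StrictlyCreatesAbsolute j r) :
    StrictlyMonadic j r := by
  have ho : IsOpcartesian ((L.carrierCocone hc).nerveCell j) :=
    L.isOpcartesian_carrierCocone hc hU
  have ho₁ : IsOpcartesian (Cocone.nerveCell j
    (⟨𝟙 D ≫ r, mapCell (𝟙 D ≫ r)⟩ : Cocone (one D) (𝟙 D ≫ r))) :=
    L.isOpcartesian_nerveCell_one (Category.id_comp r)
  obtain ⟨K, ⟨hK, -⟩, -⟩ := h (hom c (𝟙 C)) (𝟙 D) (L.carrierCocone hc) (hj.isColimit ho)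
    (Cocone.isAbsolute_iff.2 ho)
  obtain ⟨hm, hKc⟩ := Cocone.map_eq_iff.1 hK
  have hu : (K.pt ≫ c) ≫ U.e = U.e := (L.comp_carrier hc K).trans hm
  -- The inverse of the comparison is the vertex of the cocone created over `u`.
  refine ⟨L, C, U, hU, c, L.isComparison_of_mediates hc, ⟨K.pt, ?_, ?_⟩⟩
  -- The restriction of `K` along `c` and the identity cocone have the same image under `r`, so
  -- uniqueness in the creation of the `D(1, 1)`-weighted colimit identifies them, and hence their
  -- vertices.
  · obtain ⟨K₁, ⟨-, hK₁⟩, -⟩ := h (one D) (𝟙 D) _ (hj.isColimit ho₁)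
      (Cocone.isAbsolute_iff.2 ho₁)
    have hn : (c ≫ K.pt) ≫ r = 𝟙 D ≫ r := by
      rw [Category.assoc, hm]
      exact hc.choose.trans (Category.id_comp r).symm
    have e₁ := hK₁ (restrictCocone K) (Cocone.map_eq_iff.2 ⟨hn, by
      rw [restrictCocone_map_cell K hm hn, hKc]
      exact L.paste_mapLift_carrierCocone hc _⟩)
    have e₂ := hK₁ ⟨𝟙 D, idCell (one D)⟩ idCocone_map
    exact congrArg Cocone.pt (e₁.trans e₂.symm)
  -- Both `K.pt ≫ c` and the identity mediate `U`: their extension operators agree after pasting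
  -- with the nerve 2-cell, since both make the cocone of `u` graded.
  · refine (hU.tight U).unique ⟨hu, ?_⟩ (RelativeMonad.Mediates.refl U)
    refine IsLeftOpcartesian.ext (R := .nil C) (IsOpcartesian.isLeftOpcartesian ho) ?_
    have e₁ := L.isGradedMorphism_map_cell hc K hm hu
    replace e₁ := Eq.mp (congrArg (fun x => RelativeMonad.IsGradedMorphism (U.restrict c
      (hc.choose.trans (Category.id_comp r).symm)) (U.restrict (K.pt ≫ c) hu) x) hKc) e₁
    exact e₁.trans (L.isGradedMorphism_carrierCocone hc).symm

theorem nonstrictlyMonadic (hc : RelativeMonad.Mediates U L.algebra c) (hj : Dense j)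
    (hU : RelativeMonad.IsAlgebraObject U) (h : NonstrictlyCreatesAbsolute j r) :
    NonstrictlyMonadic j r := by
  have ho : IsOpcartesian ((L.carrierCocone hc).nerveCell j) :=
    L.isOpcartesian_carrierCocone hc hU
  have ho₁ : IsOpcartesian (Cocone.nerveCell j
    (⟨𝟙 D ≫ r, mapCell (𝟙 D ≫ r)⟩ : Cocone (one D) (𝟙 D ≫ r))) :=
    L.isOpcartesian_nerveCell_one (Category.id_comp r)
  obtain ⟨hcr, K, hK⟩ := h (hom c (𝟙 C)) (𝟙 D) (L.carrierCocone hc) (hj.isColimit ho)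
    (Cocone.isAbsolute_iff.2 ho)
  obtain ⟨hcr₁, -⟩ := h (one D) (𝟙 D) _ (hj.isColimit ho₁) (Cocone.isAbsolute_iff.2 ho₁)
  obtain ⟨θ, θ', e, e₁, e₂⟩ := Cocone.IsColimit.exists_iso (hj.isColimit ho) ((hcr K).2 hK)
  have hu := L.comp_carrier hc K
  refine ⟨L, C, U, hU, c, L.isComparison_of_mediates hc, K.pt, ?_, ?_⟩
  · have hn : c ≫ U.e = 𝟙 D ≫ r := hc.choose.trans (Category.id_comp r).symm
    have hn' : c ≫ K.pt ≫ r = (c ≫ K.pt) ≫ r := (Category.assoc _ _ _).symm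
    -- Restricting the isomorphism `u ≅ K.pt ≫ r` along `c` identifies this cocone with the `D(1,
    -- 1)`-weighted colimit `r`. Creation then makes both `c ≫ K.pt` and the identity colimits in
    -- `D` of the same diagram.
    have h₁ : ((restrictCocone K).map r).IsColimit := by
      refine Cocone.IsColimit.of_iso (K' := (restrictCocone K).map r) (hj.isColimit ho₁)
        (θ := paste (Cells.nil c) θ hn hn')
        (θ' := paste (Cells.nil c) θ' hn' hn) ?_ (paste_nil_hcomp_eq_idH c e₁ _ _)
        (paste_nil_hcomp_eq_idH c e₂ _ _)
      have e₃ := paste_hcompNil (Cells.single (mapLift c)) (L.carrierCocone hc).cell θ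
        (Category.id_comp _) hn hn'
      rw [L.paste_mapLift_carrierCocone hc hn] at e₃
      refine e₃.symm.trans (Eq.trans ?_ (restrictCocone_map_cell K rfl rfl).symm)
      exact congrArg (fun x => paste (Cells.single (mapLift c)) x (Category.id_comp _) hn') e
    have h₂ : (Cocone.mk (𝟙 D) (idCell (one D))).IsColimit := (hcr₁ _).1 (by
      rw [idCocone_map]
      exact hj.isColimit ho₁)
    obtain ⟨φ, φ', -, h₃, h₄⟩ := Cocone.IsColimit.exists_iso ((hcr₁ _).1 h₁) h₂
    exact ⟨φ, φ', h₃, h₄⟩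
  -- The isomorphism `u ≅ (K.pt ≫ c) ≫ u` is graded because its composite with the cocone of `u` is.
  -- It and its inverse lift to the algebra object, giving `K.pt ≫ c ≅ 1`.
  · have hg : RelativeMonad.IsGradedMorphism U (U.restrict (K.pt ≫ c) hu) θ := by
      refine RelativeMonad.IsGradedMorphism.of_hcomp (L.isGradedMorphism_carrierCocone hc) ho ?_
      exact Eq.mp (congrArg (fun x => RelativeMonad.IsGradedMorphism (U.restrict c
        (hc.choose.trans (Category.id_comp r).symm)) (U.restrict (K.pt ≫ c) hu) x) e.symm)
        (L.isGradedMorphism_map_cell hc K rfl hu)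
    have hg' := hg.inverse e₁ e₂
    have m₁ := RelativeMonad.Mediates.refl U
    have m₂ := U.restrict_mediates (K.pt ≫ c) hu
    obtain ⟨φ, hφ, -⟩ := hU.cell _ _ _ _ m₁ m₂ (Category.id_comp _) hu θ hg
    obtain ⟨φ', hφ', -⟩ := hU.cell _ _ _ _ m₂ m₁ hu (Category.id_comp _) θ' hg'
    refine ⟨φ', φ, hU.postcomp_injective hu hu ?_,
      hU.postcomp_injective (Category.id_comp _) (Category.id_comp _) ?_⟩
    · refine (postcomp_hcomp φ' φ U.e hu (Category.id_comp _) hu).trans ?_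
      rw [postcomp_idH]
      exact (congrArg₂ (fun x y => hcomp x y) hφ' hφ).trans e₂
    · refine (postcomp_hcomp φ φ' U.e (Category.id_comp _) hu (Category.id_comp _)).trans ?_
      rw [postcomp_idH]
      exact (congrArg₂ (fun x y => hcomp x y) hφ hφ').trans e₁

end LeftRelativeAdjoint

/-! ### The monadicity criteria, for composites and for left-composites -/

variable {A D E : X} {j : A ⟶ E} {r : D ⟶ E}

theorem strictlyMonadic_iff (hj : Dense j) : StrictlyMonadic j r ↔
    (∃ L : LeftRelativeAdjoint j r, L.monad.HasAlgebraObject) ∧ StrictlyCreatesAbsolute j r := by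
  constructor
  · intro h
    obtain ⟨L, C, U, hU, -⟩ := id h
    exact ⟨⟨L, C, U, hU⟩, h.creates⟩
  · rintro ⟨⟨L, C, U, hU⟩, h⟩
    obtain ⟨c, hc, -⟩ := hU.tight L.algebra
    exact L.strictlyMonadic hc hj hU h

theorem nonstrictlyMonadic_iff (hj : Dense j) : NonstrictlyMonadic j r ↔
    (∃ L : LeftRelativeAdjoint j r, L.monad.HasAlgebraObject) ∧
      NonstrictlyCreatesAbsolute j r := by
  constructor
  · intro h
    obtain ⟨L, C, U, hU, -⟩ := id h
    exact ⟨⟨L, C, U, hU⟩, h.creates⟩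
  · rintro ⟨⟨L, C, U, hU⟩, h⟩
    obtain ⟨c, hc, -⟩ := hU.tight L.algebra
    exact L.nonstrictlyMonadic hc hj hU h

theorem strictlyCreatesLeftAbsolute_iff (h : LeftCompositesAreComposites j) :
    StrictlyCreatesLeftAbsolute j r ↔ StrictlyCreatesAbsolute j r :=
  ⟨fun H _ _ p f K hK ha => H p f K hK ha.isLeftAbsolute,
    fun H _ _ p f K hK ha => H p f K hK ((Cocone.isLeftAbsolute_iff h).1 ha)⟩

theorem nonstrictlyCreatesLeftAbsolute_iff (h : LeftCompositesAreComposites j) :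
    NonstrictlyCreatesLeftAbsolute j r ↔ NonstrictlyCreatesAbsolute j r :=
  ⟨fun H _ _ p f K hK ha => H p f K hK ha.isLeftAbsolute,
    fun H _ _ p f K hK ha => H p f K hK ((Cocone.isLeftAbsolute_iff h).1 ha)⟩

end

end FormalCat

theorem mainTheorem2 {X : Type u} [FormalCat.VirtualDoubleCategory.{z, w, v, u} X]
    [FormalCat.VirtualEquipment X] {A E D : X} (j : A ⟶ E) (hj : FormalCat.Dense j) (r : D ⟶ E) :
    (FormalCat.StrictlyMonadic j r ↔
      (∃ L : FormalCat.LeftRelativeAdjoint j r, L.monad.HasAlgebraObject) ∧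
        FormalCat.StrictlyCreatesAbsolute j r) ∧
    (FormalCat.NonstrictlyMonadic j r ↔
      (∃ L : FormalCat.LeftRelativeAdjoint j r, L.monad.HasAlgebraObject) ∧
        FormalCat.NonstrictlyCreatesAbsolute j r) ∧
    (FormalCat.LeftCompositesAreComposites j →
      (FormalCat.StrictlyMonadic j r ↔
        (∃ L : FormalCat.LeftRelativeAdjoint j r, L.monad.HasAlgebraObject) ∧
          FormalCat.StrictlyCreatesLeftAbsolute j r) ∧
      (FormalCat.NonstrictlyMonadic j r ↔
        (∃ L : FormalCat.LeftRelativeAdjoint j r, L.monad.HasAlgebraObject) ∧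
          FormalCat.NonstrictlyCreatesLeftAbsolute j r)) := by
  refine ⟨FormalCat.strictlyMonadic_iff hj, FormalCat.nonstrictlyMonadic_iff hj, fun h => ?_⟩
  rw [FormalCat.strictlyCreatesLeftAbsolute_iff h, FormalCat.nonstrictlyCreatesLeftAbsolute_iff h]
  exact ⟨FormalCat.strictlyMonadic_iff hj, FormalCat.nonstrictlyMonadic_iff hj⟩
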